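/- Let $S$ be a normal projective variety over $\mathbb{C}$, let $L$ be an ample Cartier divisor on $S$, and let $\Delta=\sum_i\delta_i\Delta_i$ be a finite sum of distinct prime divisors with rational coefficients $\delta_i\in[0,1]$. Let $X=\operatorname{Spec}\bigoplus_{k\ge 0}H^0(S,kL)$ be the cone over $S$, with vertex $x$ (the point of the ideal $\bigoplus_{k>0}H^0(S,kL)$). Let $\mu_S:\tilde S\to S$ be a proper birational morphism with $\tilde S$ smooth, let $\tilde\Delta_i$ be the strict transform of $\Delta_i$, and put $\tilde\Delta=\sum_i\delta_i\tilde\Delta_i$. Let $\pi_{\tilde S}:\tilde X\to\tilde S$ be the total space of the line bundle $\mu_S^*L^{-1}$, let $\mu_X:\tilde X\to X$ be the natural morphism, and put $E_x=\mu_X^{-1}(x)$ (the zero section) and $\tilde D=\sum_i\delta_i\,\pi_{\tilde S}^{-1}(\tilde\Delta_i)$. Let $H=\sum_k H_k$ be a reduced divisor on $\tilde S$ such that the divisors $\tilde\Delta_i$ and $H_k$ together have simple normal crossings, let $N\ge 1$ be an integer with $N\delta_i\in\mathbb{Z}$ for all $i$, and let $\sigma:S'\to\tilde S$ be a Kawamata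 covering with ramification index $N$, that is, a finite surjective Galois covering by a smooth variety $S'$ such that (i) $\sigma$ is étale over the complement of $\operatorname{supp}\bigl(\sum_i\tilde\Delta_i+H\bigr)$; (ii) the preimages of the $\tilde\Delta_i$ and the $H_k$ together form a simple normal crossing divisor; (iii) near each closed point of $S'$ and its image there are local coordinates $w_1,\dots,w_n$ and $z_1,\dots,z_n$ such that those of the $\tilde\Delta_i$, $H_k$ that pass through the image point are given by distinct coordinates $z_j$, for these $j$ one has $\sigma^*z_j=w_j^N$ up to a unit, and $\sigma^*z_j=w_j$ for the other $j$. Let $\tilde Y=S'\times_{\tilde S}\tilde X$, with the projections $\pi:\tilde Y\to S'$ and $\sigma_{\tilde X}:\tilde Y\to\tilde X$ and the zero section $i_0:S'\to\tilde Y$. Let $\Omega^1_{S'}(\log B)=\sigma^*\Omega^1_{\tilde S}(\log\tilde\Delta)$ be the pulled-back orbifold cotangent sheaf: the $\mathcal{O}_{S'}$-submodule of the sheaf of rational $1$-forms on $S'$ generated locally by $\sigma^*\Omega^1_{\tilde S}$ and the forms $w^{-e\delta_i}\,d(\sigma^*z)$, where $z$ is a local equation of $\tilde\Delta_i$, $w$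 is a local equation of $\sigma^{-1}(\tilde\Delta_i)$, and $\sigma^*z=u\,w^e$ with a unit $u$. (Where $\sigma^*z=w^N$, the last form is $N\,w^{-d}dw$ with $d=1-N+N\delta_i$.) Let $\Omega^1_{\tilde Y}(\log G)=\sigma_{\tilde X}^*\Omega^1_{\tilde X}(\log(\tilde D+E_x))$ be defined in the same way from $\sigma_{\tilde X}$, the divisors $\pi_{\tilde S}^{-1}(\tilde\Delta_i)$ with the coefficients $\delta_i$, and the divisor $E_x$ with the coefficient $1$. Then pull-back of differential forms along $\pi$ maps $\Omega^1_{S'}(\log B)$ into $\Omega^1_{\tilde Y}(\log G)$, and there is a short exact sequence of $\mathcal{O}_{\tilde Y}$-modules $$0\to\pi^*\Omega^1_{S'}(\log B)\to\Omega^1_{\tilde Y}(\log G)\to\mathcal{O}_{\tilde Y}\to 0\qquad(1)$$ whose first map is this pull-back of forms. Put $\mathscr{E}^\vee=i_0^*\,\Omega^1_{\tilde Y}(\log G)$. Restricting (1) to the zero section gives a short exact sequence of $\mathcal{O}_{S'}$-modules $$0\to\Omega^1_{S'}(\log B)\to\mathscr{E}^\vee\to\mathcal{O}_{S'}\to 0,\qquad(2)$$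 and (1) is the pull-back of (2) along $\pi$: there is an isomorphism $\pi^*\mathscr{E}^\vee\cong\Omega^1_{\tilde Y}(\log G)$ that is compatible with the maps of (1) and of the pull-back of (2). Finally, the extension class of (2), i.e. the image of $1$ under the connecting map $H^0(S',\mathcal{O}_{S'})\to H^1(S',\Omega^1_{S'}(\log B))$, is $\Phi(c_1(\mu_S^*L))$, where $c_1(\mu_S^*L)\in H^1(\tilde S,\mathcal{O}^*_{\tilde S})$ is the class of the line bundle $\mu_S^*L$ and $\Phi$ is the composition $$H^1(\tilde S,\mathcal{O}_{\tilde S}^*)\xrightarrow{\ d\log\ }H^1(\tilde S,\Omega^1_{\tilde S})\xrightarrow{\ \sigma^*\ }H^1(S',\sigma^*\Omega^1_{\tilde S})\xrightarrow{\ \phi\ }H^1(S',\Omega^1_{S'}(\log B)),$$ in which $\phi$ is induced by the natural map $\sigma^*\Omega^1_{\tilde S}\to\Omega^1_{S'}(\log B)$. -/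

import Mathlib

open CategoryTheory AlgebraicGeometry TopologicalSpace Opposite
open scoped KaehlerDifferential

noncomputable section

namespace LogCone

/-- The base: `Spec ℂ`. -/
abbrev SpecC : Scheme.{0} := Spec (CommRingCat.of ℂ)

section Basic

variable {X : Scheme.{0}}

/-- Local rings of a scheme over `ℂ` are `ℂ`-algebras. -/
instance stalkAlgebra [X.Over SpecC] (x : X) : Algebra ℂ (X.presheaf.stalk x) :=
  ((X.presheaf.germ ⊤ x (Opens.mem_top x)).hom.comp
    (((X ↘ SpecC).appTop).hom.comp (Scheme.ΓSpecIso (CommRingCat.of ℂ)).inv.hom)).toAlgebra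

instance stalkTower [X.Over SpecC] [IsIntegral X] (x : X) :
    IsScalarTower ℂ (X.presheaf.stalk x) X.functionField := by
  refine IsScalarTower.of_algebraMap_eq fun r => ?_
  exact (ConcreteCategory.congr_hom (TopCat.Presheaf.germ_stalkSpecializes X.presheaf
    (Opens.mem_top x) ((genericPoint_spec X).specializes trivial))
    ((X ↘ SpecC).appTop ((Scheme.ΓSpecIso (CommRingCat.of ℂ)).inv r))).symm

/-- A section of the structure sheaf, viewed in the function field (via its germ at `y`). -/
def toField [IsIntegral X] {U : X.Opens} (r : Γ(X, U)) (y : X) (hy : y ∈ U) : X.functionField :=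
  algebraMap (X.presheaf.stalk y) X.functionField (X.presheaf.germ U y hy r)

lemma toField_res [IsIntegral X] {U V : X.Opens} (i : U ⟶ V) (r : Γ(X, V)) (y : X) (hy : y ∈ U) :
    toField (X.presheaf.map i.op r) y hy = toField r y (i.le hy) := by
  simp only [toField]
  congr 1
  exact X.presheaf.germ_res_apply i y hy r

/-- The value in the function field does not depend on the point. -/
lemma toField_eq [IsIntegral X] {U : X.Opens} (r : Γ(X, U)) (y z : X) (hy : y ∈ U) (hz : z ∈ U) :
    toField r y hy = toField r z hz := by
  have : Nonempty U := ⟨⟨y, hy⟩⟩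
  rw [toField, toField, Scheme.algebraMap_germ_eq_germToFunctionField,
    Scheme.algebraMap_germ_eq_germToFunctionField]

end Basic

section Rational

variable {X : Scheme.{0}} [X.Over SpecC] [IsIntegral X]

/-- Rational differential `1`-forms on an integral scheme over `ℂ`. -/
abbrev RatForms (X : Scheme.{0}) [X.Over SpecC] [IsIntegral X] : Type := Ω[X.functionField⁄ℂ]

/-- A stalkwise prescribed family of modules of rational `1`-forms. -/
abbrev FormStalks (X : Scheme.{0}) [X.Over SpecC] [IsIntegral X] : Type :=
  ∀ x : X, Submodule (X.presheaf.stalk x) (RatForms X)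

/-- A function on `U` with values in rational forms is a section of the sheaf with stalks `N`
if locally it is given by one rational form that lies in all the prescribed stalks. -/
def IsFormSection (N : FormStalks X) {U : X.Opens} (s : U → RatForms X) : Prop :=
  ∀ y : U, ∃ V : X.Opens, y.1 ∈ V ∧ ∃ m : RatForms X, ∀ z : U, z.1 ∈ V → m ∈ N z.1 ∧ s z = m

/-- The group of sections over `U`. -/
def formSections (N : FormStalks X) (U : X.Opens) : AddSubgroup (U → RatForms X) where
  carrier := {s | IsFormSection N s}
  zero_mem' := fun _ => ⟨⊤, Opens.mem_top _, 0, fun z _ => ⟨zero_mem _, rfl⟩⟩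
  add_mem' := by
    intro a b ha hb y
    obtain ⟨V, hV, m, hm⟩ := ha y
    obtain ⟨W, hW, n, hn⟩ := hb y
    refine ⟨V ⊓ W, ⟨hV, hW⟩, m + n, fun z hz => ⟨add_mem (hm z hz.1).1 (hn z hz.2).1, ?_⟩⟩
    simp [(hm z hz.1).2, (hn z hz.2).2]
  neg_mem' := by
    intro a ha y
    obtain ⟨V, hV, m, hm⟩ := ha y
    exact ⟨V, hV, -m, fun z hz => ⟨neg_mem (hm z hz).1, by simp [(hm z hz).2]⟩⟩

lemma smul_isFormSection (N : FormStalks X) {U : X.Opens} (r : Γ(X, U)) (s : U → RatForms X)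
    (hs : IsFormSection N s) : IsFormSection N (fun y => toField r y.1 y.2 • s y) := by
  intro y
  obtain ⟨V, hV, m, hm⟩ := hs y
  refine ⟨V, hV, toField r y.1 y.2 • m, fun z hz => ⟨?_, ?_⟩⟩
  · rw [toField_eq r y.1 z.1 y.2 z.2, toField, algebraMap_smul]
    exact Submodule.smul_mem _ _ (hm z hz).1
  · change toField r z.1 z.2 • s z = _
    rw [toField_eq r y.1 z.1 y.2 z.2, (hm z hz).2]

instance formSectionsModule (N : FormStalks X) (U : X.Opens) :
    Module Γ(X, U) (formSections N U) where
  smul r s := ⟨fun y => toField r y.1 y.2 • s.1 y, smul_isFormSection N r s.1 s.2⟩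
  one_smul s := by
    apply Subtype.ext; funext y
    change toField (1 : Γ(X, U)) y.1 y.2 • s.1 y = s.1 y
    simp [toField]
  mul_smul a b s := by
    apply Subtype.ext; funext y
    change toField (a * b) y.1 y.2 • s.1 y = toField a y.1 y.2 • toField b y.1 y.2 • s.1 y
    simp [toField, mul_smul]
  smul_zero a := by
    apply Subtype.ext; funext y
    change toField a y.1 y.2 • (0 : RatForms X) = 0
    simp
  smul_add a s t := by
    apply Subtype.ext; funext y
    change toField a y.1 y.2 • (s.1 y + t.1 y) = toField a y.1 y.2 • s.1 y + toField a y.1 y.2 • t.1 y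
    simp
  add_smul a b s := by
    apply Subtype.ext; funext y
    change toField (a + b) y.1 y.2 • s.1 y = toField a y.1 y.2 • s.1 y + toField b y.1 y.2 • s.1 y
    simp [toField, add_smul]
  zero_smul s := by
    apply Subtype.ext; funext y
    change toField (0 : Γ(X, U)) y.1 y.2 • s.1 y = 0
    simp [toField]

/-- Restriction of sections. -/
def formRes (N : FormStalks X) {U V : X.Opens} (h : U ≤ V) :
    formSections N V →+ formSections N U where
  toFun s := ⟨fun y => s.1 ⟨y.1, h y.2⟩, fun y => by
    obtain ⟨W, hW, m, hm⟩ := s.2 ⟨y.1, h y.2⟩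
    exact ⟨W, hW, m, fun z hz => hm ⟨z.1, h z.2⟩ hz⟩⟩
  map_zero' := rfl
  map_add' _ _ := rfl

/-- The presheaf of abelian groups of sections. -/
def formPresheaf (N : FormStalks X) : TopCat.Presheaf Ab.{0} X where
  obj U := AddCommGrpCat.of (formSections N U.unop)
  map i := AddCommGrpCat.ofHom (formRes N i.unop.le)

instance (N : FormStalks X) (U : X.Opensᵒᵖ) :
    Module (X.ringCatSheaf.obj.obj U) ((formPresheaf N).obj U) :=
  formSectionsModule N U.unop

/-- The local predicate defining the sheaf. -/
def formPredicate (N : FormStalks X) : TopCat.LocalPredicate (fun _ : X => RatForms X) where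
  pred {U} s := IsFormSection N (U := U) s
  res {U V} i s hs y := by
    obtain ⟨W, hW, m, hm⟩ := hs ⟨y.1, i.le y.2⟩
    exact ⟨W, hW, m, fun z hz => hm ⟨z.1, i.le z.2⟩ hz⟩
  locality {U} s hs y := by
    obtain ⟨V, hV, i, h⟩ := hs y
    obtain ⟨W, hW, m, hm⟩ := h ⟨y.1, hV⟩
    exact ⟨V ⊓ W, ⟨hV, hW⟩, m, fun z hz => hm ⟨z.1, hz.1⟩ hz.2⟩

lemma formPresheaf_isSheaf (N : FormStalks X) :
    Presheaf.IsSheaf (Opens.grothendieckTopology X) (formPresheaf N) := by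
  refine (TopCat.Presheaf.isSheaf_iff_isSheaf_comp (forget Ab.{0}) (formPresheaf N)).mpr ?_
  refine TopCat.Presheaf.isSheaf_of_iso ?_ (TopCat.subpresheafToTypes.isSheaf (formPredicate N))
  exact NatIso.ofComponents (fun U => Iso.refl _) (fun i => rfl)

/-- The `𝒪_X`-module of rational `1`-forms whose germ at every point `x` lies in `N x`. -/
def formSheaf (N : FormStalks X) : X.Modules :=
  { val := PresheafOfModules.ofPresheaf (R := X.ringCatSheaf.obj) (formPresheaf N) (by
      intro U V i r m
      apply Subtype.ext; funext y
      change toField (U := U.unop) r y.1 _ • m.1 _ = toField (U := V.unop) (X.presheaf.map i r) y.1 _ • m.1 _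
      congr 1
      exact (toField_res i.unop r y.1 y.2).symm)
    isSheaf := formPresheaf_isSheaf N }

/-- The rational form underlying a section of `formSheaf N` near a point `y`. -/
def formValue {N : FormStalks X} {U : X.Opens} (s : Γ(formSheaf N, U)) (y : X) (hy : y ∈ U) :
    RatForms X :=
  (show formSections N U from s).1 ⟨y, hy⟩

end Rational

section Algebra

variable {K L : Type} [CommRing K] [CommRing L] [Algebra ℂ K] [Algebra ℂ L]

/-- The map on Kähler differentials over `ℂ` induced by a homomorphism of `ℂ`-algebras. -/
def kaehlerMap (φ : K →+* L) (h : ∀ c : ℂ, φ (algebraMap ℂ K c) = algebraMap ℂ L c) :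
    Ω[K⁄ℂ] →+ Ω[L⁄ℂ] :=
  letI := φ.toAlgebra
  haveI : IsScalarTower ℂ K L := .of_algebraMap_eq fun c => (h c).symm
  (KaehlerDifferential.map ℂ ℂ K L).toAddMonoidHom

lemma kaehlerMap_D (φ : K →+* L) (h : ∀ c : ℂ, φ (algebraMap ℂ K c) = algebraMap ℂ L c) (b : K) :
    kaehlerMap φ h (KaehlerDifferential.D ℂ K b) = KaehlerDifferential.D ℂ L (φ b) := by
  let _ := φ.toAlgebra
  have : IsScalarTower ℂ K L := .of_algebraMap_eq fun c => (h c).symm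
  exact KaehlerDifferential.map_D ℂ ℂ K L b

lemma kaehlerMap_smul (φ : K →+* L) (h : ∀ c : ℂ, φ (algebraMap ℂ K c) = algebraMap ℂ L c) (a : K)
    (m : Ω[K⁄ℂ]) : kaehlerMap φ h (a • m) = φ a • kaehlerMap φ h m := by
  let _ := φ.toAlgebra
  have : IsScalarTower ℂ K L := .of_algebraMap_eq fun c => (h c).symm
  refine ((KaehlerDifferential.map ℂ ℂ K L).map_smul a m).trans ?_
  exact (algebraMap_smul L a _).symm

end Algebra

section Functoriality

variable {X Y : Scheme.{0}} [IsIntegral X] [IsIntegral Y]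

lemma map_genericPoint (f : Y ⟶ X) [IsDominant f] : genericPoint X = f (genericPoint Y) := by
  refine ((genericPoint_spec X).eq ?_)
  have h := (genericPoint_spec Y).image f.continuous
  rw [Set.image_univ, f.denseRange.closure_range] at h
  exact h

/-- The pull-back of rational functions along a dominant morphism. -/
def fieldMap (f : Y ⟶ X) [IsDominant f] : X.functionField →+* Y.functionField :=
  (f.stalkMap (genericPoint Y)).hom.comp
    (X.presheaf.stalkSpecializes (specializes_of_eq (map_genericPoint f).symm)).hom

/-- The pull-back of a germ of a function, as a rational function on the source. -/
def pullGerm (f : Y ⟶ X) (y : Y) : X.presheaf.stalk (f y) →+* Y.functionField :=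
  (algebraMap (Y.presheaf.stalk y) Y.functionField).comp (f.stalkMap y).hom

lemma fieldMap_algebraMap (f : Y ⟶ X) [IsDominant f] (y : Y) (g : X.presheaf.stalk (f y)) :
    fieldMap f (algebraMap _ _ g) = pullGerm f y g := by
  have h := Scheme.Hom.stalkSpecializes_stalkMap f _ _ ((genericPoint_spec Y).specializes (y := y) trivial)
  have h' := ConcreteCategory.congr_hom h g
  refine Eq.trans ?_ h'
  simp only [fieldMap]
  change f.stalkMap _ (X.presheaf.stalkSpecializes _ (X.presheaf.stalkSpecializes _ g)) = f.stalkMap _ (X.presheaf.stalkSpecializes _ g)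
  congr 1
  exact ConcreteCategory.congr_hom (X.presheaf.stalkSpecializes_comp _ _) g

lemma fieldMap_toField (f : Y ⟶ X) [IsDominant f] {U : X.Opens} (r : Γ(X, U)) (y : Y)
    (hy : f y ∈ U) : fieldMap f (toField r (f y) hy) = toField (f.app U r) y hy := by
  refine (fieldMap_algebraMap f y _).trans
    (congrArg (algebraMap (Y.presheaf.stalk y) Y.functionField) ?_)
  exact Scheme.Hom.germ_stalkMap_apply f U y hy r

variable [X.Over SpecC] [Y.Over SpecC]

lemma pullGerm_complex (f : Y ⟶ X) [f.IsOver SpecC] (y : Y) (c : ℂ) :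
    pullGerm f y (algebraMap ℂ _ c) = algebraMap ℂ _ c := by
  have key : (f.stalkMap y).hom (algebraMap ℂ (X.presheaf.stalk (f y)) c) =
      algebraMap ℂ (Y.presheaf.stalk y) c := by
    refine (Scheme.Hom.germ_stalkMap_apply f ⊤ y (Opens.mem_top _)
      ((X ↘ SpecC).appTop ((Scheme.ΓSpecIso (CommRingCat.of ℂ)).inv c))).trans ?_
    change Y.presheaf.germ ⊤ _ _ (f.appTop _) =
      Y.presheaf.germ ⊤ _ _ ((Y ↘ SpecC).appTop _)
    congr 1
    have h : f ≫ (X ↘ SpecC) = Y ↘ SpecC := comp_over f SpecC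
    rw [← h, Scheme.Hom.comp_appTop]
    rfl
  rw [IsScalarTower.algebraMap_apply ℂ (Y.presheaf.stalk y) Y.functionField, pullGerm,
    RingHom.comp_apply]
  exact congrArg (algebraMap (Y.presheaf.stalk y) Y.functionField) key

lemma fieldMap_complex (f : Y ⟶ X) [IsDominant f] [f.IsOver SpecC] (c : ℂ) :
    fieldMap f (algebraMap ℂ _ c) = algebraMap ℂ _ c := by
  have h := fieldMap_algebraMap f (genericPoint Y)
    (algebraMap ℂ (X.presheaf.stalk (f (genericPoint Y))) c)
  rw [pullGerm_complex] at h
  rw [← h]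
  exact congrArg _ (IsScalarTower.algebraMap_apply ℂ (X.presheaf.stalk (f (genericPoint Y))) X.functionField c)

/-- The pull-back of rational differential forms along a dominant morphism over `ℂ`. -/
def formMap (f : Y ⟶ X) [IsDominant f] [f.IsOver SpecC] : RatForms X →+ RatForms Y :=
  kaehlerMap (fieldMap f) (fieldMap_complex f)

lemma formMap_D (f : Y ⟶ X) [IsDominant f] [f.IsOver SpecC] (b : X.functionField) :
    formMap f (KaehlerDifferential.D ℂ _ b) = KaehlerDifferential.D ℂ _ (fieldMap f b) :=
  kaehlerMap_D _ _ b

lemma formMap_smul (f : Y ⟶ X) [IsDominant f] [f.IsOver SpecC] (a : X.functionField)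
    (m : RatForms X) : formMap f (a • m) = fieldMap f a • formMap f m :=
  kaehlerMap_smul _ _ a m

/-- Pull-back of forms as a morphism of sheaves, when it respects the prescribed stalks. -/
def formHom (f : Y ⟶ X) [IsDominant f] [f.IsOver SpecC] (N : FormStalks X) (P : FormStalks Y)
    (h : ∀ y, ∀ m ∈ N (f y), formMap f m ∈ P y) :
    formSheaf N ⟶ (Scheme.Modules.pushforward f).obj (formSheaf P) :=
  SheafOfModules.Hom.mk (PresheafOfModules.homMk
    { app := fun U => AddCommGrpCat.ofHom
        { toFun := fun s => (show formSections P (f ⁻¹ᵁ U.unop) from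
            ⟨fun y => formMap f ((show formSections N U.unop from s).1 ⟨f y.1, y.2⟩), fun y => by
              obtain ⟨V, hV, m, hm⟩ := (show formSections N U.unop from s).2 ⟨f y.1, y.2⟩
              exact ⟨f ⁻¹ᵁ V, hV, formMap f m, fun z hz =>
                ⟨h z.1 m (hm ⟨f z.1, z.2⟩ hz).1, congrArg _ (hm ⟨f z.1, z.2⟩ hz).2⟩⟩⟩)
          map_zero' := by
            apply Subtype.ext; funext y
            exact map_zero (formMap f)
          map_add' := fun s t => by
            apply Subtype.ext; funext y
            exact map_add (formMap f) _ _ }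
      naturality := by intro U V i; rfl }
    (by
      intro U r m
      apply Subtype.ext; funext y
      change formMap f (toField (U := U.unop) r (f y.1) y.2 • _) =
        toField (U := f ⁻¹ᵁ U.unop) (f.app U.unop r) y.1 y.2 • formMap f _
      rw [formMap_smul]
      exact congrArg (· • _) (fieldMap_toField f (U := U.unop) r y.1 y.2)))

end Functoriality

section Divisors

variable {X : Scheme.{0}} [IsIntegral X]

/-- A rational function is regular at `x` if it lies in the local ring at `x`. -/
def IsRegularAt (x : X) (g : X.functionField) : Prop :=
  g ∈ (algebraMap (X.presheaf.stalk x) X.functionField).range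

lemma isRegularAt_zero (x : X) : IsRegularAt x 0 := ⟨0, map_zero _⟩

lemma isRegularAt_one (x : X) : IsRegularAt x 1 := ⟨1, map_one _⟩

lemma toField_zero {U : X.Opens} (y : X) (hy : y ∈ U) : toField (0 : Γ(X, U)) y hy = 0 := by
  simp [toField]

lemma toField_one {U : X.Opens} (y : X) (hy : y ∈ U) : toField (1 : Γ(X, U)) y hy = 1 := by
  simp [toField]

lemma toField_add {U : X.Opens} (a b : Γ(X, U)) (y : X) (hy : y ∈ U) :
    toField (a + b) y hy = toField a y hy + toField b y hy := by
  simp [toField]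

lemma toField_mul {U : X.Opens} (a b : Γ(X, U)) (y : X) (hy : y ∈ U) :
    toField (a * b) y hy = toField a y hy * toField b y hy := by
  simp [toField]

lemma toField_injective {U : X.Opens} {a b : Γ(X, U)}
    (h : ∀ y hy, toField a y hy = toField b y hy) : a = b := by
  refine TopCat.Presheaf.section_ext X.sheaf U a b fun x hx => ?_
  exact IsFractionRing.injective (X.presheaf.stalk x) X.functionField (h x hx)

lemma isRegularAt_toField {U : X.Opens} (a : Γ(X, U)) (x y : X) (hx : x ∈ U) (hy : y ∈ U) :
    IsRegularAt y (toField a x hx) := by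
  rw [toField_eq a x y hx hy]
  exact ⟨_, rfl⟩

/-- A rational function regular at all points of `U` is a section of the structure sheaf. -/
lemma exists_section (U : X.Opens) (g : X.functionField) (h : ∀ x ∈ U, IsRegularAt x g) :
    ∃ a : Γ(X, U), ∀ y hy, toField a y hy = g := by
  have h1 : ∀ x : U, ∃ V ≤ U, ∃ (_ : x.1 ∈ V) (s : Γ(X, V)), ∀ y hy, toField s y hy = g := by
    rintro ⟨x, hx⟩
    obtain ⟨t, ht⟩ := h x hx
    obtain ⟨V, hV, hm, s, hs⟩ := X.presheaf.exists_le_germ_eq t hx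
    refine ⟨V, hV, hm, s, fun y hy => ?_⟩
    rw [toField_eq s y x hy hm, ← ht, ← hs]
    rfl
  choose V hV hm s hs using h1
  obtain ⟨a, ha, -⟩ := X.sheaf.existsUnique_gluing' (ι := U) V U (fun x => homOfLE (hV x))
    (fun x hx => Opens.mem_iSup.mpr ⟨⟨x, hx⟩, hm ⟨x, hx⟩⟩) s (by
      intro i j
      refine toField_injective fun y hy => ?_
      exact ((toField_res _ (s i) y hy).trans (hs i y _)).trans
        ((toField_res _ (s j) y hy).trans (hs j y _)).symm)
  refine ⟨a, fun y hy => ?_⟩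
  have := toField_res (homOfLE (hV ⟨y, hy⟩)) a y (hm ⟨y, hy⟩)
  rw [← this]
  refine Eq.trans ?_ (hs ⟨y, hy⟩ y (hm _))
  exact congrArg (fun b => toField b y _) (ha ⟨y, hy⟩)

variable (X) in
/-- A Cartier divisor on an integral scheme, by local equations: an open cover `U` and rational
functions `f i ≠ 0` whose quotients `f i / f j` are units on `U i ⊓ U j`. -/
structure CartierDivisor where
  /-- The index set of the cover. -/
  ι : Type
  /-- The open cover. -/
  U : ι → X.Opens
  iSup_U : ⨆ i, U i = ⊤
  /-- The local equations. -/
  f : ι → X.functionFieldˣ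
  cocycle : ∀ i j, ∃ u : Γ(X, U i ⊓ U j)ˣ,
    ∀ y hy, toField (u : Γ(X, U i ⊓ U j)) y hy * (f j : X.functionField) = f i

namespace CartierDivisor

variable (L : CartierDivisor X)

lemma exists_mem (x : X) : ∃ i, x ∈ L.U i := by
  have : x ∈ ⨆ i, L.U i := by rw [L.iSup_U]; trivial
  exact Opens.mem_iSup.mp this

/-- The rational function `g` is a section over `U` of the line bundle `𝒪(k L)`, i.e. the divisor
`div g + k L` is effective on `U`. -/
def IsSection (k : ℕ) (U : X.Opens) (g : X.functionField) : Prop :=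
  ∀ x ∈ U, ∀ i, x ∈ L.U i → IsRegularAt x (g * (L.f i : X.functionField) ^ k)

/-- The ring `⨁ₖ H⁰(U, 𝒪(k L)) Tᵏ`, as a ring of polynomials over the function field. -/
def sectionRing (U : X.Opens) : Subring (Polynomial X.functionField) where
  carrier := {p | ∀ k, L.IsSection k U (p.coeff k)}
  zero_mem' k x hx i hi := by simpa using isRegularAt_zero x
  one_mem' k x hx i hi := by
    rw [Polynomial.coeff_one]
    split_ifs with h
    · subst h; simpa using isRegularAt_one x
    · simpa using isRegularAt_zero x
  add_mem' {p q} hp hq k x hx i hi := by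
    rw [Polynomial.coeff_add, add_mul]
    exact add_mem (hp k x hx i hi) (hq k x hx i hi)
  neg_mem' {p} hp k x hx i hi := by
    rw [Polynomial.coeff_neg, neg_mul]
    exact neg_mem (hp k x hx i hi)
  mul_mem' {p q} hp hq k x hx i hi := by
    rw [Polynomial.coeff_mul, Finset.sum_mul]
    refine sum_mem fun c hc => ?_
    rw [← Finset.HasAntidiagonal.mem_antidiagonal.mp hc, pow_add, mul_mul_mul_comm]
    exact mul_mem (hp _ x hx i hi) (hq _ x hx i hi)

lemma sectionRing_mono {U V : X.Opens} (h : U ≤ V) : L.sectionRing V ≤ L.sectionRing U :=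
  fun _ hp k x hx => hp k x (h hx)

/-- The algebra `⨁ₖ H⁰(U, 𝒪(k L))`, as pairs of a regular function (the degree `0` part) and
a polynomial over the function field. The polynomial is recorded as a constant function on `U`, so
that the algebra is the zero ring for `U = ∅`. -/
def symAlg (U : X.Opens) : Subring (Γ(X, U) × (U → Polynomial X.functionField)) where
  carrier := {s | ∃ q ∈ L.sectionRing U, (∀ y, s.2 y = q) ∧ ∀ y hy, toField s.1 y hy = q.coeff 0}
  zero_mem' := ⟨0, zero_mem _, fun _ => rfl, fun y hy => by simp [toField]⟩
  one_mem' := ⟨1, one_mem _, fun _ => rfl, fun y hy => by simp [toField]⟩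
  add_mem' := by
    rintro s t ⟨p, hp, h1, h2⟩ ⟨q, hq, h3, h4⟩
    refine ⟨p + q, add_mem hp hq, fun y => by simp [h1, h3], fun y hy => ?_⟩
    rw [Polynomial.coeff_add, ← h2 y hy, ← h4 y hy]
    simp [toField]
  neg_mem' := by
    rintro s ⟨p, hp, h1, h2⟩
    refine ⟨-p, neg_mem hp, fun y => by simp [h1], fun y hy => ?_⟩
    rw [Polynomial.coeff_neg, ← h2 y hy]
    simp [toField]
  mul_mem' := by
    rintro s t ⟨p, hp, h1, h2⟩ ⟨q, hq, h3, h4⟩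
    refine ⟨p * q, mul_mem hp hq, fun y => by simp [h1, h3], fun y hy => ?_⟩
    rw [Polynomial.mul_coeff_zero, ← h2 y hy, ← h4 y hy]
    simp [toField]

lemma symAlg_ext {U : X.Opens} {s t : L.symAlg U} (y : U) (h : s.1.2 y = t.1.2 y) : s = t := by
  obtain ⟨⟨a, p⟩, q, hq, h1, h2⟩ := s
  obtain ⟨⟨b, p'⟩, q', hq', h3, h4⟩ := t
  have e : q = q' := by rw [← h1 y, ← h3 y]; exact h
  subst e
  refine Subtype.ext (Prod.ext ?_ (funext fun z => (h1 z).trans (h3 z).symm))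
  exact toField_injective fun y hy => (h2 y hy).trans (h4 y hy).symm


/-- Restriction of sections of the symmetric algebra. -/
def symAlgRes {U V : X.Opens} (h : U ≤ V) : L.symAlg V →+* L.symAlg U where
  toFun s := ⟨(X.presheaf.map (homOfLE h).op s.1.1, fun y => s.1.2 ⟨y.1, h y.2⟩), by
    obtain ⟨⟨a, p⟩, q, hq, h1, h2⟩ := s
    refine ⟨q, L.sectionRing_mono h hq, fun y => h1 _, fun y hy => ?_⟩
    exact (toField_res (homOfLE h) a y hy).trans (h2 y _)⟩
  map_one' := Subtype.ext (Prod.ext (map_one _) rfl)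
  map_mul' _ _ := Subtype.ext (Prod.ext (map_mul _ _ _) rfl)
  map_zero' := Subtype.ext (Prod.ext (map_zero _) rfl)
  map_add' _ _ := Subtype.ext (Prod.ext (map_add _ _ _) rfl)

/-- The structure map of the symmetric algebra. -/
def symAlgC (U : X.Opens) : Γ(X, U) →+* L.symAlg U where
  toFun a := ⟨(a, fun y => Polynomial.C (toField a y.1 y.2)), by
    by_cases hU : Nonempty U
    · obtain ⟨⟨y, hy⟩⟩ := hU
      refine ⟨Polynomial.C (toField a y hy), fun k x hx i hi => ?_, fun z => ?_, fun z hz => ?_⟩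
      · rw [Polynomial.coeff_C]
        split_ifs with h
        · subst h; simpa using isRegularAt_toField a y x hy hx
        · simpa using isRegularAt_zero x
      · exact congrArg Polynomial.C (toField_eq a z.1 y z.2 hy)
      · rw [Polynomial.coeff_C_zero]
        exact toField_eq a z y hz hy
    · exact ⟨0, zero_mem _, fun y => (hU ⟨y⟩).elim, fun y hy => (hU ⟨⟨y, hy⟩⟩).elim⟩⟩
  map_one' := Subtype.ext (Prod.ext rfl (funext fun y =>
    (congrArg Polynomial.C (toField_one y.1 y.2)).trans (map_one Polynomial.C)))
  map_mul' _ _ := Subtype.ext (Prod.ext rfl (funext fun y =>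
    (congrArg Polynomial.C (toField_mul _ _ y.1 y.2)).trans (map_mul Polynomial.C _ _)))
  map_zero' := Subtype.ext (Prod.ext rfl (funext fun y =>
    (congrArg Polynomial.C (toField_zero y.1 y.2)).trans (map_zero Polynomial.C)))
  map_add' _ _ := Subtype.ext (Prod.ext rfl (funext fun y =>
    (congrArg Polynomial.C (toField_add _ _ y.1 y.2)).trans (map_add Polynomial.C _ _)))

/-- The augmentation (projection to degree `0`) of the symmetric algebra. -/
def symAlgAug (U : X.Opens) : L.symAlg U →+* Γ(X, U) :=
  (RingHom.fst _ _).comp (L.symAlg U).subtype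

/-- The symmetric algebra as a presheaf of rings. -/
def symPresheaf : X.Opensᵒᵖ ⥤ CommRingCat where
  obj U := .of (L.symAlg U.unop)
  map i := CommRingCat.ofHom (L.symAlgRes i.unop.le)
  map_id U := by
    refine CommRingCat.hom_ext (RingHom.ext fun s => Subtype.ext (Prod.ext ?_ rfl))
    exact ConcreteCategory.congr_hom (X.presheaf.map_id U) s.1.1
  map_comp i j := by
    refine CommRingCat.hom_ext (RingHom.ext fun s => Subtype.ext (Prod.ext ?_ rfl))
    exact ConcreteCategory.congr_hom (X.presheaf.map_comp i j) s.1.1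

/-- The structure map, as a map of presheaves. -/
def symUnit : X.presheaf ⟶ L.symPresheaf where
  app U := CommRingCat.ofHom (L.symAlgC U.unop)
  naturality U V i := by
    refine CommRingCat.hom_ext (RingHom.ext fun a => Subtype.ext (Prod.ext rfl (funext fun y => ?_)))
    exact congrArg Polynomial.C (toField_res i.unop (U := V.unop) (V := U.unop) a y.1 y.2)

end CartierDivisor

end Divisors

section Localization

variable {X : Scheme.{0}} [IsIntegral X]

lemma IsRegularAt.mul {x : X} {g h : X.functionField} (hg : IsRegularAt x g)
    (hh : IsRegularAt x h) : IsRegularAt x (g * h) := by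
  obtain ⟨a, rfl⟩ := hg
  obtain ⟨b, rfl⟩ := hh
  exact ⟨a * b, map_mul _ _ _⟩

lemma toField_pow {U : X.Opens} (a : Γ(X, U)) (n : ℕ) (y : X) (hy : y ∈ U) :
    toField (a ^ n) y hy = toField a y hy ^ n := by
  simp [toField]

lemma genericPoint_mem {U : X.Opens} {y : X} (hy : y ∈ U) : genericPoint X ∈ U :=
  ((genericPoint_spec X).specializes (y := y) trivial).mem_open U.2 hy

lemma toField_eq_zero {U : X.Opens} (a : Γ(X, U)) (y : X) (hy : y ∈ U) :
    toField a y hy = 0 ↔ a = 0 := by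
  refine ⟨fun h => toField_injective fun z hz => ?_, fun h => h ▸ toField_zero y hy⟩
  rw [toField_zero, toField_eq a z y hz hy, h]

namespace CartierDivisor

variable (L : CartierDivisor X)

lemma isSection_mul_toField {k : ℕ} {U : X.Opens} {g : X.functionField} (h : L.IsSection k U g)
    (a : Γ(X, U)) (y : X) (hy : y ∈ U) : L.IsSection k U (toField a y hy * g) := by
  intro x hx i hi
  rw [mul_assoc]
  exact (isRegularAt_toField a y x hy hx).mul (h x hx i hi)

/-- It is enough to check regularity with one of the local equations. -/
lemma isRegularAt_of_mem {k : ℕ} {g : X.functionField} {x : X} {i j : L.ι} (hi : x ∈ L.U i)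
    (hj : x ∈ L.U j) (h : IsRegularAt x (g * (L.f i : X.functionField) ^ k)) :
    IsRegularAt x (g * (L.f j : X.functionField) ^ k) := by
  obtain ⟨u, hu⟩ := L.cocycle j i
  have hm : x ∈ L.U j ⊓ L.U i := ⟨hj, hi⟩
  rw [← hu x hm, mul_pow, mul_left_comm, ← toField_pow]
  exact (isRegularAt_toField _ x x hm hm).mul h

lemma exists_pow_isSection_local {U : X.Opens} (f : Γ(X, U)) {k : ℕ} {g : X.functionField}
    (hg : L.IsSection k (X.basicOpen f) g) (x : X) (hx : x ∈ U) :
    ∃ n, ∃ V ≤ U, x ∈ V ∧ L.IsSection k V (toField f x hx ^ n * g) := by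
  by_cases hF : f = 0
  · refine ⟨1, U, le_rfl, hx, fun y _ i _ => ?_⟩
    rw [hF, toField_zero]
    simpa using isRegularAt_zero y
  obtain ⟨i, hi⟩ := L.exists_mem x
  obtain ⟨V, hV, hxV, hVU⟩ := X.isBasis_affineOpens.exists_subset_of_mem_open
    (show x ∈ U ⊓ L.U i from ⟨hx, hi⟩) (U ⊓ L.U i).2
  obtain ⟨V, hVa, rfl⟩ := hV
  have hVU' : V ≤ U := fun y hy => (hVU hy).1
  set f' : Γ(X, V) := X.presheaf.map (homOfLE hVU').op f with hf'
  have hbf : X.basicOpen f' ≤ X.basicOpen f := by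
    rw [hf', X.basicOpen_res]; exact inf_le_right
  obtain ⟨a, ha⟩ := exists_section (X.basicOpen f') (g * (L.f i : X.functionField) ^ k)
    fun y hy => hg y (hbf hy) i (hVU (X.basicOpen_le _ hy)).2
  have hloc := hVa.isLocalization_basicOpen f'
  obtain ⟨⟨b, ⟨_, n, rfl⟩⟩, hb⟩ := IsLocalization.surj (Submonoid.powers f') a
  refine ⟨n, V, hVU', hxV, fun y hy j hj => ?_⟩
  refine L.isRegularAt_of_mem (i := i) (hVU hy).2 hj ?_
  have hf0 : f' ≠ 0 := by
    rw [Ne, ← toField_eq_zero f' x hxV, hf', toField_res, toField_eq_zero]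
    exact hF
  have hη : genericPoint X ∈ X.basicOpen f' := by
    have : X.basicOpen f' ≠ ⊥ := by rwa [Ne, basicOpen_eq_bot_iff]
    rw [Ne, ← Opens.not_nonempty_iff_eq_bot, not_not] at this
    exact genericPoint_mem this.choose_spec
  have key := congrArg (fun c => toField (U := X.basicOpen f') c (genericPoint X) hη) hb
  simp only [toField_mul, ha] at key
  have e1 : toField (U := X.basicOpen f') (algebraMap Γ(X, V) Γ(X, X.basicOpen f') b)
      (genericPoint X) hη = toField b y hy :=
    (toField_res (homOfLE (X.basicOpen_le f')) b _ hη).trans (toField_eq _ _ _ _ _)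
  have e2 : toField (U := X.basicOpen f') (algebraMap Γ(X, V) Γ(X, X.basicOpen f') (f' ^ n))
      (genericPoint X) hη = toField f x hx ^ n := by
    refine (toField_res (homOfLE (X.basicOpen_le f')) (f' ^ n) _ hη).trans ?_
    rw [toField_pow]
    exact congrArg (· ^ n) ((toField_res (homOfLE hVU') f _ _).trans (toField_eq _ _ _ _ _))
  have key' : toField f x hx ^ n * g * (L.f i : X.functionField) ^ k = toField b y hy := by
    rw [← e1, ← e2, mul_assoc, mul_comm]
    exact key
  rw [key']
  exact isRegularAt_toField b y y hy hy

lemma exists_pow_isSection {U : X.Opens} (hU : IsAffineOpen U) (f : Γ(X, U)) {k : ℕ}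
    {g : X.functionField} (hg : L.IsSection k (X.basicOpen f) g) (x : X) (hx : x ∈ U) :
    ∃ n, L.IsSection k U (toField f x hx ^ n * g) := by
  have h := hU.isCompact.induction_on (p := fun T => ∃ n, ∀ y ∈ T, y ∈ U → ∀ i, y ∈ L.U i →
      IsRegularAt y (toField f x hx ^ n * g * (L.f i : X.functionField) ^ k))
    ⟨0, fun y hy => hy.elim⟩
    (fun s t hst ⟨n, hn⟩ => ⟨n, fun y hy => hn y (hst hy)⟩)
    (fun s t ⟨n, hn⟩ ⟨m, hm⟩ => ⟨n + m, fun y hy hyU i hi => by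
      rcases hy with hy | hy
      · rw [pow_add, mul_comm (_ ^ n), mul_assoc, mul_assoc, ← toField_pow, ← mul_assoc _ g]
        exact (isRegularAt_toField _ x y hx hyU).mul (hn y hy hyU i hi)
      · rw [pow_add, mul_assoc, mul_assoc, ← toField_pow f n, ← mul_assoc _ g]
        exact (isRegularAt_toField _ x y hx hyU).mul (hm y hy hyU i hi)⟩)
    (fun y hy => by
      obtain ⟨n, V, hV, hyV, h⟩ := L.exists_pow_isSection_local f hg y hy
      refine ⟨V, mem_nhdsWithin_of_mem_nhds (V.2.mem_nhds hyV), n, fun z hz hzU i hi => ?_⟩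
      rw [toField_eq f x y hx hy]
      exact h z hz i hi)
  obtain ⟨n, hn⟩ := h
  exact ⟨n, fun y hy i hi => hn y hy hy i hi⟩

lemma exists_pow_mem_sectionRing {U : X.Opens} (hU : IsAffineOpen U) (f : Γ(X, U))
    {q : Polynomial X.functionField} (hq : q ∈ L.sectionRing (X.basicOpen f)) (x : X)
    (hx : x ∈ U) : ∃ n, Polynomial.C (toField f x hx ^ n) * q ∈ L.sectionRing U := by
  choose n hn using fun k => L.exists_pow_isSection hU f (hq k) x hx
  refine ⟨∑ k ∈ q.support, n k, fun k => ?_⟩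
  rw [Polynomial.coeff_C_mul]
  by_cases hk : k ∈ q.support
  · rw [← Finset.sum_erase_add _ _ hk, pow_add, mul_assoc, ← toField_pow]
    exact L.isSection_mul_toField (hn k) _ x hx
  · rw [Polynomial.notMem_support_iff.mp hk, mul_zero]
    intro y _ i _
    simpa using isRegularAt_zero y

lemma symAlg_subsingleton {U : X.Opens} (h : ¬ Nonempty U) : Subsingleton (L.symAlg U) := by
  refine ⟨fun s t => Subtype.ext (Prod.ext ?_ (funext fun y => (h ⟨y⟩).elim))⟩
  exact toField_injective fun y hy => (h ⟨⟨y, hy⟩⟩).elim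

lemma symAlg_isLocalization {U : X.Opens} (hU : IsAffineOpen U) (f : Γ(X, U)) :
    letI := (L.symAlgRes (X.basicOpen_le f)).toAlgebra
    IsLocalization.Away (L.symAlgC U f) (L.symAlg (X.basicOpen f)) := by
  let _ := (L.symAlgRes (X.basicOpen_le f)).toAlgebra
  have hval : ∀ (t : L.symAlg U) (y : X.basicOpen f),
      (algebraMap (L.symAlg U) (L.symAlg (X.basicOpen f)) t).1.2 y =
        t.1.2 ⟨y.1, X.basicOpen_le f y.2⟩ := fun _ _ => rfl
  by_cases hD : Nonempty (X.basicOpen f)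
  swap
  · have := L.symAlg_subsingleton hD
    have hf : f = 0 := by
      rw [← basicOpen_eq_bot_iff, ← Opens.not_nonempty_iff_eq_bot]
      exact fun ⟨y, hy⟩ => hD ⟨⟨y, hy⟩⟩
    refine IsLocalization.Away.mk _ ?_ (fun s => ⟨0, 0, Subsingleton.elim _ _⟩) fun a b _ => ⟨1, ?_⟩
    · rw [Subsingleton.elim (algebraMap (L.symAlg U) (L.symAlg (X.basicOpen f)) _) 1]
      exact isUnit_one
    · simp [hf]
  obtain ⟨⟨y', hy'⟩⟩ := hD
  let y : ↥(X.basicOpen f) := ⟨y', hy'⟩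
  have hyU : y' ∈ U := X.basicOpen_le f hy'
  refine IsLocalization.Away.mk _ ?_ (fun s => ?_) fun a b hab => ⟨0, ?_⟩
  · have h := RingedSpace.isUnit_res_basicOpen X.toRingedSpace f
    have h' := h.map (L.symAlgC (X.basicOpen f))
    convert h' using 1
    refine L.symAlg_ext y ?_
    refine congrArg Polynomial.C (toField_res (homOfLE (X.basicOpen_le f)) f y.1 y.2).symm
  · obtain ⟨q, hq, h1, h2⟩ := s.2
    obtain ⟨n, hn⟩ := L.exists_pow_mem_sectionRing hU f hq y' hyU
    obtain ⟨a, ha⟩ := exists_section U ((Polynomial.C (toField f y' hyU ^ n) * q).coeff 0)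
      fun x hx => by
        obtain ⟨i, hi⟩ := L.exists_mem x
        simpa using hn 0 x hx i hi
    let t : L.symAlg U :=
      ⟨(a, fun _ => Polynomial.C (toField f y' hyU ^ n) * q), _, hn, fun _ => rfl, ha⟩
    let ev : L.symAlg (X.basicOpen f) →+* Polynomial X.functionField :=
      (Pi.evalRingHom _ y).comp ((RingHom.snd _ _).comp (L.symAlg (X.basicOpen f)).subtype)
    have e1 : ev s = q := h1 y
    have e2 : ev (algebraMap (L.symAlg U) (L.symAlg (X.basicOpen f)) (L.symAlgC U f)) =
        Polynomial.C (toField f y' hyU) := rfl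
    have e3 : ev (algebraMap (L.symAlg U) (L.symAlg (X.basicOpen f)) t) =
        Polynomial.C (toField f y' hyU ^ n) * q := rfl
    have e4 : ev (s * algebraMap (L.symAlg U) (L.symAlg (X.basicOpen f)) (L.symAlgC U f) ^ n) =
        ev (algebraMap (L.symAlg U) (L.symAlg (X.basicOpen f)) t) := by
      rw [e3, map_mul, map_pow, e1, e2, mul_comm, map_pow]
    exact ⟨n, t, L.symAlg_ext y e4⟩
  · rw [pow_zero, one_mul, one_mul]
    refine L.symAlg_ext ⟨y', hyU⟩ ?_
    exact (hval a y).symm.trans ((congrArg (fun t => t.1.2 y) hab).trans (hval b y))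

lemma coequifibered_symUnit : NatTrans.Coequifibered
    ((Scheme.AffineZariskiSite.toOpensFunctor X).op.whiskerLeft L.symUnit) :=
  Scheme.AffineZariskiSite.coequifibered_iff_forall_isLocalizationAway.mpr fun U f =>
    L.symAlg_isLocalization U.2 f

end CartierDivisor

end Localization

namespace CartierDivisor

section TotalSpace

variable {X : Scheme.{0}} [IsIntegral X] (L : CartierDivisor X)

/-- The affine schemes `Spec ⨁ₖ H⁰(U, 𝒪(k L))` over the affine open subsets `U` of `X`. -/
def totalGluing :=
  Scheme.AffineZariskiSite.relativeGluingData L.coequifibered_symUnit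

instance : (L.totalGluing.functor ⋙ Scheme.forget).IsLocallyDirected :=
  Scheme.Cover.RelativeGluingData.instIsLocallyDirectedI₀CompFunctorForgetOfIsThin ..

/-- The total space of the line bundle `L⁻¹`, i.e. the relative spectrum of `⨁ₖ 𝒪(k L)`. -/
def totalSpace : Scheme.{0} := L.totalGluing.glued

/-- The projection of the line bundle to the base. -/
def proj : L.totalSpace ⟶ X := L.totalGluing.toBase

/-- The zero section of the line bundle. -/
def zeroSection : X ⟶ L.totalSpace :=
  (Scheme.AffineZariskiSite.isColimitCocone X).desc
    { pt := L.totalSpace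
      ι :=
        { app := fun U => Spec.map (CommRingCat.ofHom (L.symAlgAug U.1)) ≫
            Limits.colimit.ι L.totalGluing.functor U
          naturality := fun U V i => by
            have h : (L.symPresheaf.map ((Scheme.AffineZariskiSite.toOpensFunctor X).map i).op) ≫
                CommRingCat.ofHom (L.symAlgAug U.1) =
                CommRingCat.ofHom (L.symAlgAug V.1) ≫
                  X.presheaf.map ((Scheme.AffineZariskiSite.toOpensFunctor X).map i).op := rfl
            refine Eq.trans ?_ (Category.comp_id _).symm
            rw [← Limits.colimit.w L.totalGluing.functor i]
            refine (Category.assoc _ _ _).symm.trans (Eq.trans ?_ (Category.assoc _ _ _))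
            refine congrArg (· ≫ _) ?_
            refine (Spec.map_comp _ _).symm.trans (Eq.trans (congrArg Spec.map h.symm) (Spec.map_comp _ _)) } }

lemma ι_zeroSection (U : X.AffineZariskiSite) : U.2.fromSpec ≫ L.zeroSection =
    Spec.map (CommRingCat.ofHom (L.symAlgAug U.1)) ≫ Limits.colimit.ι L.totalGluing.functor U :=
  (Scheme.AffineZariskiSite.isColimitCocone X).fac _ U

lemma ι_proj (U : X.AffineZariskiSite) : Limits.colimit.ι L.totalGluing.functor U ≫ L.proj =
    Spec.map (CommRingCat.ofHom (L.symAlgC U.1)) ≫ U.2.fromSpec :=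
  Limits.colimit.ι_desc _ _

lemma zeroSection_proj : L.zeroSection ≫ L.proj = 𝟙 X := by
  refine (Scheme.AffineZariskiSite.isColimitCocone X).hom_ext fun U => ?_
  change U.2.fromSpec ≫ L.zeroSection ≫ L.proj = U.2.fromSpec ≫ 𝟙 X
  refine (Category.assoc _ _ _).symm.trans ((congrArg (· ≫ L.proj) (L.ι_zeroSection U)).trans ?_)
  refine (Category.assoc _ _ _).trans ((congrArg (_ ≫ ·) (L.ι_proj U)).trans ?_)
  refine (Category.assoc _ _ _).symm.trans (Eq.trans ?_ (Category.comp_id _).symm)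
  refine Eq.trans (congrArg (· ≫ U.2.fromSpec) ?_) (Category.id_comp _)
  exact (Spec.map_comp _ _).symm.trans (Spec.map_id _)

end TotalSpace

section Cone

variable {X : Scheme.{0}} [IsIntegral X] (L : CartierDivisor X)

/-- The affine cone `Spec ⨁ₖ H⁰(X, 𝒪(k L))`. -/
def cone : Scheme.{0} := Spec (CommRingCat.of (L.sectionRing ⊤))

/-- The vertex of the cone: the prime ideal `⨁_{k > 0} H⁰(X, 𝒪(k L))`. -/
def vertex : L.cone :=
  (⟨RingHom.ker (Polynomial.constantCoeff.comp (L.sectionRing ⊤).subtype),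
    RingHom.ker_isPrime _⟩ : PrimeSpectrum (L.sectionRing ⊤))

/-- The degree `0` part, as a section of the structure sheaf. -/
def constSection (U : X.Opens) : L.sectionRing U →+* Γ(X, U) :=
  have h : ∀ q : L.sectionRing U, ∃ a : Γ(X, U), ∀ y hy, toField a y hy = q.1.coeff 0 := fun q =>
    exists_section U (q.1.coeff 0) fun x hx => by
      obtain ⟨i, hi⟩ := L.exists_mem x
      simpa using q.2 0 x hx i hi
  { toFun := fun q => (h q).choose
    map_one' := toField_injective fun y hy => by
      rw [(h 1).choose_spec y hy, toField_one]; exact Polynomial.coeff_one_zero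
    map_mul' := fun p q => toField_injective fun y hy => by
      rw [(h _).choose_spec y hy, toField_mul, (h p).choose_spec y hy, (h q).choose_spec y hy]
      exact Polynomial.mul_coeff_zero _ _
    map_zero' := toField_injective fun y hy => by
      rw [(h 0).choose_spec y hy, toField_zero]; exact Polynomial.coeff_zero _
    map_add' := fun p q => toField_injective fun y hy => by
      rw [(h _).choose_spec y hy, toField_add, (h p).choose_spec y hy, (h q).choose_spec y hy]
      exact Polynomial.coeff_add _ _ _ }

lemma toField_constSection {U : X.Opens} (q : L.sectionRing U) (y : X) (hy : y ∈ U) :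
    toField (L.constSection U q) y hy = q.1.coeff 0 := by
  have h : ∃ a : Γ(X, U), ∀ y hy, toField a y hy = q.1.coeff 0 :=
    exists_section U (q.1.coeff 0) fun x hx => by
      obtain ⟨i, hi⟩ := L.exists_mem x
      simpa using q.2 0 x hx i hi
  exact h.choose_spec y hy

/-- Sections of `⨁ₖ 𝒪(k L)` over `U` as elements of the symmetric algebra. -/
def toSymAlg (U : X.Opens) : L.sectionRing U →+* L.symAlg U where
  toFun q := ⟨(L.constSection U q, fun _ => q.1), q.1, q.2, fun _ => rfl,
    L.toField_constSection q⟩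
  map_one' := Subtype.ext (Prod.ext (map_one _) rfl)
  map_mul' _ _ := Subtype.ext (Prod.ext (map_mul _ _ _) rfl)
  map_zero' := Subtype.ext (Prod.ext (map_zero _) rfl)
  map_add' _ _ := Subtype.ext (Prod.ext (map_add _ _ _) rfl)

/-- The contraction of the zero section. -/
def toCone : L.totalSpace ⟶ L.cone :=
  Limits.colimit.desc L.totalGluing.functor
    { pt := L.cone
      ι :=
        { app := fun U => Spec.map (CommRingCat.ofHom
            ((L.symAlgRes (le_top : U.1 ≤ ⊤)).comp (L.toSymAlg ⊤)))
          naturality := fun U V i => by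
            refine Eq.trans ((Spec.map_comp _ _).symm.trans (congrArg Spec.map ?_))
              (Category.comp_id _).symm
            refine CommRingCat.hom_ext (RingHom.ext fun s => Subtype.ext (Prod.ext ?_ rfl))
            exact (ConcreteCategory.congr_hom (X.presheaf.map_comp (homOfLE le_top).op
              ((Scheme.AffineZariskiSite.toOpensFunctor X).map i).op) (L.constSection ⊤ s)).symm } }

end Cone

section Pullback

variable {X Y : Scheme.{0}} [IsIntegral X] [IsIntegral Y]

lemma _root_.LogCone.IsRegularAt.fieldMap (f : Y ⟶ X) [IsDominant f] {y : Y} {g : X.functionField}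
    (h : IsRegularAt (f y) g) : IsRegularAt y (LogCone.fieldMap f g) := by
  obtain ⟨a, rfl⟩ := h
  exact ⟨_, (fieldMap_algebraMap f y a).symm⟩

/-- The pull-back of a Cartier divisor along a dominant morphism. -/
def pullback (L : CartierDivisor X) (f : Y ⟶ X) [IsDominant f] : CartierDivisor Y where
  ι := L.ι
  U i := f ⁻¹ᵁ L.U i
  iSup_U := by
    refine TopologicalSpace.Opens.ext (Set.eq_univ_of_forall fun y => ?_)
    obtain ⟨i, hi⟩ := L.exists_mem (f y)
    exact Opens.mem_iSup.mpr ⟨i, hi⟩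
  f i := Units.map (fieldMap f).toMonoidHom (L.f i)
  cocycle i j := by
    obtain ⟨u, hu⟩ := L.cocycle i j
    refine ⟨Units.map (f.app (L.U i ⊓ L.U j)).hom.toMonoidHom u, fun y hy => ?_⟩
    have h := congrArg (fieldMap f) (hu (f y) hy)
    rw [map_mul] at h
    exact (congrArg (· * _) (fieldMap_toField f (U := L.U i ⊓ L.U j) _ y hy).symm).trans h

/-- The pull-back of sections, as a homomorphism of section rings. -/
def pullSections (L : CartierDivisor X) (f : Y ⟶ X) [IsDominant f] :
    L.sectionRing ⊤ →+* (L.pullback f).sectionRing ⊤ :=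
  ((Polynomial.mapRingHom (fieldMap f)).comp (L.sectionRing ⊤).subtype).codRestrict _ fun q k y _ i hi => by
    have h := (q.2 k (f y) trivial i hi).fieldMap f
    rw [map_mul, map_pow] at h
    refine Eq.mp ?_ h
    congr 2
    exact (Polynomial.coeff_map _ _).symm

end Pullback

end CartierDivisor

namespace CartierDivisor

section LocalTriviality

variable {X : Scheme.{0}} [IsIntegral X] (L : CartierDivisor X)

/-- The fibre coordinate of the line bundle over an open set on which it is trivialised. -/
def coord {U : X.Opens} {i : L.ι} (h : U ≤ L.U i) : L.symAlg U :=
  ⟨(0, fun _ => Polynomial.C ((L.f i)⁻¹ : X.functionFieldˣ).1 * Polynomial.X),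
    Polynomial.C ((L.f i)⁻¹ : X.functionFieldˣ).1 * Polynomial.X, by
    intro k x hx j hj
    rw [Polynomial.coeff_C_mul, Polynomial.coeff_X]
    split_ifs with hk
    · subst hk
      refine L.isRegularAt_of_mem (h hx) hj ?_
      simpa using isRegularAt_one x
    · simpa using isRegularAt_zero x, fun _ => rfl, fun y hy => by simp [toField_zero]⟩

/-- The comparison of the polynomial ring with the symmetric algebra. -/
def fromPoly {U : X.Opens} {i : L.ι} (h : U ≤ L.U i) : Polynomial Γ(X, U) →+* L.symAlg U :=
  Polynomial.eval₂RingHom (L.symAlgC U) (L.coord h)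

/-- The underlying polynomial over the function field. -/
def valAt {U : X.Opens} (y : U) : L.symAlg U →+* Polynomial X.functionField :=
  (Pi.evalRingHom _ y).comp ((RingHom.snd _ _).comp (L.symAlg U).subtype)

/-- `toField` as a ring homomorphism. -/
def _root_.LogCone.toFieldHom {U : X.Opens} (y : U) : Γ(X, U) →+* X.functionField :=
  (algebraMap (X.presheaf.stalk y.1) X.functionField).comp (X.presheaf.germ U y.1 y.2).hom

lemma valAt_fromPoly {U : X.Opens} {i : L.ι} (h : U ≤ L.U i) (y : U) (p : Polynomial Γ(X, U)) :
    L.valAt y (L.fromPoly h p) =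
      (p.map (toFieldHom y)).comp (Polynomial.C ((L.f i)⁻¹ : X.functionFieldˣ).1 * Polynomial.X) := by
  have : (L.valAt y).comp (L.fromPoly h) =
      (Polynomial.compRingHom (Polynomial.C ((L.f i)⁻¹ : X.functionFieldˣ).1 * Polynomial.X)).comp
        (Polynomial.mapRingHom (toFieldHom y)) := by
    refine Polynomial.ringHom_ext (fun a => ?_) ?_
    · simp only [RingHom.comp_apply, fromPoly, Polynomial.coe_eval₂RingHom, Polynomial.eval₂_C,
        Polynomial.coe_mapRingHom, Polynomial.map_C, Polynomial.coe_compRingHom, Polynomial.C_comp]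
      rfl
    · simp only [RingHom.comp_apply, fromPoly, Polynomial.coe_eval₂RingHom, Polynomial.eval₂_X,
        Polynomial.coe_mapRingHom, Polynomial.map_X, Polynomial.coe_compRingHom, Polynomial.X_comp]
      rfl
  exact RingHom.congr_fun this p

lemma fromPoly_bijective {U : X.Opens} {i : L.ι} (h : U ≤ L.U i) (y : U) :
    Function.Bijective (L.fromPoly h) := by
  constructor
  · intro p q hpq
    have := congrArg (L.valAt y) hpq
    rw [valAt_fromPoly, valAt_fromPoly] at this
    ext k
    have hk := congrArg (fun r => r.coeff k) this
    simp only [Polynomial.comp_C_mul_X_coeff, Polynomial.coeff_map] at hk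
    have h0 : ((((L.f i)⁻¹ : X.functionFieldˣ).1) ^ k) ≠ 0 := pow_ne_zero _ (Units.ne_zero _)
    have hk' := mul_right_cancel₀ h0 hk
    exact toField_injective fun z hz =>
      (toField_eq _ z y.1 hz y.2).trans (hk'.trans (toField_eq _ y.1 z y.2 hz))
  · rintro s
    obtain ⟨q, hq, h1, h2⟩ := s.2
    choose a ha using fun k => exists_section U (q.coeff k * (L.f i : X.functionField) ^ k)
      fun x hx => hq k x hx i (h hx)
    refine ⟨∑ k ∈ Finset.range (q.natDegree + 1), Polynomial.monomial k (a k), L.symAlg_ext y ?_⟩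
    change L.valAt y _ = _
    rw [h1, valAt_fromPoly]
    ext k
    simp only [Polynomial.comp_C_mul_X_coeff, Polynomial.coeff_map, Polynomial.finsetSum_coeff,
      Polynomial.coeff_monomial, Finset.sum_ite_eq', Finset.mem_range]
    split_ifs with hk
    · have : toFieldHom y (a k) = q.coeff k * (L.f i : X.functionField) ^ k := ha k y.1 y.2
      rw [this, mul_assoc, ← mul_pow]
      simp
    · rw [map_zero, zero_mul, Polynomial.coeff_eq_zero_of_natDegree_lt (by omega)]

/-- Over a trivialising open set, the line bundle is an affine line. -/
def symAlgEquiv {U : X.Opens} {i : L.ι} (h : U ≤ L.U i) (y : U) :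
    MvPolynomial PUnit.{1} Γ(X, U) ≃+* L.symAlg U :=
  (MvPolynomial.uniqueAlgEquiv Γ(X, U) PUnit.{1}).toRingEquiv.trans
    (RingEquiv.ofBijective _ (L.fromPoly_bijective h y))

lemma symAlgEquiv_C {U : X.Opens} {i : L.ι} (h : U ≤ L.U i) (y : U) (a : Γ(X, U)) :
    L.symAlgEquiv h y (MvPolynomial.C a) = L.symAlgC U a := by
  simp [symAlgEquiv, fromPoly]

/-- Properties that are local on the target and hold for affine lines hold for the projection
of the line bundle. -/
lemma proj_of_affineLine (P : MorphismProperty Scheme.{0}) [IsZariskiLocalAtTarget P]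
    (hP : ∀ R : CommRingCat.{0}, P (𝔸(PUnit.{1}; Spec R) ↘ Spec R)) : P L.proj := by
  have hcov : ∀ x : X, ∃ U : X.AffineZariskiSite, x ∈ U.1 ∧ ∃ i, U.1 ≤ L.U i := by
    intro x
    obtain ⟨i, hi⟩ := L.exists_mem x
    obtain ⟨_, ⟨V, hV, rfl⟩, hxV, hVU⟩ :=
      X.isBasis_affineOpens.exists_subset_of_mem_open hi (L.U i).2
    exact ⟨⟨V, hV⟩, hxV, i, hVU⟩
  refine IsZariskiLocalAtTarget.of_forall_exists_morphismRestrict fun x => ?_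
  obtain ⟨U, hx, i, hi⟩ := hcov x
  refine ⟨U.1, hx, ?_⟩
  have h1 : P (Spec.map (CommRingCat.ofHom (L.symAlgC U.1))) := by
    let e := (L.symAlgEquiv hi ⟨x, hx⟩).toCommRingCatIso
    have h2 : CommRingCat.ofHom (L.symAlgC U.1) = CommRingCat.ofHom MvPolynomial.C ≫ e.hom := by
      refine CommRingCat.hom_ext (RingHom.ext fun a => ?_)
      exact (L.symAlgEquiv_C hi ⟨x, hx⟩ a).symm
    rw [h2, Spec.map_comp, P.cancel_left_of_respectsIso, ← AffineSpace.SpecIso_inv_over,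
      P.cancel_left_of_respectsIso]
    exact hP _
  have hpb := L.totalGluing.isPullback_natTrans_ι_toBase U
  have h3 : P (L.totalGluing.natTrans.app U) := by
    change P (Spec.map (CommRingCat.ofHom (L.symAlgC U.1)) ≫ U.2.isoSpec.inv)
    rwa [P.cancel_right_of_respectsIso]
  have hpb2 := isPullback_morphismRestrict L.proj U.1
  rw [← IsPullback.isoIsPullback_hom_fst _ _ hpb2 hpb]
  exact (P.cancel_left_of_respectsIso _ _).mpr h3

lemma isClosedUnderIsomorphisms_isIntegral :
    ObjectProperty.IsClosedUnderIsomorphisms (C := Scheme.{0}) IsIntegral :=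
  ⟨fun {Z S} e h => by
    have : Nonempty S := ⟨e.hom (@Nonempty.some _ h.1)⟩
    exact isIntegral_of_isOpenImmersion e.inv⟩

lemma isZariskiLocalAtTarget_geometricallyIntegral :
    IsZariskiLocalAtTarget (@GeometricallyIntegral : MorphismProperty Scheme.{0}) :=
  have := isClosedUnderIsomorphisms_isIntegral
  GeometricallyIntegral.eq_geometrically ▸
    instIsZariskiLocalAtTargetGeometricallyOfIsClosedUnderIsomorphismsScheme (P := IsIntegral)

instance : GeometricallyIntegral L.proj :=
  have := isZariskiLocalAtTarget_geometricallyIntegral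
  L.proj_of_affineLine @GeometricallyIntegral fun _ => inferInstance

instance : LocallyOfFinitePresentation L.proj :=
  have := HasRingHomProperty.instIsZariskiLocalAtTarget
    (@LocallyOfFinitePresentation : MorphismProperty Scheme.{0})
  L.proj_of_affineLine @LocallyOfFinitePresentation fun _ => inferInstance

instance : Flat L.proj :=
  have := HasRingHomProperty.instIsZariskiLocalAtTarget (@Flat : MorphismProperty Scheme.{0})
  L.proj_of_affineLine @Flat fun R => by
    have h : Flat (Spec.map (CommRingCat.ofHom
        (MvPolynomial.C : R →+* MvPolynomial PUnit.{1} R))) := by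
      rw [Flat.SpecMap_iff]
      exact RingHom.flat_algebraMap_iff.mpr
        (inferInstance : Module.Flat R (MvPolynomial PUnit.{1} R))
    rw [← AffineSpace.SpecIso_inv_over] at h
    have h2 : (𝔸(PUnit.{1}; Spec R) ↘ Spec R) = (AffineSpace.SpecIso PUnit.{1} R).hom ≫
        (AffineSpace.SpecIso PUnit.{1} R).inv ≫ (𝔸(PUnit.{1}; Spec R) ↘ Spec R) := by
      rw [Iso.hom_inv_id_assoc]
    rw [h2]
    infer_instance

instance : UniversallyOpen L.proj := inferInstance

end LocalTriviality

end CartierDivisor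

section Cech

/-- An open cover of a space, indexed by its points, with `x ∈ U x`. -/
structure PointedCover (X : Type) [TopologicalSpace X] where
  /-- The open set around a point. -/
  U : X → Opens X
  mem : ∀ x, x ∈ U x

/-- Pointed covers are ordered by refinement: larger means finer. -/
instance (X : Type) [TopologicalSpace X] : Preorder (PointedCover X) where
  le 𝓤 𝓥 := ∀ x, 𝓥.U x ≤ 𝓤.U x
  le_refl _ _ := le_rfl
  le_trans _ _ _ h h' x := (h' x).trans (h x)

variable {X : TopCat.{0}} (F : TopCat.Presheaf Ab.{0} X)

/-- The restriction map of a presheaf of abelian groups. -/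
def res {U V : Opens X} (h : U ≤ V) : F.obj (op V) →+ F.obj (op U) :=
  (F.map (homOfLE h).op).hom

lemma res_res {U V W : Opens X} (h : U ≤ V) (h' : V ≤ W) (s : F.obj (op W)) :
    res F h (res F h' s) = res F (h.trans h') s :=
  (ConcreteCategory.congr_hom (F.map_comp (homOfLE h').op (homOfLE h).op) s).symm

/-- Čech `1`-cocycles. -/
def cocycles (𝓤 : PointedCover X) : AddSubgroup (∀ x y, F.obj (op (𝓤.U x ⊓ 𝓤.U y))) where
  carrier := {c | ∀ x y z,
    res F (U := 𝓤.U x ⊓ 𝓤.U y ⊓ 𝓤.U z) inf_le_left (c x y) +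
      res F (inf_le_inf_right _ inf_le_right) (c y z) =
      res F (inf_le_inf_right _ inf_le_left) (c x z)}
  zero_mem' x y z := by simp
  add_mem' {a b} ha hb x y z := by
    simp only [Pi.add_apply, map_add]
    rw [← ha x y z, ← hb x y z]
    abel
  neg_mem' {a} ha x y z := by
    simp only [Pi.neg_apply, map_neg]
    rw [← ha x y z]
    abel

/-- The Čech coboundary of a `0`-cochain. -/
def coboundary (𝓤 : PointedCover X) : (∀ x, F.obj (op (𝓤.U x))) →+ cocycles F 𝓤 where
  toFun b := ⟨fun x y => res F inf_le_right (b y) - res F inf_le_left (b x), fun x y z => by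
    simp only [map_sub, res_res]
    abel⟩
  map_zero' := by
    ext x y
    simp
  map_add' a b := by
    ext x y
    simp only [Pi.add_apply, map_add, AddSubgroup.coe_add]
    abel

/-- The first Čech cohomology group of a cover. -/
abbrev CechH1 (𝓤 : PointedCover X) : Type := cocycles F 𝓤 ⧸ (coboundary F 𝓤).range

/-- Refinement of cocycles. -/
def refineCocycle {𝓤 𝓥 : PointedCover X} (h : 𝓤 ≤ 𝓥) : cocycles F 𝓤 →+ cocycles F 𝓥 where
  toFun c := ⟨fun x y => res F (inf_le_inf (h x) (h y)) (c.1 x y), fun x y z => by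
    have := congrArg (res F (inf_le_inf (inf_le_inf (h x) (h y)) (h z))) (c.2 x y z)
    simpa only [map_add, res_res] using this⟩
  map_zero' := by
    ext x y
    simp
  map_add' a b := by
    ext x y
    simp

/-- The refinement map on Čech cohomology. -/
def refineH1 {𝓤 𝓥 : PointedCover X} (h : 𝓤 ≤ 𝓥) : CechH1 F 𝓤 →+ CechH1 F 𝓥 :=
  QuotientAddGroup.map _ _ (refineCocycle F h) (by
    rintro _ ⟨b, rfl⟩
    refine ⟨fun x => res F (h x) (b x), ?_⟩
    ext x y
    simp [coboundary, refineCocycle, res_res])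

open Classical in
/-- The first cohomology group: the direct limit of Čech cohomology over all covers. -/
def H1 : Type := AddCommGroup.DirectLimit (CechH1 F) (fun _ _ h => refineH1 F h)

open Classical in
instance : AddCommGroup (H1 F) :=
  inferInstanceAs (AddCommGroup (AddCommGroup.DirectLimit _ _))

open Classical in
/-- The cohomology class of a cocycle. -/
def H1.mk (𝓤 : PointedCover X) : cocycles F 𝓤 →+ H1 F :=
  (AddCommGroup.DirectLimit.of (CechH1 F) (fun _ _ h => refineH1 F h) 𝓤).comp
    (QuotientAddGroup.mk' _)

open Classical in
lemma H1.mk_refine {𝓤 𝓥 : PointedCover X} (h : 𝓤 ≤ 𝓥) (c : cocycles F 𝓤) :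
    H1.mk F 𝓥 (refineCocycle F h c) = H1.mk F 𝓤 c :=
  AddCommGroup.DirectLimit.of_f (G := CechH1 F) (f := fun _ _ h => refineH1 F h) (hij := h)
    (x := QuotientAddGroup.mk' _ c)

open Classical in
lemma H1.mk_coboundary (𝓤 : PointedCover X) (b) : H1.mk F 𝓤 (coboundary F 𝓤 b) = 0 := by
  have : QuotientAddGroup.mk' (coboundary F 𝓤).range (coboundary F 𝓤 b) = 0 :=
    (QuotientAddGroup.eq_zero_iff _).mpr ⟨b, rfl⟩
  exact (congrArg (AddCommGroup.DirectLimit.of (CechH1 F) (fun _ _ h => refineH1 F h) 𝓤) this).trans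
    (map_zero _)

open Classical in
/-- Homomorphisms out of `H1` from compatible homomorphisms on cocycles. -/
def H1.lift {A : Type} [AddCommGroup A] (g : ∀ 𝓤, cocycles F 𝓤 →+ A)
    (h0 : ∀ 𝓤 b, g 𝓤 (coboundary F 𝓤 b) = 0)
    (hr : ∀ 𝓤 𝓥 (h : 𝓤 ≤ 𝓥) c, g 𝓥 (refineCocycle F h c) = g 𝓤 c) : H1 F →+ A :=
  AddCommGroup.DirectLimit.lift _ _ A
    (fun 𝓤 => QuotientAddGroup.lift (coboundary F 𝓤).range (g 𝓤) (by
      rintro _ ⟨b, rfl⟩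
      exact h0 𝓤 b))
    (fun 𝓤 𝓥 h c => by
      obtain ⟨c, rfl⟩ := QuotientAddGroup.mk_surjective c
      exact hr 𝓤 𝓥 h c)

open Classical in
lemma H1.lift_mk {A : Type} [AddCommGroup A] (g : ∀ 𝓤, cocycles F 𝓤 →+ A) (h0 hr) (𝓤)
    (c : cocycles F 𝓤) : H1.lift F g h0 hr (H1.mk F 𝓤 c) = g 𝓤 c := by
  exact AddCommGroup.DirectLimit.lift_of ..

variable {F} {G : TopCat.Presheaf Ab.{0} X}

lemma app_res (φ : F ⟶ G) {U V : Opens X} (h : U ≤ V) (s : F.obj (op V)) :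
    (φ.app (op U)).hom (res F h s) = res G h ((φ.app (op V)).hom s) :=
  ConcreteCategory.congr_hom (φ.naturality (homOfLE h).op) s

/-- The image of a cocycle under a morphism of presheaves. -/
def mapCocycle (φ : F ⟶ G) (𝓤 : PointedCover X) : cocycles F 𝓤 →+ cocycles G 𝓤 where
  toFun c := ⟨fun x y => (φ.app _).hom (c.1 x y), fun x y z => by
    have := congrArg (φ.app _).hom (c.2 x y z)
    rw [map_add, app_res, app_res, app_res] at this
    exact this⟩
  map_zero' := by
    ext x y
    simp
  map_add' a b := by
    ext x y
    simp

/-- Functoriality of `H1` in the presheaf. -/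
def H1.map (φ : F ⟶ G) : H1 F →+ H1 G :=
  H1.lift F (fun 𝓤 => (H1.mk G 𝓤).comp (mapCocycle φ 𝓤))
    (fun 𝓤 b => by
      have : mapCocycle φ 𝓤 (coboundary F 𝓤 b) = coboundary G 𝓤 fun x => (φ.app _).hom (b x) := by
        ext x y
        simp [mapCocycle, coboundary, app_res]
      rw [AddMonoidHom.comp_apply, this, H1.mk_coboundary])
    (fun 𝓤 𝓥 h c => by
      have : mapCocycle φ 𝓥 (refineCocycle F h c) = refineCocycle G h (mapCocycle φ 𝓤 c) := by
        ext x y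
        simp [mapCocycle, refineCocycle, app_res]
      rw [AddMonoidHom.comp_apply, this, H1.mk_refine]
      rfl)

variable {Y : TopCat.{0}} (f : Y ⟶ X) (K : TopCat.Presheaf Ab.{0} Y)

/-- The inverse image of a pointed cover. -/
def PointedCover.comap (𝓤 : PointedCover X) : PointedCover Y where
  U y := (Opens.map f).obj (𝓤.U (f y))
  mem y := 𝓤.mem (f y)

/-- Cocycles of the direct image give cocycles on the inverse image cover. -/
def pullCocycle (𝓤 : PointedCover X) :
    cocycles ((TopCat.Presheaf.pushforward Ab.{0} f).obj K) 𝓤 →+ cocycles K (𝓤.comap f) where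
  toFun c := ⟨fun x y => c.1 (f x) (f y), fun x y z => c.2 (f x) (f y) (f z)⟩
  map_zero' := rfl
  map_add' _ _ := rfl

/-- The natural homomorphism from the cohomology of the direct image. -/
def H1.pull : H1 ((TopCat.Presheaf.pushforward Ab.{0} f).obj K) →+ H1 K :=
  H1.lift _ (fun 𝓤 => (H1.mk K (𝓤.comap f)).comp (pullCocycle f K 𝓤))
    (fun 𝓤 b => H1.mk_coboundary K (𝓤.comap f) fun y => b (f y))
    (fun 𝓤 𝓥 h c => H1.mk_refine K (𝓤 := 𝓤.comap f) (𝓥 := 𝓥.comap f)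
      (fun y _ hy => h (f y) hy) (pullCocycle f K 𝓤 c))

end Cech

section Divisors

variable {X Y : Scheme.{0}}

/-- The ideal, in the local ring at `x`, of the germs that vanish on the set `Z`. -/
def idealOf (Z : Set X) (x : X) : Ideal (X.presheaf.stalk x) :=
  ⨅ (y : X) (_ : y ∈ Z) (h : y ⤳ x),
    (IsLocalRing.maximalIdeal (X.presheaf.stalk y)).comap (X.presheaf.stalkSpecializes h).hom

/-- `z` is a local equation at `x` of the (reduced) divisor with support `Z`. -/
def IsLocalEquation (Z : Set X) (x : X) (z : X.presheaf.stalk x) : Prop :=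
  Ideal.span {z} = idealOf Z x

/-- Regular systems of parameters of a local ring. -/
def IsRegularSystem (R : Type) [CommRing R] [IsLocalRing R] {n : ℕ} (z : Fin n → R) : Prop :=
  Ideal.span (Set.range z) = IsLocalRing.maximalIdeal R ∧ ringKrullDim R = n

/-- The reduced divisors `D j` are smooth and cross normally: at every closed point there are local
coordinates, some of which are local equations of the `D j` through that point. -/
def IsSNC {J : Type} (D : J → Set X) : Prop :=
  (∀ j, IsClosed (D j)) ∧ ∀ x : X, IsClosed {x} →
    ∃ (n : ℕ) (z : Fin n → X.presheaf.stalk x) (a : {j // x ∈ D j} → Fin n),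
      IsRegularSystem (X.presheaf.stalk x) z ∧ Function.Injective a ∧
        ∀ j : {j // x ∈ D j}, IsLocalEquation (D j) x (z (a j))

/-- Prime divisors: irreducible closed subsets of codimension one. -/
def IsPrimeDivisor (Z : Set X) : Prop :=
  ∃ x : X, closure {x} = Z ∧ ringKrullDim (X.presheaf.stalk x) = 1

/-- The largest open subset of the target over which `f` is an isomorphism. -/
def isoLocus (f : Y ⟶ X) : X.Opens := sSup {U | IsIso (f ∣_ U)}

/-- The strict transform of a set under a birational morphism. -/
def strictTransform (f : Y ⟶ X) (Z : Set X) : Set Y := closure (f ⁻¹' (Z ∩ isoLocus f))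

/-- Proper birational morphisms. -/
class IsModification (f : Y ⟶ X) : Prop where
  proper : IsProper f
  birational : ∃ U : X.Opens, (U : Set X).Nonempty ∧ IsIso (f ∣_ U)

instance [IsIntegral X] (f : Y ⟶ X) [h : IsModification f] : IsDominant f := by
  obtain ⟨U, hU, hf⟩ := h.birational
  refine ⟨fun x => ?_⟩
  have hd : Dense (U : Set X) := U.2.dense hU
  refine closure_mono ?_ (hd x)
  intro y hy
  obtain ⟨z, hz⟩ := (f ∣_ U).surjective ⟨y, hy⟩
  exact ⟨z.1, (morphismRestrict_base_coe f U z).symm.trans (congrArg Subtype.val hz)⟩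

end Divisors

section Forms

variable {X : Scheme.{0}} {Y : Scheme.{0}} [IsIntegral Y] [Y.Over SpecC]

/-- The stalks of the sheaf of regular `1`-forms: the submodule of rational forms that is
generated by the differentials of regular functions. On a smooth variety, this is the sheaf of
Kähler differentials. -/
def regularForms (Y : Scheme.{0}) [IsIntegral Y] [Y.Over SpecC] : FormStalks Y := fun y =>
  Submodule.span (Y.presheaf.stalk y)
    (Set.range fun g : Y.presheaf.stalk y => KaehlerDifferential.D ℂ Y.functionField
      (algebraMap (Y.presheaf.stalk y) Y.functionField g))

/-- The stalks of the pull-back under `σ : Y ⟶ X` of the orbifold cotangent sheaf of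
`(X, ∑ δ j • D j)`. They are generated by the pull-backs of regular forms on `X` and by the forms
`w ^ (- e * δ j) • d (σ^* z)`, where `z` and `w` are local equations of `D j` and of its preimage,
and `e` is the ramification index, i.e. `σ^* z = u * w ^ e` with a unit `u`. In coordinates with
`σ^* z = w ^ e` the latter form is `e • w ^ (- d) • dw` with `d = 1 - e + e * δ j`. (Divisors with
coefficient `0` contribute nothing new.) -/
def orbCotangent (σ : Y ⟶ X) {J : Type} (D : J → Set X) (δ : J → ℚ) : FormStalks Y := fun y =>
  Submodule.span (Y.presheaf.stalk y)
    ((Set.range fun g : X.presheaf.stalk (σ y) =>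
        KaehlerDifferential.D ℂ Y.functionField (pullGerm σ y g)) ∪
      {ω | ∃ (j : J) (z : X.presheaf.stalk (σ y)) (w u : Y.presheaf.stalk y) (e m : ℕ),
        IsLocalEquation (D j) (σ y) z ∧ IsLocalEquation (σ ⁻¹' D j) y w ∧ IsUnit u ∧
        (σ.stalkMap y).hom z = u * w ^ e ∧ (m : ℚ) = e * δ j ∧
        ω = (algebraMap (Y.presheaf.stalk y) Y.functionField w ^ m)⁻¹ •
          KaehlerDifferential.D ℂ Y.functionField (pullGerm σ y z)})

lemma formMap_regularForms [IsIntegral X] [X.Over SpecC] (σ : Y ⟶ X) [IsDominant σ]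
    [σ.IsOver SpecC] {J : Type} (D : J → Set X) (δ : J → ℚ) (y : Y) (m : RatForms X)
    (hm : m ∈ regularForms X (σ y)) : formMap σ m ∈ orbCotangent σ D δ y := by
  refine Submodule.span_induction ?_ ?_ ?_ ?_ hm
  · rintro _ ⟨g, rfl⟩
    refine Submodule.subset_span (Or.inl ⟨g, ?_⟩)
    rw [formMap_D, fieldMap_algebraMap]
  · rw [map_zero]
    exact zero_mem _
  · intro a b _ _ ha hb
    rw [map_add]
    exact add_mem ha hb
  · intro r a _ ha
    rw [← algebraMap_smul X.functionField r a, formMap_smul, fieldMap_algebraMap]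
    exact Submodule.smul_mem _ ((σ.stalkMap y).hom r) ha

end Forms

section Classes

variable {X : Scheme.{0}}

/-- The presheaf of units, written additively. -/
def unitsPresheaf (X : Scheme.{0}) : TopCat.Presheaf Ab.{0} X where
  obj U := AddCommGrpCat.of (Additive Γ(X, U.unop)ˣ)
  map i := AddCommGrpCat.ofHom (Units.map (X.presheaf.map i).hom.toMonoidHom).toAdditive
  map_id U := by
    ext u
    exact Units.ext (ConcreteCategory.congr_hom (X.presheaf.map_id U) (Units.val (Additive.toMul u)))
  map_comp i j := by
    ext u
    exact Units.ext (ConcreteCategory.congr_hom (X.presheaf.map_comp i j)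
      (Units.val (Additive.toMul u)))

variable [IsIntegral X]

lemma toField_ne_zero {U : X.Opens} (u : Γ(X, U)ˣ) (y : X) (hy : y ∈ U) :
    toField (u : Γ(X, U)) y hy ≠ 0 := fun h => by
  have : toField ((u : Γ(X, U)) * (u⁻¹ : Γ(X, U)ˣ).1) y hy = 1 := by
    rw [u.mul_inv, toField_one]
  rw [toField_mul, h, zero_mul] at this
  exact zero_ne_one this

lemma inv_toField {U : X.Opens} (u : Γ(X, U)ˣ) (y : X) (hy : y ∈ U) :
    (toField (u : Γ(X, U)) y hy)⁻¹ = toField (u⁻¹ : Γ(X, U)ˣ).1 y hy := by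
  refine inv_eq_of_mul_eq_one_right ?_
  rw [← toField_mul, u.mul_inv, toField_one]

/-- The logarithmic derivative of a rational function. -/
def dlogForm [X.Over SpecC] (g : X.functionField) : RatForms X :=
  g⁻¹ • KaehlerDifferential.D ℂ X.functionField g

lemma dlogForm_mul [X.Over SpecC] {g h : X.functionField} (hg : g ≠ 0) (hh : h ≠ 0) :
    dlogForm (g * h) = dlogForm g + dlogForm h := by
  simp only [dlogForm, Derivation.leibniz, smul_add, smul_smul]
  rw [add_comm]
  congr 2
  · field_simp
  · field_simp

/-- The logarithmic derivative of a unit, as a section of the sheaf of regular `1`-forms. -/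
def dlogSection [X.Over SpecC] {U : X.Opens} (u : Γ(X, U)ˣ) : formSections (regularForms X) U :=
  ⟨fun y => dlogForm (toField (u : Γ(X, U)) y.1 y.2), fun y =>
    ⟨U, y.2, dlogForm (toField (u : Γ(X, U)) y.1 y.2), fun z hz => by
      have h : toField (u : Γ(X, U)) y.1 y.2 = toField (u : Γ(X, U)) z.1 z.2 := toField_eq _ _ _ _ _
      rw [h]
      refine ⟨?_, rfl⟩
      rw [dlogForm, inv_toField, toField, algebraMap_smul]
      exact Submodule.smul_mem _ _ (Submodule.subset_span ⟨_, rfl⟩)⟩⟩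

/-- The logarithmic derivative `u ↦ u⁻¹ du`. -/
def dlog (X : Scheme.{0}) [IsIntegral X] [X.Over SpecC] :
    unitsPresheaf X ⟶ (formSheaf (regularForms X)).presheaf where
  app U := AddCommGrpCat.ofHom
    { toFun := fun u : Additive Γ(X, U.unop)ˣ => dlogSection u.toMul
      map_zero' := by
        apply Subtype.ext; funext y
        change dlogForm (toField (1 : Γ(X, U.unop)) y.1 y.2) = 0
        rw [toField_one, dlogForm]
        simp
      map_add' := fun u v => by
        apply Subtype.ext; funext y
        change dlogForm (toField (u.toMul.1 * v.toMul.1) y.1 y.2) = dlogForm _ + dlogForm _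
        rw [toField_mul, dlogForm_mul (toField_ne_zero _ _ _) (toField_ne_zero _ _ _)] }
  naturality U V i := by
    ext u
    apply Subtype.ext; funext y
    exact congrArg dlogForm (toField_res i.unop (U := V.unop) (V := U.unop) u.toMul.1 y.1 y.2)

namespace CartierDivisor

variable (L : CartierDivisor X)

/-- An open set of the cover around a point. -/
def idx (x : X) : L.ι := (L.exists_mem x).choose

lemma mem_idx (x : X) : x ∈ L.U (L.idx x) := (L.exists_mem x).choose_spec

/-- The first Chern class of the line bundle `𝒪(L)` in the first cohomology of the units: the class
of the transition functions `f i / f j`. -/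
def c1 : H1 (unitsPresheaf X) :=
  H1.mk (unitsPresheaf X) ⟨fun x => L.U (L.idx x), L.mem_idx⟩
    ⟨fun x y => Additive.ofMul (L.cocycle (L.idx x) (L.idx y)).choose, fun x y z => by
      refine Units.ext (toField_injective fun p hp => ?_)
      have hx : p ∈ L.U (L.idx x) := hp.1.1
      have hy : p ∈ L.U (L.idx y) := hp.1.2
      have hz : p ∈ L.U (L.idx z) := hp.2
      have h1 := (L.cocycle (L.idx x) (L.idx y)).choose_spec p ⟨hx, hy⟩
      have h2 := (L.cocycle (L.idx y) (L.idx z)).choose_spec p ⟨hy, hz⟩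
      have h3 := (L.cocycle (L.idx x) (L.idx z)).choose_spec p ⟨hx, hz⟩
      refine mul_right_cancel₀ (Units.ne_zero (L.f (L.idx z))) ?_
      refine Eq.trans ?_ ((congrArg (· * _) (toField_res _ _ p hp)).trans h3).symm
      refine (congrArg (· * _) ((toField_mul _ _ p hp).trans
        (congrArg₂ (· * ·) (toField_res _ _ p hp) (toField_res _ _ p hp)))).trans ?_
      rw [mul_assoc]
      exact (congrArg (_ * ·) h2).trans h1⟩

/-- Ampleness: the complements of the zero sets of sections of positive multiples that are affine
cover `X`. -/
def IsAmple : Prop :=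
  ∀ x : X, ∃ (k : ℕ) (g : X.functionField) (U : X.Opens), 0 < k ∧ L.IsSection k ⊤ g ∧
    IsAffineOpen U ∧ x ∈ U ∧ ∀ (y : X) (i : L.ι), y ∈ L.U i →
      (y ∈ U ↔ ∃ u : (X.presheaf.stalk y)ˣ, algebraMap (X.presheaf.stalk y) X.functionField u =
        g * (L.f i : X.functionField) ^ k)

end CartierDivisor

end Classes

section Kawamata

variable {X Y : Scheme.{0}} [IsIntegral X] [IsIntegral Y]

/-- `σ : Y ⟶ X` is a Kawamata covering for the simple normal crossing divisors `D j`, with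
ramification index `N`: it is finite and Galois, étale over the complement of the divisors, the
preimage of the divisors has simple normal crossings, and in suitable coordinates near a closed
point `y` of `Y` and near `σ y` the map sends the coordinate `w` along each `D j` to `z = w ^ N`, up
to a unit, and is the identity in the other coordinates. -/
structure IsKawamataCover (σ : Y ⟶ X) [IsDominant σ] {J : Type} (D : J → Set X) (N : ℕ) : Prop where
  finite : IsFinite σ
  galois : letI := (fieldMap σ).toAlgebra; IsGalois X.functionField Y.functionField
  etale : ∀ U : X.Opens, (∀ j, Disjoint (U : Set X) (D j)) → Etale (σ ∣_ U)
  snc : IsSNC fun j => σ ⁻¹' D j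
  local_form : ∀ y : Y, IsClosed {y} →
    ∃ (n : ℕ) (z : Fin n → X.presheaf.stalk (σ y)) (w : Fin n → Y.presheaf.stalk y)
      (a : {j // σ y ∈ D j} → Fin n),
      IsRegularSystem (X.presheaf.stalk (σ y)) z ∧ IsRegularSystem (Y.presheaf.stalk y) w ∧
      Function.Injective a ∧
      (∀ j : {j // σ y ∈ D j}, IsLocalEquation (D j) (σ y) (z (a j)) ∧
        ∃ u, IsUnit u ∧ (σ.stalkMap y).hom (z (a j)) = u * w (a j) ^ N) ∧
      ∀ k, k ∉ Set.range a → (σ.stalkMap y).hom (z k) = w k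

end Kawamata

section Modules

variable {X Y : Scheme.{0}}

/-- The structure sheaf as a module over itself. -/
abbrev structureSheaf (X : Scheme.{0}) : X.Modules := SheafOfModules.unit X.ringCatSheaf

/-- The canonical morphism `f^* 𝒪_X ⟶ 𝒪_Y`. -/
def pullbackUnit (f : Y ⟶ X) :
    (Scheme.Modules.pullback f).obj (structureSheaf X) ⟶ structureSheaf Y :=
  ((Scheme.Modules.pullbackPushforwardAdjunction f).homEquiv _ _).symm
    (SheafOfModules.unitToPushforwardObjUnit f.toRingCatSheafHom)

/-- For a section `s` of `p`, the restriction along `s` of a morphism `p^* M ⟶ N`. -/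
def restrictHom (s : X ⟶ Y) (p : Y ⟶ X) (h : s ≫ p = 𝟙 X) {M : X.Modules} {N : Y.Modules}
    (α : (Scheme.Modules.pullback p).obj M ⟶ N) : M ⟶ (Scheme.Modules.pullback s).obj N :=
  (Scheme.Modules.pullbackId X).inv.app M ≫ (Scheme.Modules.pullbackCongr h).inv.app M ≫
    (Scheme.Modules.pullbackComp s p).inv.app M ≫ (Scheme.Modules.pullback s).map α

/-- `ξ` is the class of the extension `0 ⟶ F ⟶ E ⟶ 𝒪 ⟶ 0`, i.e. the image of `1` under the
connecting homomorphism `H⁰(𝒪) → H¹(F)`: it is represented by the differences of local lifts of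
the section `1`. -/
def IsExtensionClass {F E : X.Modules} (a : F ⟶ E) (b : E ⟶ structureSheaf X)
    (ξ : H1 F.presheaf) : Prop :=
  ∃ (𝓤 : PointedCover X) (e : ∀ x, Γ(E, 𝓤.U x)) (c : cocycles F.presheaf 𝓤),
    (∀ x, b.app (𝓤.U x) (e x) = (1 : Γ(X, 𝓤.U x))) ∧
    (∀ x y, a.app (𝓤.U x ⊓ 𝓤.U y) (c.1 x y) =
      res E.presheaf inf_le_right (e y) - res E.presheaf inf_le_left (e x)) ∧
    ξ = H1.mk F.presheaf 𝓤 c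

/-- The pull-back of cohomology classes `H¹(X, M) → H¹(Y, f^* M)`. -/
def pullH1 (f : Y ⟶ X) (M : X.Modules) :
    H1 M.presheaf →+ H1 ((Scheme.Modules.pullback f).obj M).presheaf :=
  (H1.pull f.base ((Scheme.Modules.pullback f).obj M).presheaf).comp
    (H1.map ((Scheme.Modules.pullbackPushforwardAdjunction f).unit.app M).mapPresheaf)

end Modules

section Cone

variable {S S₁ S₂ : Scheme.{0}} [IsIntegral S] [IsIntegral S₁] [IsIntegral S₂]

namespace CartierDivisor

/-- The composition of the morphism from the total space of `μ^* L⁻¹` to the total space of `L⁻¹`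
with the contraction of the latter to the cone over `S`. -/
def resToCone (L : CartierDivisor S) (μ : S₁ ⟶ S) [IsDominant μ] :
    (L.pullback μ).totalSpace ⟶ L.cone :=
  (L.pullback μ).toCone ≫ Spec.map (CommRingCat.ofHom (L.pullSections μ))

/-- The exceptional divisor over the vertex of the cone. -/
def exceptional (L : CartierDivisor S) (μ : S₁ ⟶ S) [IsDominant μ] :
    Set (L.pullback μ).totalSpace :=
  L.resToCone μ ⁻¹' {L.vertex}

/-- The fibre product of `σ : S₂ ⟶ S₁` with the total space of a line bundle on `S₁`. -/
def coverTotal (L : CartierDivisor S₁) (σ : S₂ ⟶ S₁) : Scheme.{0} := Limits.pullback σ L.proj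

variable (L : CartierDivisor S₁) (σ : S₂ ⟶ S₁)

/-- The projection of the fibre product to the cover of the base. -/
def coverProj : L.coverTotal σ ⟶ S₂ := Limits.pullback.fst σ L.proj

/-- The projection of the fibre product to the total space. -/
def coverMap : L.coverTotal σ ⟶ L.totalSpace := Limits.pullback.snd σ L.proj

/-- The zero section of the fibre product. -/
def coverZero : S₂ ⟶ L.coverTotal σ :=
  Limits.pullback.lift (𝟙 S₂) (σ ≫ L.zeroSection) (by
    rw [Category.assoc, L.zeroSection_proj, Category.comp_id, Category.id_comp])

lemma coverZero_coverProj : L.coverZero σ ≫ L.coverProj σ = 𝟙 S₂ :=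
  Limits.pullback.lift_fst _ _ _

instance : Surjective (L.coverProj σ) :=
  inferInstanceAs (Surjective (Limits.pullback.fst σ L.proj))

instance : IsDominant (L.coverProj σ) := inferInstance

variable [S₂.Over SpecC]

instance : (L.coverTotal σ).Over SpecC := ⟨L.coverProj σ ≫ (S₂ ↘ SpecC)⟩

instance : (L.coverProj σ).IsOver SpecC := ⟨rfl⟩

instance [Smooth (S₂ ↘ SpecC)] : IsIntegral (L.coverTotal σ) :=
  have : IsLocallyNoetherian S₂ := LocallyOfFiniteType.isLocallyNoetherian (S₂ ↘ SpecC)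
  inferInstanceAs (IsIntegral (Limits.pullback σ L.proj))

end CartierDivisor

variable [S₁.Over SpecC] [S₂.Over SpecC]

/-- The morphism `σ^* Ω¹ ⟶ σ^* Ω¹(log D)`. -/
def logInclusion (σ : S₂ ⟶ S₁) [IsDominant σ] [σ.IsOver SpecC] {J : Type} (D : J → Set S₁)
    (δ : J → ℚ) : (Scheme.Modules.pullback σ).obj (formSheaf (regularForms S₁)) ⟶
      formSheaf (orbCotangent σ D δ) :=
  ((Scheme.Modules.pullbackPushforwardAdjunction σ).homEquiv _ _).symm
    (formHom σ (regularForms S₁) (orbCotangent σ D δ) (formMap_regularForms σ D δ))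

/-- The composition
`H¹(S₁, 𝒪^*) → H¹(S₁, Ω¹) → H¹(S₂, σ^* Ω¹) → H¹(S₂, σ^* Ω¹(log D))`
of the logarithmic derivative, the pull-back, and the map induced by the inclusion. -/
def chernMap (σ : S₂ ⟶ S₁) [IsDominant σ] [σ.IsOver SpecC] {J : Type} (D : J → Set S₁)
    (δ : J → ℚ) : H1 (unitsPresheaf S₁) →+ H1 (formSheaf (orbCotangent σ D δ)).presheaf :=
  (H1.map (logInclusion σ D δ).mapPresheaf).comp
    ((pullH1 σ (formSheaf (regularForms S₁))).comp (H1.map (dlog S₁)))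

end Cone

end LogCone

end

open LogCone

/-! The proof compares the logarithmic forms on the total space with an explicit extension on the
base. Over an affine open set where `L` has the local equation `f i`, the line bundle is an affine
line with a coordinate `t i`, and the products `f i * t i` agree on overlaps: they are one rational
function, `fiberCoord`. The fibre product with the covering is again a line bundle; let `τ` be the
pull-back of that function to it. Then `dlog τ = π^* dlog (f i) + dlog (t i)`.

On the base, take the sheaf of pairs `(ω, r)`, to be read as `ω + r dlog τ`, with `r` regular and `ω
+ r dlog (f i)` an orbifold form (`extStalks`). It is visibly an extension of the structure sheaf by
the orbifold forms (`ext_shortExact`). The section `1` lifts locally to `(-dlog (f i), 1)`, which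
stands for `dlog (t i)`, and two such lifts differ by the logarithmic derivative of a transition
function. Hence the class of this extension is the image of the Chern class
(`isExtensionClass_chernMap`).

The heart of the proof is that `(ω, r) ↦ π^* ω + r dlog τ` identifies the pull-back of this
extension with the logarithmic forms upstairs. It is injective (`IsLogLine.mono_pullbackHom`)
because `π` is flat and because the pull-backs of a basis of rational forms stay independent
together with `dlog τ` (`injective_of_flat`, `linearIndependent_extForm`). It is surjective
(`IsLogLine.epi_pullbackHom`) because the orbifold forms of the base and `dlog (t i)` generate the
logarithmic forms (`orbCotangent_le_lineForms`). That generation needs `t i` to be a local equation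
of the fibre over the vertex. Here the geometry of the cone enters: ampleness, and the fact that a
nonzero regular function on a proper integral scheme is a unit
(`mem_exceptional_iff_notMem_basicOpen`).

The rest is formal. The zero section `i₀` satisfies `i₀^* π^* = id`, so restricting the isomorphism
to it recovers the extension on the base, together with its class (`extension_of_pullback_iso`). -/

noncomputable section

namespace LogCone

/-! ### Local criteria for monomorphisms, epimorphisms and exactness of sheaves of modules. -/

section ModuleSheaves

variable {X : Scheme.{0}} {M N P : X.Modules}

lemma mono_of_app_injective (φ : M ⟶ N) (h : ∀ U, Function.Injective (φ.app U)) : Mono φ := by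
  refine ⟨fun {Z} a b hab => ?_⟩
  ext U s
  refine h U ?_
  have := congrArg (fun ψ : Z ⟶ N => ψ.app U s) hab
  exact this

lemma app_injective_of_mono (φ : M ⟶ N) [Mono φ] (U : X.Opens) :
    Function.Injective (φ.app U) := by
  have : Mono ((Scheme.Modules.toPresheaf X).map φ) := inferInstance
  have h2 := (NatTrans.mono_iff_mono_app _).mp this (op U)
  exact (AddCommGrpCat.mono_iff_injective _).mp h2

/-- Sections of a sheaf of modules that agree locally are equal. -/
lemma section_ext (M : X.Modules) {U : X.Opens} (s t : Γ(M, U))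
    (h : ∀ x ∈ U, ∃ (V : X.Opens) (hV : V ≤ U), x ∈ V ∧
      res M.presheaf hV s = res M.presheaf hV t) : s = t := by
  refine TopCat.Presheaf.section_ext ⟨M.presheaf, M.isSheaf⟩ U s t fun x hx => ?_
  obtain ⟨V, hV, hxV, h⟩ := h x hx
  refine TopCat.Presheaf.germ_ext M.presheaf V hxV (homOfLE hV) (homOfLE hV) h

lemma hom_app_res (φ : M ⟶ N) {U V : X.Opens} (h : U ≤ V) (s : Γ(M, V)) :
    φ.app U (res M.presheaf h s) = res N.presheaf h (φ.app V s) :=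
  app_res φ.mapPresheaf h s

lemma epi_of_locally_surjective (φ : M ⟶ N)
    (h : ∀ (U : X.Opens) (s : Γ(N, U)), ∀ x ∈ U, ∃ (V : X.Opens) (hV : V ≤ U), x ∈ V ∧
      ∃ t : Γ(M, V), φ.app V t = res N.presheaf hV s) : Epi φ := by
  refine ⟨fun {Z} a b hab => ?_⟩
  ext U s
  refine section_ext Z _ _ fun x hx => ?_
  obtain ⟨V, hV, hxV, t, ht⟩ := h U s x hx
  refine ⟨V, hV, hxV, ?_⟩
  rw [← hom_app_res, ← hom_app_res, ← ht]
  exact congrArg (fun ψ : M ⟶ Z => ψ.app V t) hab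

/-- Exactness means that the induced map to the kernel is an epimorphism. Local preimages are found
in `N`, and the equality is carried back to the kernel because the kernel inclusion is injective on
sections. -/
lemma exact_of_locally_exact (φ : M ⟶ N) (ψ : N ⟶ P) (w : φ ≫ ψ = 0)
    (h : ∀ (U : X.Opens) (s : Γ(N, U)), ψ.app U s = 0 → ∀ x ∈ U,
      ∃ (V : X.Opens) (hV : V ≤ U), x ∈ V ∧ ∃ t : Γ(M, V), φ.app V t = res N.presheaf hV s) :
    (ShortComplex.mk φ ψ w).Exact := by
  rw [ShortComplex.exact_iff_epi_kernel_lift]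
  refine epi_of_locally_surjective _ fun U s x hx => ?_
  have hk : ψ.app U ((Limits.kernel.ι ψ).app U s) = 0 := by
    have := congrArg (fun ψ : _ ⟶ P => ψ.app U s) (Limits.kernel.condition ψ)
    exact this
  obtain ⟨V, hV, hxV, t, ht⟩ := h U _ hk x hx
  refine ⟨V, hV, hxV, t, app_injective_of_mono (Limits.kernel.ι ψ) V ?_⟩
  rw [hom_app_res, ← ht]
  exact congrArg (fun χ : M ⟶ N => χ.app V t) (Limits.kernel.lift_ι ψ φ w)

end ModuleSheaves

/-! ### The pull-back of the structure sheaf and its coherence isomorphisms. -/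

section PullbackUnit

variable {X Y : Scheme.{0}}

/-- Every object of the comma category maps to the one given by `⊤`, so the category is connected.
Finality is what makes the pull-back of the structure sheaf the structure sheaf. -/
instance final_opensMap (f : Y ⟶ X) : (Opens.map f.base).Final := by
  refine ⟨fun U => ?_⟩
  let T : StructuredArrow U (Opens.map f.base) := StructuredArrow.mk (Y := ⊤) (homOfLE le_top)
  have : Nonempty (StructuredArrow U (Opens.map f.base)) := ⟨T⟩
  refine zigzag_isConnected fun j k => ?_
  have h : ∀ j : StructuredArrow U (Opens.map f.base), Zigzag j T := fun j =>
    Zigzag.of_hom (StructuredArrow.homMk (homOfLE le_top) (Subsingleton.elim _ _))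
  exact (h j).trans ((h k).symm)

instance pullbackUnit_isIso (f : Y ⟶ X) : IsIso (pullbackUnit f) := by
  have h : (Scheme.Modules.pushforward f).IsRightAdjoint := inferInstance
  exact @SheafOfModules.instIsIsoPullbackObjUnitToUnitOfFinal _ _ _ _ _ _ _ _ _ _
    f.toRingCatSheafHom h (final_opensMap f)

/-- The canonical morphism `𝒪_X ⟶ f_* 𝒪_Y`. -/
def pushUnit (f : Y ⟶ X) :
    structureSheaf X ⟶ (Scheme.Modules.pushforward f).obj (structureSheaf Y) :=
  SheafOfModules.unitToPushforwardObjUnit f.toRingCatSheafHom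

lemma homEquiv_pullbackUnit (f : Y ⟶ X) :
    (Scheme.Modules.pullbackPushforwardAdjunction f).homEquiv _ _ (pullbackUnit f) = pushUnit f :=
  Equiv.apply_symm_apply _ _

/-- Calculus of mates: an identity between left adjoints is moved to the right adjoints. For modules
these are push-forwards, where the coherence maps are the identity on sections. -/
lemma homEquiv_conjugate {C D : Type*} [Category C] [Category D] {L₁ L₂ : C ⥤ D} {R₁ R₂ : D ⥤ C}
    (adj₁ : L₁ ⊣ R₁) (adj₂ : L₂ ⊣ R₂) (α : L₂ ⟶ L₁) {c : C} {d : D} (g : L₁.obj c ⟶ d) :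
    adj₂.homEquiv _ _ (α.app c ≫ g) =
      adj₁.homEquiv _ _ g ≫ (conjugateEquiv adj₁ adj₂ α).app d := by
  rw [Adjunction.homEquiv_unit, Adjunction.homEquiv_unit, Functor.map_comp, ← Category.assoc,
    ← unit_conjugateEquiv, Category.assoc, Category.assoc, NatTrans.naturality]

lemma pullbackComp_inv_pullbackUnit {Z : Scheme.{0}} (s : Z ⟶ Y) (p : Y ⟶ X) :
    (Scheme.Modules.pullbackComp s p).inv.app (structureSheaf X) ≫
      (Scheme.Modules.pullback s).map (pullbackUnit p) ≫ pullbackUnit s = pullbackUnit (s ≫ p) := by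
  refine ((Scheme.Modules.pullbackPushforwardAdjunction (s ≫ p)).homEquiv _ _).injective ?_
  rw [homEquiv_pullbackUnit]
  refine (homEquiv_conjugate ((Scheme.Modules.pullbackPushforwardAdjunction p).comp
    (Scheme.Modules.pullbackPushforwardAdjunction s)) _ _
    ((Scheme.Modules.pullback s).map (pullbackUnit p) ≫ pullbackUnit s)).trans ?_
  rw [Scheme.Modules.conjugateEquiv_pullbackComp_inv, Adjunction.comp_homEquiv]
  have h1 : (Scheme.Modules.pullbackPushforwardAdjunction s).homEquiv _ _
      ((Scheme.Modules.pullback s).map (pullbackUnit p) ≫ pullbackUnit s) =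
      pullbackUnit p ≫ pushUnit s := by
    rw [Adjunction.homEquiv_naturality_left, homEquiv_pullbackUnit]
  have h2 := (congrArg ((Scheme.Modules.pullbackPushforwardAdjunction p).homEquiv _ _) h1).trans
    ((Adjunction.homEquiv_naturality_right _ _ _).trans
      (congrArg (· ≫ _) (homEquiv_pullbackUnit p)))
  refine (congrArg (· ≫ _) h2).trans ?_
  ext U x
  rfl

lemma pullbackCongr_inv_pullbackUnit {p q : Y ⟶ X} (h : p = q) :
    (Scheme.Modules.pullbackCongr h).inv.app (structureSheaf X) ≫ pullbackUnit p =
      pullbackUnit q := by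
  subst h
  exact Category.id_comp _

lemma pullbackId_inv_pullbackUnit :
    (Scheme.Modules.pullbackId X).inv.app (structureSheaf X) ≫ pullbackUnit (𝟙 X) = 𝟙 _ := by
  have h : (Scheme.Modules.pullbackId X).hom.app (structureSheaf X) = pullbackUnit (𝟙 X) := by
    refine ((Scheme.Modules.pullbackPushforwardAdjunction (𝟙 X)).homEquiv _ _).injective ?_
    refine Eq.trans ?_ (homEquiv_pullbackUnit (𝟙 X)).symm
    have := homEquiv_conjugate Adjunction.id (Scheme.Modules.pullbackPushforwardAdjunction (𝟙 X))
      (Scheme.Modules.pullbackId X).hom (𝟙 (structureSheaf X))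
    rw [Scheme.Modules.conjugateEquiv_pullbackId_hom] at this
    refine (congrArg _ (Category.comp_id _).symm).trans (this.trans ?_)
    ext U x
    rfl
  rw [← h]
  exact Iso.inv_hom_id_app _ _

end PullbackUnit

/-! ### Restriction of pull-backs along a section. -/

section RestrictIso

variable {X Y : Scheme.{0}} (s : X ⟶ Y) (p : Y ⟶ X) (h : s ≫ p = 𝟙 X)

/-- For a section `s` of `p`, the functor `s^* p^*` is the identity. -/
def sectionIso : 𝟭 X.Modules ≅ Scheme.Modules.pullback p ⋙ Scheme.Modules.pullback s :=
  (Scheme.Modules.pullbackId X).symm ≪≫ (Scheme.Modules.pullbackCongr h).symm ≪≫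
    (Scheme.Modules.pullbackComp s p).symm

lemma restrictHom_eq {M : X.Modules} {N : Y.Modules}
    (α : (Scheme.Modules.pullback p).obj M ⟶ N) :
    restrictHom s p h α = (sectionIso s p h).hom.app M ≫ (Scheme.Modules.pullback s).map α := by
  simp [restrictHom, sectionIso]

/-- For the structure sheaf there are two identifications of `s^* p^* 𝒪` with `𝒪`, one from `s ≫ p =
𝟙` and one from `pullbackUnit`. Their agreement is what makes the restricted quotient map equal to
the original one. -/
lemma sectionIso_pullbackUnit :
    (sectionIso s p h).hom.app (structureSheaf X) ≫
      (Scheme.Modules.pullback s).map (pullbackUnit p) ≫ pullbackUnit s = 𝟙 _ := by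
  have h1 := pullbackComp_inv_pullbackUnit s p
  simp only [sectionIso, Iso.trans_hom, Iso.symm_hom, NatTrans.comp_app, Category.assoc]
  refine (congrArg (_ ≫ ·) (congrArg (_ ≫ ·) h1)).trans ?_
  rw [pullbackCongr_inv_pullbackUnit]
  exact pullbackId_inv_pullbackUnit

end RestrictIso

/-! ### Commutative algebra: injectivity from flatness and generic independence. -/

section FlatInjectivity

open TensorProduct

/-- The finitely many coordinates of a vector have a common denominator in `R`. After multiplication
by it they are scalars from `R`, which move across the tensor sign. -/
lemma exists_smul_tmul_basis {R R' K V ι : Type} [CommRing R] [CommRing R'] [Field K]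
    [Algebra R R'] [Algebra R K] [IsFractionRing R K] [AddCommGroup V] [Module K V] [Module R V]
    [IsScalarTower R K V] (b : Module.Basis ι K V) (x : R' ⊗[R] V) :
    ∃ s ∈ nonZeroDivisors R, ∃ c : ι →₀ R', s • x = c.sum fun i a => a ⊗ₜ[R] b i := by
  classical
  have hadd : ∀ c d : ι →₀ R', (c + d).sum (fun i a => a ⊗ₜ[R] b i) =
      c.sum (fun i a => a ⊗ₜ[R] b i) + d.sum fun i a => a ⊗ₜ[R] b i := fun c d =>
    Finsupp.sum_add_index' (fun _ => zero_tmul _ _) fun _ _ _ => add_tmul _ _ _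
  have hsmul : ∀ (r : R) (c : ι →₀ R'), (r • c).sum (fun i a => a ⊗ₜ[R] b i) =
      r • c.sum (fun i a => a ⊗ₜ[R] b i) := fun r c => by
    refine (Finsupp.sum_smul_index' (h := fun i a => a ⊗ₜ[R] b i) fun _ => zero_tmul _ _).trans ?_
    rw [Finsupp.smul_sum]
    rfl
  induction x using TensorProduct.induction_on with
  | zero => exact ⟨1, one_mem _, 0, by simp⟩
  | tmul a v =>
    obtain ⟨s, hs⟩ := IsLocalization.exist_integer_multiples_of_finset (nonZeroDivisors R)
      ((b.repr v).support.image (b.repr v))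
    -- The second clause makes the chosen numerators vanish outside the support of `v`, so that they
    -- form a finitely supported family.
    have hs' : ∀ i, ∃ r : R, algebraMap R K r = s.1 • b.repr v i ∧ (b.repr v i = 0 → r = 0) := by
      intro i
      by_cases hi : b.repr v i = 0
      · exact ⟨0, by simp [hi], fun _ => rfl⟩
      · obtain ⟨r, hr⟩ := hs (b.repr v i)
          (Finset.mem_image_of_mem _ (Finsupp.mem_support_iff.mpr hi))
        exact ⟨r, hr, fun h => (hi h).elim⟩
    choose r hr hr0 using hs'
    refine ⟨s.1, s.2, Finsupp.onFinset (b.repr v).support (fun i => r i • a) (fun i hi => ?_), ?_⟩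
    · rw [Finsupp.mem_support_iff]
      intro h0
      exact hi (by rw [hr0 i h0, zero_smul])
    · refine Eq.trans ?_ (Finsupp.onFinset_sum (g := fun i a => a ⊗ₜ[R] b i) _
        (fun _ => zero_tmul _ _)).symm
      conv_lhs => rw [← b.linearCombination_repr v, Finsupp.linearCombination_apply, Finsupp.sum,
        tmul_sum, Finset.smul_sum]
      refine Finset.sum_congr rfl fun i _ => ?_
      rw [← tmul_smul, smul_tmul, ← smul_assoc, ← hr, algebraMap_smul]
  | add x y hx hy =>
    obtain ⟨s, hs, c, hc⟩ := hx
    obtain ⟨t, ht, d, hd⟩ := hy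
    refine ⟨s * t, mul_mem hs ht, t • c + s • d, ?_⟩
    rw [hadd, hsmul, hsmul, ← hc, ← hd, smul_add, mul_smul, mul_smul, smul_comm s t x]

/-- A homomorphism from a module that is generated by a torsion-free module over a smaller ring is
injective, if it is so generically and the extension of rings is flat. -/
lemma injective_of_flat {R R' K K' N V Q W ι : Type} [CommRing R] [CommRing R'] [Field K]
    [Field K'] [Algebra R K] [IsFractionRing R K] [Algebra R' K'] [IsFractionRing R' K']
    [AddCommGroup N] [Module R N] [AddCommGroup V] [Module K V] [AddCommGroup Q] [Module R' Q]
    [AddCommGroup W] [Module K' W] (ρ : R →+* R') (hρ : ρ.Flat) (κ : K →+* K')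
    (hκ : ∀ r, κ (algebraMap R K r) = algebraMap R' K' (ρ r))
    (v : N →+ V) (hv : ∀ r n, v (r • n) = algebraMap R K r • v n) (hv' : Function.Injective v)
    (Λ : V →+ W) (hΛ : ∀ k x, Λ (k • x) = κ k • Λ x) (b : Module.Basis ι K V)
    (hb : LinearIndependent K' fun i => Λ (b i))
    (η : N →+ Q) (hη : ∀ r n, η (r • n) = ρ r • η n) (hspan : Submodule.span R' (Set.range η) = ⊤)
    (g : Q →+ W) (hg : ∀ a q, g (a • q) = algebraMap R' K' a • g q)
    (hgη : ∀ n, g (η n) = Λ (v n)) : Function.Injective g := by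
  have : Nontrivial R := (algebraMap R K).domain_nontrivial
  let _ := ρ.toAlgebra
  let _ : Module R V := Module.compHom V (algebraMap R K)
  have : IsScalarTower R K V := ⟨fun r k x => by
    rw [Algebra.smul_def, mul_smul]; rfl⟩
  let _ : Module R Q := Module.compHom Q ρ
  have : IsScalarTower R R' Q := ⟨fun r k x => by
    rw [Algebra.smul_def, mul_smul]; rfl⟩
  let _ : Module R' W := Module.compHom W (algebraMap R' K')
  have : IsScalarTower R' K' W := ⟨fun r k x => by
    rw [Algebra.smul_def, mul_smul]; rfl⟩
  let _ : Module R W := Module.compHom W ρ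
  have : IsScalarTower R R' W := ⟨fun r k x => by
    rw [Algebra.smul_def, mul_smul]; rfl⟩
  have hflat : Module.Flat R R' := hρ
  let vl : N →ₗ[R] V := { v with map_smul' := hv }
  let ηl : N →ₗ[R] Q := { η with map_smul' := hη }
  let gl : Q →ₗ[R'] W := { g with map_smul' := hg }
  let Λl : V →ₗ[R] W := { Λ with
    map_smul' := fun r x => (hΛ _ x).trans (congrArg (· • Λ x) (hκ r)) }
  let τ : R' ⊗[R] N →ₗ[R'] Q := LinearMap.liftBaseChange R' ηl
  let θ : R' ⊗[R] V →ₗ[R'] W := LinearMap.liftBaseChange R' Λl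
  have hcomp : ∀ x, gl (τ x) = θ (vl.lTensor R' x) := by
    intro x
    induction x using TensorProduct.induction_on with
    | zero => simp
    | tmul a n =>
      rw [LinearMap.lTensor_tmul, LinearMap.liftBaseChange_tmul, LinearMap.liftBaseChange_tmul,
        map_smul]
      exact congrArg (a • ·) (hgη n)
    | add x y hx hy => simp only [map_add, hx, hy]
  have hθ : Function.Injective θ := by
    rw [injective_iff_map_eq_zero]
    intro x hx
    obtain ⟨s, hs, c, hc⟩ := exists_smul_tmul_basis (R' := R') b x
    have h1 : θ (c.sum fun i a => a ⊗ₜ[R] b i) = 0 := by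
      rw [← hc, LinearMap.map_smul_of_tower, hx, smul_zero]
    rw [Finsupp.sum, map_sum] at h1
    have h2 : ∑ i ∈ c.support, algebraMap R' K' (c i) • Λ (b i) = 0 := by
      rw [← h1]
      refine Finset.sum_congr rfl fun i _ => ?_
      rw [LinearMap.liftBaseChange_tmul]
      rfl
    have h3 := linearIndependent_iff'.mp hb _ _ h2
    have h4 : s • x = 0 := by
      rw [hc]
      refine Finset.sum_eq_zero fun i hi => ?_
      have : c i = 0 := IsFractionRing.injective R' K' ((h3 i hi).trans (map_zero _).symm)
      rw [this]
      exact zero_tmul _ _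
    -- A denominator `s` acts invertibly on `V`, hence on `R' ⊗ V`, so `s • x = 0` forces `x = 0`.
    have h5 : (LinearMap.lsmul K V (algebraMap R K s)⁻¹).restrictScalars R ∘ₗ
        LinearMap.lsmul R V s = LinearMap.id := by
      ext y
      change (algebraMap R K s)⁻¹ • algebraMap R K s • y = y
      rw [smul_smul, inv_mul_cancel₀ (IsFractionRing.to_map_ne_zero_of_mem_nonZeroDivisors hs),
        one_smul]
    have h6 := LinearMap.congr_fun (congrArg (LinearMap.lTensor R') h5) x
    rw [LinearMap.lTensor_comp, LinearMap.lTensor_id, LinearMap.comp_apply, LinearMap.id_apply] at h6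
    rw [← h6]
    have h7 : LinearMap.lTensor R' (LinearMap.lsmul R V s) x = s • x := by
      have : LinearMap.lsmul R V s = s • LinearMap.id := rfl
      rw [this, LinearMap.lTensor_smul, LinearMap.smul_apply, LinearMap.lTensor_id]
      rfl
    rw [h7, h4, map_zero]
  have hτ : Function.Surjective τ := by
    rw [← LinearMap.range_eq_top, eq_top_iff, ← hspan, Submodule.span_le]
    rintro _ ⟨n, rfl⟩
    exact ⟨1 ⊗ₜ n, by rw [LinearMap.liftBaseChange_tmul, one_smul]; rfl⟩
  rw [injective_iff_map_eq_zero]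
  intro q hq
  obtain ⟨x, rfl⟩ := hτ q
  have h1 : θ (vl.lTensor R' x) = 0 := (hcomp x).symm.trans hq
  have h2 : x = 0 := by
    refine Module.Flat.lTensor_preserves_injective_linearMap vl hv' ?_
    rw [map_zero]
    exact hθ (h1.trans (map_zero _).symm)
  rw [h2, map_zero]

end FlatInjectivity

/-! ### Kähler differentials of the function field of an affine line. -/

section Differentials

open TensorProduct

variable {A K L : Type} [CommRing A] [Field K] [Field L]

/-- For `L = Frac A[t]` there is a functional on differentials that is `1` on `dt` and vanishes on
the differentials of elements of `A`. -/
lemma exists_functional_of_polynomial [Algebra ℂ L] [Algebra (Polynomial A) L]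
    [IsFractionRing (Polynomial A) L] [Algebra ℂ A] [Algebra A L] [IsScalarTower A (Polynomial A) L]
    [IsScalarTower ℂ A L] :
    ∃ d : Ω[L⁄ℂ] →ₗ[L] L, d (KaehlerDifferential.D ℂ L (algebraMap (Polynomial A) L Polynomial.X)) = 1 ∧
      ∀ a : A, d (KaehlerDifferential.D ℂ L (algebraMap A L a)) = 0 := by
  let d0 : Derivation A (Polynomial A) L := Polynomial.mkDerivation A (1 : L)
  -- Localisation is formally étale, so the differentials of `L` over `A` are the base change of
  -- those of the polynomial ring, and the derivation `d/dt` extends.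
  have : Algebra.FormallyEtale (Polynomial A) L :=
    Algebra.FormallyEtale.of_isLocalization (nonZeroDivisors (Polynomial A))
  have h := KaehlerDifferential.isBaseChange_of_formallyEtale A (Polynomial A) L
  let d1 : Ω[L⁄A] →ₗ[L] L := h.lift d0.liftKaehlerDifferential
  refine ⟨d1.comp (KaehlerDifferential.map ℂ A L L), ?_, fun a => ?_⟩
  · rw [LinearMap.comp_apply, KaehlerDifferential.map_D]
    have := h.lift_eq d0.liftKaehlerDifferential (KaehlerDifferential.D A (Polynomial A) Polynomial.X)
    rw [KaehlerDifferential.map_D] at this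
    refine this.trans ?_
    simp [d0]
  · rw [LinearMap.comp_apply, KaehlerDifferential.map_D]
    change d1 (KaehlerDifferential.D A L (algebraMap A L a)) = 0
    rw [Derivation.map_algebraMap, map_zero]

/-- The map from `L ⊗ Ω[K⁄ℂ]` to `Ω[L⁄ℂ]` has as kernel the image of the first cotangent homology of
`L` over `K`. This vanishes because `L` is formally smooth over `K`: the characteristic is zero, and
the polynomial ring shows that `L` is essentially of finite type. -/
lemma linearIndependent_kaehlerMap [Algebra ℂ K] [Algebra ℂ L] [Algebra A K]
    [Algebra (Polynomial A) L] [IsFractionRing (Polynomial A) L] (κ : K →+* L)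
    (hκ : ∀ c : ℂ, κ (algebraMap ℂ K c) = algebraMap ℂ L c)
    (hA : ∀ a : A, κ (algebraMap A K a) = algebraMap (Polynomial A) L (Polynomial.C a))
    {ι : Type} (b : Module.Basis ι K Ω[K⁄ℂ]) :
    LinearIndependent L fun i => kaehlerMap κ hκ (b i) := by
  let _ := κ.toAlgebra
  have : IsScalarTower ℂ K L := .of_algebraMap_eq fun c => (hκ c).symm
  let _ : Algebra A L := ((algebraMap (Polynomial A) L).comp Polynomial.C).toAlgebra
  have : IsScalarTower A (Polynomial A) L := .of_algebraMap_eq fun a => rfl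
  have : IsScalarTower A K L := .of_algebraMap_eq fun a => (hA a).symm
  have : Algebra.EssFiniteType (Polynomial A) L :=
    Algebra.EssFiniteType.of_isLocalization _ (nonZeroDivisors (Polynomial A))
  have : Algebra.EssFiniteType A L := .comp A (Polynomial A) L
  have : Algebra.EssFiniteType K L := .of_comp A K L
  have : CharZero K := charZero_of_injective_algebraMap (algebraMap ℂ K).injective
  have : Algebra.FormallySmooth K L := inferInstance
  have hinj : Function.Injective (KaehlerDifferential.mapBaseChange ℂ K L) := by
    rw [injective_iff_map_eq_zero]
    intro x hx
    obtain ⟨x, rfl⟩ := (Algebra.H1Cotangent.exact_δ_mapBaseChange ℂ K L x).mp hx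
    rw [Subsingleton.elim x 0, map_zero]
  have h1 := ((b.baseChange L).linearIndependent).map' _ (LinearMap.ker_eq_bot.mpr hinj)
  have h2 : (fun i => kaehlerMap κ hκ (b i)) =
      KaehlerDifferential.mapBaseChange ℂ K L ∘ b.baseChange L := funext fun i => ?_
  · rw [h2]
    exact h1
  rw [Function.comp_apply, Module.Basis.baseChange_apply, KaehlerDifferential.mapBaseChange_tmul,
    one_smul]
  rfl

/-- By the quotient rule, a functional that kills the differentials from `A` kills those of all
fractions, and these span the forms of `K`. -/
lemma functional_kaehlerMap_eq_zero [Algebra ℂ K] [Algebra ℂ L] [Algebra A K] [IsFractionRing A K]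
    [Nontrivial A] (κ : K →+* L)
    (hκ : ∀ c : ℂ, κ (algebraMap ℂ K c) = algebraMap ℂ L c) (d : Ω[L⁄ℂ] →ₗ[L] L)
    (hd : ∀ a : A, d (KaehlerDifferential.D ℂ L (κ (algebraMap A K a))) = 0) (ω : Ω[K⁄ℂ]) :
    d (kaehlerMap κ hκ ω) = 0 := by
  have hω : ω ∈ Submodule.span K (Set.range (KaehlerDifferential.D ℂ K)) := by
    rw [KaehlerDifferential.span_range_derivation]
    trivial
  induction hω using Submodule.span_induction with
  | mem x hx =>
    obtain ⟨k, rfl⟩ := hx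
    obtain ⟨a, s, hs, rfl⟩ := IsFractionRing.div_surjective (A := A) k
    have hs0 : κ (algebraMap A K s) ≠ 0 := by
      rw [Ne, map_eq_zero]
      exact IsFractionRing.to_map_ne_zero_of_mem_nonZeroDivisors hs
    rw [kaehlerMap_D]
    have h1 : κ (algebraMap A K s) * κ (algebraMap A K a / algebraMap A K s) =
        κ (algebraMap A K a) := by
      rw [map_div₀, mul_div_cancel₀ _ hs0]
    have h2 := congrArg (fun x => d (KaehlerDifferential.D ℂ L x)) h1
    simp only [Derivation.leibniz, map_add, map_smul, hd, smul_zero, add_zero] at h2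
    exact (smul_eq_zero.mp h2).resolve_left hs0
  | zero => rw [map_zero, map_zero]
  | add x y _ _ hx hy => rw [map_add, map_add, hx, hy, add_zero]
  | smul r x _ hx => rw [kaehlerMap_smul, map_smul, hx, smul_zero]

/-- The functional `d` vanishes on the span of the images of `V` but not on the last vector, so it
separates the two. -/
lemma linearIndependent_prod_unit {V W ι : Type} [AddCommGroup V] [Module K V] [AddCommGroup W]
    [Module L W] (Λ : V × K →+ W) (b : Module.Basis ι K V)
    (hb : LinearIndependent L fun i => Λ (b i, 0)) (d : W →ₗ[L] L) (hd : ∀ v, d (Λ (v, 0)) = 0)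
    (hd' : d (Λ (0, 1)) ≠ 0) :
    LinearIndependent L fun i => Λ (b.prod (Module.Basis.singleton Unit K) i) := by
  have h1 : LinearIndependent L fun _ : Unit => Λ (0, 1) :=
    LinearIndependent.of_subsingleton () fun h => hd' (by rw [h, map_zero])
  have h2 := hb.sum_type h1 (by
    rw [Submodule.disjoint_def]
    intro x hx hx'
    rw [Set.range_const, Submodule.mem_span_singleton] at hx'
    obtain ⟨c, rfl⟩ := hx'
    have h3 : Submodule.span L (Set.range fun i => Λ (b i, 0)) ≤ LinearMap.ker d := by
      rw [Submodule.span_le]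
      rintro _ ⟨i, rfl⟩
      exact hd _
    have h4 := h3 hx
    rw [LinearMap.mem_ker, map_smul, smul_eq_mul] at h4
    rw [(mul_eq_zero.mp h4).resolve_right hd', zero_smul])
  have h5 : (fun i => Λ (b.prod (Module.Basis.singleton Unit K) i)) =
      Sum.elim (fun i => Λ (b i, 0)) fun _ : Unit => Λ (0, 1) := by
    funext i
    rcases i with i | i
    · exact congrArg Λ (Prod.ext (Module.Basis.prod_apply_inl_fst _ _ _)
        (Module.Basis.prod_apply_inl_snd _ _ _))
    · exact congrArg Λ (Prod.ext (Module.Basis.prod_apply_inr_fst _ _ _)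
        ((Module.Basis.prod_apply_inr_snd _ _ _).trans (Module.Basis.singleton_apply _ _ _)))
  rw [h5]
  exact h2

end Differentials

/-! ### Stalks of sheaves of modules. -/

section Stalks

variable {X : Scheme.{0}}

/-- The stalk of a sheaf of modules. -/
abbrev modStalk (M : X.Modules) (x : X) : Type :=
  (TopCat.Presheaf.stalk M.presheaf x : Ab.{0})

instance stalkModule (M : X.Modules) (x : X) : Module (X.presheaf.stalk x) (modStalk M x) :=
  PresheafOfModules.instModuleCarrierStalkCommRingCatCarrierAbPresheafOpensCarrier
    (R := X.presheaf) M.val x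

/-- The germ of a section of a sheaf of modules. -/
def modGerm (M : X.Modules) {U : X.Opens} (x : X) (hx : x ∈ U) : Γ(M, U) →+ modStalk M x :=
  (TopCat.Presheaf.germ M.presheaf U x hx).hom

lemma modGerm_smul (M : X.Modules) {U : X.Opens} (x : X) (hx : x ∈ U) (r : Γ(X, U)) (s : Γ(M, U)) :
    modGerm M x hx (r • s) = X.presheaf.germ U x hx r • modGerm M x hx s :=
  PresheafOfModules.germ_smul (R := X.presheaf) M.val x U hx r s

lemma modGerm_res (M : X.Modules) {U V : X.Opens} (h : U ≤ V) (x : X) (hx : x ∈ U) (s : Γ(M, V)) :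
    modGerm M x hx (res M.presheaf h s) = modGerm M x (h hx) s :=
  TopCat.Presheaf.germ_res_apply M.presheaf (homOfLE h) x hx s

lemma exists_modGerm_eq (M : X.Modules) {x : X} (t : modStalk M x) :
    ∃ (U : X.Opens) (hx : x ∈ U) (s : Γ(M, U)), modGerm M x hx s = t := by
  obtain ⟨U, hx, s, hs⟩ := TopCat.Presheaf.exists_germ_eq M.presheaf t
  exact ⟨U, hx, s, hs⟩

lemma exists_modGerm_eq_le (M : X.Modules) {x : X} (t : modStalk M x) (V : X.Opens) (hV : x ∈ V) :
    ∃ (U : X.Opens) (_ : U ≤ V) (hx : x ∈ U) (s : Γ(M, U)), modGerm M x hx s = t := by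
  obtain ⟨U, hx, s, hs⟩ := exists_modGerm_eq M t
  exact ⟨U ⊓ V, inf_le_right, ⟨hx, hV⟩, res M.presheaf inf_le_left s,
    (modGerm_res M inf_le_left x ⟨hx, hV⟩ s).trans hs⟩

lemma modGerm_ext (M : X.Modules) {U : X.Opens} (s t : Γ(M, U))
    (h : ∀ x (hx : x ∈ U), modGerm M x hx s = modGerm M x hx t) : s = t :=
  TopCat.Presheaf.section_ext ⟨M.presheaf, M.isSheaf⟩ U s t h

/-- The map on stalks induced by a morphism of sheaves of modules. -/
def modStalkMap {M N : X.Modules} (φ : M ⟶ N) (x : X) :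
    modStalk M x →ₗ[X.presheaf.stalk x] modStalk N x where
  toFun := ((TopCat.Presheaf.stalkFunctor Ab x).map φ.mapPresheaf).hom
  map_add' := map_add _
  map_smul' r t := by
    obtain ⟨U, hx, s, rfl⟩ := exists_modGerm_eq M t
    obtain ⟨V, hVU, hxV, r, rfl⟩ := X.presheaf.exists_le_germ_eq r hx
    have hg : ∀ W (hW : x ∈ W) (s : Γ(M, W)),
        ((TopCat.Presheaf.stalkFunctor Ab x).map φ.mapPresheaf).hom (modGerm M x hW s) =
          modGerm N x hW (φ.app W s) := fun W hW s =>
      TopCat.Presheaf.stalkFunctor_map_germ_apply W x hW φ.mapPresheaf s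
    rw [← modGerm_res M hVU x hxV s, ← modGerm_smul, hg, hg, Scheme.Modules.Hom.app_smul,
      modGerm_smul]
    rfl

lemma modStalkMap_germ {M N : X.Modules} (φ : M ⟶ N) {U : X.Opens} (x : X) (hx : x ∈ U)
    (s : Γ(M, U)) : modStalkMap φ x (modGerm M x hx s) = modGerm N x hx (φ.app U s) :=
  TopCat.Presheaf.stalkFunctor_map_germ_apply U x hx φ.mapPresheaf s

lemma mono_of_stalk_injective {M N : X.Modules} (φ : M ⟶ N)
    (h : ∀ x, Function.Injective (modStalkMap φ x)) : Mono φ := by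
  refine mono_of_app_injective φ fun U s t hst => modGerm_ext M s t fun x hx => h x ?_
  rw [modStalkMap_germ, modStalkMap_germ, hst]

lemma epi_of_stalk_surjective {M N : X.Modules} (φ : M ⟶ N)
    (h : ∀ x, Function.Surjective (modStalkMap φ x)) : Epi φ := by
  refine epi_of_locally_surjective φ fun U s x hx => ?_
  obtain ⟨t, ht⟩ := h x (modGerm N x hx s)
  obtain ⟨V, hVU, hxV, t, rfl⟩ := exists_modGerm_eq_le M t U hx
  rw [modStalkMap_germ, ← modGerm_res N hVU x hxV s] at ht
  obtain ⟨W, hxW, i, j, hW⟩ := TopCat.Presheaf.germ_eq N.presheaf x hxV hxV _ _ ht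
  refine ⟨W, i.le.trans hVU, hxW, res M.presheaf i.le t, ?_⟩
  rw [hom_app_res]
  refine Eq.trans hW ?_
  exact res_res N.presheaf i.le hVU s

end Stalks

/-! ### Godement sheaves, and generation of the stalks of a pull-back. -/

section Godement

variable {X : Scheme.{0}} (A : X → Type) [∀ x, AddCommGroup (A x)]
  [∀ x, Module (X.presheaf.stalk x) (A x)]

instance godementModule (U : X.Opens) : Module Γ(X, U) (∀ x : U, A x.1) where
  smul r s := fun x => X.presheaf.germ U x.1 x.2 r • s x
  one_smul s := funext fun x => by
    change X.presheaf.germ U x.1 x.2 1 • s x = s x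
    rw [map_one, one_smul]
  mul_smul a b s := funext fun x => by
    change X.presheaf.germ U x.1 x.2 (a * b) • s x =
      X.presheaf.germ U x.1 x.2 a • X.presheaf.germ U x.1 x.2 b • s x
    rw [map_mul, mul_smul]
  smul_zero a := funext fun x => smul_zero _
  smul_add a s t := funext fun x => smul_add _ _ _
  add_smul a b s := funext fun x => by
    change X.presheaf.germ U x.1 x.2 (a + b) • s x =
      X.presheaf.germ U x.1 x.2 a • s x + X.presheaf.germ U x.1 x.2 b • s x
    rw [map_add, add_smul]
  zero_smul s := funext fun x => by
    change X.presheaf.germ U x.1 x.2 0 • s x = 0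
    rw [map_zero, zero_smul]

/-- The presheaf of families of elements of the groups `A x`. -/
def godementPresheaf : TopCat.Presheaf Ab.{0} X where
  obj U := AddCommGrpCat.of (∀ x : U.unop, A x.1)
  map i := AddCommGrpCat.ofHom
    { toFun := fun s x => s ⟨x.1, i.unop.le x.2⟩
      map_zero' := rfl
      map_add' := fun _ _ => rfl }

instance (U : X.Opensᵒᵖ) : Module (X.ringCatSheaf.obj.obj U) ((godementPresheaf A).obj U) :=
  godementModule A U.unop

omit [∀ x, Module (X.presheaf.stalk x) (A x)] in
lemma godementPresheaf_isSheaf :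
    Presheaf.IsSheaf (Opens.grothendieckTopology X) (godementPresheaf A) := by
  refine (TopCat.Presheaf.isSheaf_iff_isSheaf_comp (forget Ab.{0}) (godementPresheaf A)).mpr ?_
  refine TopCat.Presheaf.isSheaf_of_iso ?_ (TopCat.Presheaf.toTypes_isSheaf X fun x => A x)
  exact NatIso.ofComponents (fun U => Iso.refl _) (fun i => rfl)

/-- The `𝒪_X`-module of families of elements of modules over the local rings. -/
def godement : X.Modules :=
  { val := PresheafOfModules.ofPresheaf (R := X.ringCatSheaf.obj) (godementPresheaf A) (by
      intro U V i r m
      funext y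
      refine congrArg (fun a : X.presheaf.stalk y.1 =>
        a • (show ∀ x : U.unop, A x.1 from m) ⟨y.1, i.unop.le y.2⟩) ?_
      exact (X.presheaf.germ_res_apply i.unop y.1 y.2 r).symm)
    isSheaf := godementPresheaf_isSheaf A }

variable {A} in
/-- The morphism to the Godement sheaf given by linear maps on the stalks. -/
def toGodement (M : X.Modules) (l : ∀ x, modStalk M x →ₗ[X.presheaf.stalk x] A x) :
    M ⟶ godement A :=
  SheafOfModules.Hom.mk (PresheafOfModules.homMk
    { app := fun U => AddCommGrpCat.ofHom
        { toFun := fun s => (show ∀ x : U.unop, A x.1 from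
            fun x => l x.1 (modGerm M x.1 x.2 (show Γ(M, U.unop) from s)))
          map_zero' := funext fun x => by
            exact (congrArg (l x.1) (map_zero _)).trans (map_zero _)
          map_add' := fun s t => funext fun x => by
            exact (congrArg (l x.1) (map_add _ _ _)).trans (map_add _ _ _) }
      naturality := by
        intro U V i
        ext s
        funext x
        exact congrArg (l x.1) (modGerm_res M i.unop.le x.1 x.2 s) }
    (by
      intro U r m
      funext x
      exact (congrArg (l x.1) (modGerm_smul M x.1 x.2 r m)).trans (map_smul _ _ _)))

end Godement

section PullbackStalk

variable {X Y : Scheme.{0}} (f : Y ⟶ X) (M : X.Modules)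

/-- The pull-back of a section. -/
def pullSection {U : X.Opens} (s : Γ(M, U)) : Γ((Scheme.Modules.pullback f).obj M, f ⁻¹ᵁ U) :=
  ((Scheme.Modules.pullbackPushforwardAdjunction f).unit.app M).app U s

/-- The stalks of the pull-back are generated by the pull-backs of sections. -/
lemma span_pullSection (y : Y) :
    Submodule.span (Y.presheaf.stalk y) {t : modStalk ((Scheme.Modules.pullback f).obj M) y |
      ∃ (U : X.Opens) (hy : f y ∈ U) (s : Γ(M, U)),
        t = modGerm ((Scheme.Modules.pullback f).obj M) (U := f ⁻¹ᵁ U) y hy (pullSection f M s)} =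
      ⊤ := by
  let F := (Scheme.Modules.pullback f).obj M
  let S : ∀ y, Submodule (Y.presheaf.stalk y) (modStalk F y) := fun y =>
    Submodule.span (Y.presheaf.stalk y) {t | ∃ (U : X.Opens) (hy : f y ∈ U) (s : Γ(M, U)),
        t = modGerm F (U := f ⁻¹ᵁ U) y hy (pullSection f M s)}
  -- Projection to the quotients by the submodules that pulled-back sections generate. Its adjoint
  -- transpose kills every section of `M`, so `φ = 0` and the quotients vanish. Thus no tensor
  -- formula for the stalk is needed.
  let φ : F ⟶ godement fun y => modStalk F y ⧸ S y := toGodement F fun y => (S y).mkQ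
  have hφ : φ = 0 := by
    refine ((Scheme.Modules.pullbackPushforwardAdjunction f).homEquiv _ _).injective ?_
    rw [Adjunction.homEquiv_unit, Adjunction.homEquiv_unit]
    ext U s
    refine funext fun y : f ⁻¹ᵁ U => ?_
    refine ((Submodule.Quotient.mk_eq_zero (S y.1)).mpr (Submodule.subset_span ?_)).trans rfl
    exact ⟨U, y.2, s, rfl⟩
  rw [eq_top_iff]
  rintro t -
  obtain ⟨U, hy, s, rfl⟩ := exists_modGerm_eq F t
  have := congrArg (fun χ : F ⟶ godement fun y => modStalk F y ⧸ S y =>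
    (show ∀ x : U, modStalk F x.1 ⧸ S x.1 from χ.app U s) ⟨y, hy⟩) hφ
  exact (Submodule.Quotient.mk_eq_zero (S y)).mp this

end PullbackStalk

/-! ### Sheaves whose stalks embed into a vector space over the function field. -/

section FieldValued

variable {X : Scheme.{0}} [IsIntegral X]

/-- A sheaf of modules whose sections have values in a vector space over the function field, and
whose stalks embed into this vector space. -/
structure FieldValued (M : X.Modules) (V : Type) [AddCommGroup V] [Module X.functionField V] where
  /-- The value of a section near a point. -/
  val : ∀ {U : X.Opens} (y : X), y ∈ U → (Γ(M, U) →+ V)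
  val_res : ∀ {U W : X.Opens} (h : U ≤ W) (y : X) (hy : y ∈ U) (s : Γ(M, W)),
    val y hy (res M.presheaf h s) = val y (h hy) s
  val_smul : ∀ {U : X.Opens} (y : X) (hy : y ∈ U) (r : Γ(X, U)) (s : Γ(M, U)),
    val y hy (r • s) = toField r y hy • val y hy s
  eq_zero : ∀ {U : X.Opens} (y : X) (hy : y ∈ U) (s : Γ(M, U)), val y hy s = 0 →
    ∃ (W : X.Opens) (h : W ≤ U), y ∈ W ∧ res M.presheaf h s = 0

namespace FieldValued

variable {M : X.Modules} {V : Type} [AddCommGroup V] [Module X.functionField V]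
  (v : FieldValued M V)

/-- The embedding of the stalk. -/
def stalk (x : X) : modStalk M x →+ V :=
  (Limits.colimit.desc ((OpenNhds.inclusion x).op ⋙ M.presheaf)
    { pt := AddCommGrpCat.of V
      ι :=
        { app := fun U => AddCommGrpCat.ofHom (v.val (U := U.unop.1) x U.unop.2)
          naturality := fun U W i => by
            ext s
            exact v.val_res (U := W.unop.1) (W := U.unop.1) i.unop.le x W.unop.2 s } }).hom

lemma stalk_germ {U : X.Opens} (x : X) (hx : x ∈ U) (s : Γ(M, U)) :
    v.stalk x (modGerm M x hx s) = v.val x hx s :=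
  ConcreteCategory.congr_hom (Limits.colimit.ι_desc
    { pt := AddCommGrpCat.of V
      ι :=
        { app := fun U => AddCommGrpCat.ofHom (v.val (U := U.unop.1) x U.unop.2)
          naturality := fun U W i => by
            ext s
            exact v.val_res (U := W.unop.1) (W := U.unop.1) i.unop.le x W.unop.2 s } :
      Limits.Cocone ((OpenNhds.inclusion x).op ⋙ M.presheaf) } (op ⟨U, hx⟩)) s

lemma stalk_smul (x : X) (a : X.presheaf.stalk x) (t : modStalk M x) :
    v.stalk x (a • t) = algebraMap (X.presheaf.stalk x) X.functionField a • v.stalk x t := by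
  obtain ⟨U, hx, s, rfl⟩ := exists_modGerm_eq M t
  obtain ⟨W, hWU, hxW, r, rfl⟩ := X.presheaf.exists_le_germ_eq a hx
  rw [← modGerm_res M hWU x hxW s, ← modGerm_smul, stalk_germ, stalk_germ, v.val_smul]
  rfl

lemma stalk_injective (x : X) : Function.Injective (v.stalk x) := by
  rw [injective_iff_map_eq_zero]
  intro t ht
  obtain ⟨U, hx, s, rfl⟩ := exists_modGerm_eq M t
  rw [stalk_germ] at ht
  obtain ⟨W, hW, hxW, h0⟩ := v.eq_zero x hx s ht
  rw [← modGerm_res M hW x hxW s, h0, map_zero]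

end FieldValued

end FieldValued

/-! ### Injectivity and surjectivity of morphisms out of a pull-back. -/

section Pullback

variable {X Y : Scheme.{0}} (f : Y ⟶ X) (M : X.Modules)

/-- The pull-back of germs. -/
def pullStalk (y : Y) : modStalk M (f y) →+ modStalk ((Scheme.Modules.pullback f).obj M) y :=
  ((TopCat.Presheaf.stalkPushforward Ab f.base
      ((Scheme.Modules.pullback f).obj M).presheaf y).hom).comp
    (modStalkMap ((Scheme.Modules.pullbackPushforwardAdjunction f).unit.app M) (f y)).toAddMonoidHom

lemma pullStalk_germ (y : Y) {U : X.Opens} (hy : f y ∈ U) (s : Γ(M, U)) :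
    pullStalk f M y (modGerm M (f y) hy s) =
      modGerm ((Scheme.Modules.pullback f).obj M) (U := f ⁻¹ᵁ U) y hy (pullSection f M s) := by
  refine (congrArg (TopCat.Presheaf.stalkPushforward Ab f.base
      ((Scheme.Modules.pullback f).obj M).presheaf y).hom (modStalkMap_germ
    ((Scheme.Modules.pullbackPushforwardAdjunction f).unit.app M) (f y) hy s)).trans ?_
  exact ConcreteCategory.congr_hom (TopCat.Presheaf.stalkPushforward_germ Ab f.base
    ((Scheme.Modules.pullback f).obj M).presheaf U y hy) (pullSection f M s)

lemma pullSection_smul {U : X.Opens} (r : Γ(X, U)) (s : Γ(M, U)) :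
    pullSection f M (r • s) = (f.app U r) • pullSection f M s :=
  Scheme.Modules.Hom.app_smul ((Scheme.Modules.pullbackPushforwardAdjunction f).unit.app M) r s

lemma homEquiv_symm_app_pullSection {P : Y.Modules} (φ : M ⟶ (Scheme.Modules.pushforward f).obj P)
    {U : X.Opens} (s : Γ(M, U)) :
    (((Scheme.Modules.pullbackPushforwardAdjunction f).homEquiv M P).symm φ).app (f ⁻¹ᵁ U)
      (pullSection f M s) = φ.app U s := by
  have h := Equiv.apply_symm_apply ((Scheme.Modules.pullbackPushforwardAdjunction f).homEquiv M P) φ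
  rw [Adjunction.homEquiv_unit] at h
  exact congrArg (fun χ : M ⟶ (Scheme.Modules.pushforward f).obj P => χ.app U s) h

lemma pullStalk_smul (y : Y) (a : X.presheaf.stalk (f y)) (t : modStalk M (f y)) :
    pullStalk f M y (a • t) = (f.stalkMap y).hom a • pullStalk f M y t := by
  obtain ⟨U, hx, s, rfl⟩ := exists_modGerm_eq M t
  obtain ⟨W, hWU, hxW, r, rfl⟩ := X.presheaf.exists_le_germ_eq a hx
  rw [← modGerm_res M hWU (f y) hxW s, ← modGerm_smul, pullStalk_germ, pullStalk_germ,
    pullSection_smul]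
  refine (modGerm_smul _ (U := f ⁻¹ᵁ W) y hxW _ _).trans ?_
  refine congrArg (fun c : Y.presheaf.stalk y => c • _) ?_
  exact (Scheme.Hom.germ_stalkMap_apply f W y hxW r).symm

lemma span_range_pullStalk (y : Y) :
    Submodule.span (Y.presheaf.stalk y) (Set.range (pullStalk f M y)) = ⊤ := by
  rw [eq_top_iff, ← span_pullSection f M y]
  refine Submodule.span_mono ?_
  rintro _ ⟨U, hy, s, rfl⟩
  exact ⟨_, pullStalk_germ f M y hy s⟩

variable [IsIntegral X] [IsIntegral Y] [IsDominant f] {f M}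
  {V W : Type} [AddCommGroup V] [Module X.functionField V] [AddCommGroup W]
  [Module Y.functionField W] {P : Y.Modules} (v : FieldValued M V) (w : FieldValued P W)
  (α : (Scheme.Modules.pullback f).obj M ⟶ P) (Λ : V →+ W)

omit [IsDominant f] in
lemma stalk_pullStalk (hα : ∀ {U : X.Opens} (s : Γ(M, U)) (y : Y) (hy : f y ∈ U),
      w.val (U := f ⁻¹ᵁ U) y hy (α.app (f ⁻¹ᵁ U) (pullSection f M s)) = Λ (v.val (f y) hy s))
    (y : Y) (t : modStalk M (f y)) :
    w.stalk y (modStalkMap α y (pullStalk f M y t)) = Λ (v.stalk (f y) t) := by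
  obtain ⟨U, hx, s, rfl⟩ := exists_modGerm_eq M t
  rw [pullStalk_germ, v.stalk_germ, ← hα]
  exact (congrArg (w.stalk y) (modStalkMap_germ α (U := f ⁻¹ᵁ U) y hx _)).trans
    (w.stalk_germ (U := f ⁻¹ᵁ U) y hx _)

/-- This is `injective_of_flat` on each stalk: the local rings at `f y` and `y` form the flat
extension, and the stalk of `M` is the torsion-free module. Only the composite with the embedding of
the stalk of `P` is shown to be injective, and this suffices. -/
lemma mono_of_pullback [Flat f] (hΛ : ∀ k x, Λ (k • x) = fieldMap f k • Λ x)
    (hα : ∀ {U : X.Opens} (s : Γ(M, U)) (y : Y) (hy : f y ∈ U),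
      w.val (U := f ⁻¹ᵁ U) y hy (α.app (f ⁻¹ᵁ U) (pullSection f M s)) = Λ (v.val (f y) hy s))
    {ι : Type} (b : Module.Basis ι X.functionField V)
    (hb : LinearIndependent Y.functionField fun i => Λ (b i)) : Mono α := by
  refine mono_of_stalk_injective α fun y => ?_
  have h := injective_of_flat (f.stalkMap y).hom (Flat.stalkMap f y) (fieldMap f)
    (fieldMap_algebraMap f y) (v.stalk (f y)) (v.stalk_smul (f y)) (v.stalk_injective (f y)) Λ hΛ b hb
    (pullStalk f M y) (pullStalk_smul f M y) (span_range_pullStalk f M y)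
    ((w.stalk y).comp (modStalkMap α y).toAddMonoidHom)
    (fun a q => (congrArg (w.stalk y) (map_smul (modStalkMap α y) a q)).trans (w.stalk_smul y a _))
    (stalk_pullStalk v w α Λ hα y)
  exact Function.Injective.of_comp h

omit [IsDominant f] in
-- A germ of `P` is determined by its value, so surjectivity on stalks is a statement about values:
-- those of the pull-back form a submodule that contains the generators in `hs`.
lemma epi_of_pullback [Y.Over SpecC] (w : FieldValued P (RatForms Y)) (Λ : V →+ RatForms Y)
    (hα : ∀ {U : X.Opens} (s : Γ(M, U)) (y : Y) (hy : f y ∈ U),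
      w.val (U := f ⁻¹ᵁ U) y hy (α.app (f ⁻¹ᵁ U) (pullSection f M s)) = Λ (v.val (f y) hy s))
    (hs : ∀ {U : Y.Opens} (t : Γ(P, U)) (y : Y) (hy : y ∈ U),
      w.val y hy t ∈ Submodule.span (Y.presheaf.stalk y) {m : RatForms Y | ∃ (U : X.Opens) (hy : f y ∈ U)
        (s : Γ(M, U)), m = Λ (v.val (f y) hy s)}) : Epi α := by
  refine epi_of_stalk_surjective α fun y => ?_
  have key : ∀ m ∈ Submodule.span (Y.presheaf.stalk y) {m : RatForms Y | ∃ (U : X.Opens) (hy : f y ∈ U)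
        (s : Γ(M, U)), m = Λ (v.val (f y) hy s)}, ∃ t, w.stalk y (modStalkMap α y t) = m := by
    intro m hm
    induction hm using Submodule.span_induction with
    | mem m hm =>
      obtain ⟨U, hy, s, rfl⟩ := hm
      exact ⟨pullStalk f M y (modGerm M (f y) hy s), by
        rw [stalk_pullStalk v w α Λ hα, v.stalk_germ]⟩
    | zero => exact ⟨0, by rw [map_zero, map_zero]⟩
    | add a b _ _ ha hb =>
      obtain ⟨s, rfl⟩ := ha
      obtain ⟨t, rfl⟩ := hb
      exact ⟨s + t, by rw [map_add, map_add]⟩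
    | smul r a _ ha =>
      obtain ⟨s, rfl⟩ := ha
      refine ⟨r • s, ?_⟩
      rw [map_smul, w.stalk_smul, algebraMap_smul]
  intro t
  obtain ⟨U, hy, t, rfl⟩ := exists_modGerm_eq P t
  obtain ⟨s, hs⟩ := key _ (hs t y hy)
  refine ⟨s, w.stalk_injective y ?_⟩
  rw [hs, w.stalk_germ]

end Pullback

/-! ### Values of sections of sheaves of forms. -/

section FormSheaf

variable {X : Scheme.{0}} [X.Over SpecC] [IsIntegral X] (N : FormStalks X)

/-- Sections of sheaves of forms have values in the rational forms. -/
def formFieldValued : FieldValued (formSheaf N) (RatForms X) where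
  val {U} y hy :=
    { toFun := fun s => formValue s y hy
      map_zero' := rfl
      map_add' := fun _ _ => rfl }
  val_res _ _ _ _ := rfl
  val_smul _ _ _ _ := rfl
  eq_zero {U} y hy s hs := by
    obtain ⟨V, hV, m, hm⟩ := (show formSections N U from s).2 ⟨y, hy⟩
    have hm0 : m = 0 := (hm ⟨y, hy⟩ hV).2.symm.trans hs
    refine ⟨U ⊓ V, inf_le_left, ⟨hy, hV⟩, Subtype.ext (funext fun z => ?_)⟩
    exact (hm ⟨z.1, z.2.1⟩ z.2.2).2.trans hm0

lemma formFieldValued_mem {U : X.Opens} (s : Γ(formSheaf N, U)) (y : X) (hy : y ∈ U) :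
    (formFieldValued N).val y hy s ∈ N y := by
  obtain ⟨V, hV, m, hm⟩ := (show formSections N U from s).2 ⟨y, hy⟩
  have h : (formFieldValued N).val y hy s = m := (hm ⟨y, hy⟩ hV).2
  rw [h]
  exact (hm ⟨y, hy⟩ hV).1

end FormSheaf

/-! ### Sheaves of lattices in a vector space over the function field. -/

section LatticeSheaf

variable {X : Scheme.{0}} [IsIntegral X] {V : Type} [AddCommGroup V] [Module X.functionField V]

variable (X V) in
/-- A family of submodules, over the local rings of `X`, of a vector space over the function
field. -/
structure LatticeStalks where
  /-- The submodule at a point. -/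
  stalk : X → AddSubgroup V
  smul_mem : ∀ (x : X) (a : X.presheaf.stalk x) (v : V), v ∈ stalk x →
    algebraMap (X.presheaf.stalk x) X.functionField a • v ∈ stalk x

variable (N : LatticeStalks X V)

/-- A function on `U` is a section if locally it is constant with values in the submodules. -/
def IsLatticeSection {U : X.Opens} (s : U → V) : Prop :=
  ∀ y : U, ∃ W : X.Opens, y.1 ∈ W ∧ ∃ m : V, ∀ z : U, z.1 ∈ W → m ∈ N.stalk z.1 ∧ s z = m

/-- The group of sections over `U`. -/
def latticeSections (U : X.Opens) : AddSubgroup (U → V) where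
  carrier := {s | IsLatticeSection N s}
  zero_mem' := fun _ => ⟨⊤, Opens.mem_top _, 0, fun z _ => ⟨zero_mem _, rfl⟩⟩
  add_mem' := by
    intro a b ha hb y
    obtain ⟨W, hW, m, hm⟩ := ha y
    obtain ⟨W', hW', n, hn⟩ := hb y
    refine ⟨W ⊓ W', ⟨hW, hW'⟩, m + n, fun z hz => ⟨add_mem (hm z hz.1).1 (hn z hz.2).1, ?_⟩⟩
    simp [(hm z hz.1).2, (hn z hz.2).2]
  neg_mem' := by
    intro a ha y
    obtain ⟨W, hW, m, hm⟩ := ha y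
    exact ⟨W, hW, -m, fun z hz => ⟨neg_mem (hm z hz).1, by simp [(hm z hz).2]⟩⟩

lemma smul_isLatticeSection {U : X.Opens} (r : Γ(X, U)) (s : U → V)
    (hs : IsLatticeSection N s) : IsLatticeSection N (fun y => toField r y.1 y.2 • s y) := by
  intro y
  obtain ⟨W, hW, m, hm⟩ := hs y
  refine ⟨W, hW, toField r y.1 y.2 • m, fun z hz => ⟨?_, ?_⟩⟩
  · rw [toField_eq r y.1 z.1 y.2 z.2, toField]
    exact N.smul_mem _ _ _ (hm z hz).1
  · change toField r z.1 z.2 • s z = _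
    rw [toField_eq r y.1 z.1 y.2 z.2, (hm z hz).2]

instance latticeSectionsModule (U : X.Opens) : Module Γ(X, U) (latticeSections N U) where
  smul r s := ⟨fun y => toField r y.1 y.2 • s.1 y, smul_isLatticeSection N r s.1 s.2⟩
  one_smul s := by
    apply Subtype.ext; funext y
    change toField (1 : Γ(X, U)) y.1 y.2 • s.1 y = s.1 y
    rw [toField_one, one_smul]
  mul_smul a b s := by
    apply Subtype.ext; funext y
    change toField (a * b) y.1 y.2 • s.1 y = toField a y.1 y.2 • toField b y.1 y.2 • s.1 y
    rw [toField_mul, mul_smul]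
  smul_zero a := by
    apply Subtype.ext; funext y
    exact smul_zero _
  smul_add a s t := by
    apply Subtype.ext; funext y
    exact smul_add _ _ _
  add_smul a b s := by
    apply Subtype.ext; funext y
    change toField (a + b) y.1 y.2 • s.1 y = toField a y.1 y.2 • s.1 y + toField b y.1 y.2 • s.1 y
    rw [toField_add, add_smul]
  zero_smul s := by
    apply Subtype.ext; funext y
    change toField (0 : Γ(X, U)) y.1 y.2 • s.1 y = 0
    rw [toField_zero, zero_smul]

/-- The presheaf of abelian groups of sections. -/
def latticePresheaf : TopCat.Presheaf Ab.{0} X where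
  obj U := AddCommGrpCat.of (latticeSections N U.unop)
  map {U W} i := AddCommGrpCat.ofHom
    { toFun := fun s => (show latticeSections N W.unop from
        ⟨fun y => s.1 ⟨y.1, i.unop.le y.2⟩, fun y => by
          obtain ⟨T, hT, m, hm⟩ := s.2 ⟨y.1, i.unop.le y.2⟩
          exact ⟨T, hT, m, fun z hz => hm ⟨z.1, i.unop.le z.2⟩ hz⟩⟩)
      map_zero' := rfl
      map_add' := fun _ _ => rfl }

instance (U : X.Opensᵒᵖ) : Module (X.ringCatSheaf.obj.obj U) ((latticePresheaf N).obj U) :=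
  latticeSectionsModule N U.unop

/-- The local predicate defining the sheaf. -/
def latticePredicate : TopCat.LocalPredicate (fun _ : X => V) where
  pred {U} s := IsLatticeSection N (U := U) s
  res {U W} i s hs y := by
    obtain ⟨T, hT, m, hm⟩ := hs ⟨y.1, i.le y.2⟩
    exact ⟨T, hT, m, fun z hz => hm ⟨z.1, i.le z.2⟩ hz⟩
  locality {U} s hs y := by
    obtain ⟨W, hW, i, h⟩ := hs y
    obtain ⟨T, hT, m, hm⟩ := h ⟨y.1, hW⟩
    exact ⟨W ⊓ T, ⟨hW, hT⟩, m, fun z hz => hm ⟨z.1, hz.1⟩ hz.2⟩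

lemma latticePresheaf_isSheaf :
    Presheaf.IsSheaf (Opens.grothendieckTopology X) (latticePresheaf N) := by
  refine (TopCat.Presheaf.isSheaf_iff_isSheaf_comp (forget Ab.{0}) (latticePresheaf N)).mpr ?_
  refine TopCat.Presheaf.isSheaf_of_iso ?_ (TopCat.subpresheafToTypes.isSheaf (latticePredicate N))
  exact NatIso.ofComponents (fun U => Iso.refl _) (fun i => rfl)

/-- The `𝒪_X`-module of locally constant functions with values in the prescribed submodules. -/
def latticeSheaf : X.Modules :=
  { val := PresheafOfModules.ofPresheaf (R := X.ringCatSheaf.obj) (latticePresheaf N) (by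
      intro U W i r m
      apply Subtype.ext; funext y
      change toField (U := U.unop) r y.1 _ • m.1 _ =
        toField (U := W.unop) (X.presheaf.map i r) y.1 _ • m.1 _
      congr 1
      exact (toField_res i.unop r y.1 y.2).symm)
    isSheaf := latticePresheaf_isSheaf N }

/-- Sections of the sheaf have values in the vector space. -/
def latticeFieldValued : FieldValued (latticeSheaf N) V where
  val {U} y hy :=
    { toFun := fun s => (show latticeSections N U from s).1 ⟨y, hy⟩
      map_zero' := rfl
      map_add' := fun _ _ => rfl }
  val_res _ _ _ _ := rfl
  val_smul _ _ _ _ := rfl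
  eq_zero {U} y hy s hs := by
    obtain ⟨W, hW, m, hm⟩ := (show latticeSections N U from s).2 ⟨y, hy⟩
    have hm0 : m = 0 := (hm ⟨y, hy⟩ hW).2.symm.trans hs
    refine ⟨U ⊓ W, inf_le_left, ⟨hy, hW⟩, Subtype.ext (funext fun z => ?_)⟩
    exact (hm ⟨z.1, z.2.1⟩ z.2.2).2.trans hm0

lemma latticeFieldValued_mem {U : X.Opens} (s : Γ(latticeSheaf N, U)) (y : X) (hy : y ∈ U) :
    (latticeFieldValued N).val y hy s ∈ N.stalk y := by
  obtain ⟨W, hW, m, hm⟩ := (show latticeSections N U from s).2 ⟨y, hy⟩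
  have h : (latticeFieldValued N).val y hy s = m := (hm ⟨y, hy⟩ hW).2
  rw [h]
  exact (hm ⟨y, hy⟩ hW).1

variable {N} in
-- Every non-empty open set contains the generic point, so each value equals the value there.
lemma IsLatticeSection.eq_generic {U : X.Opens} {s : U → V} (hs : IsLatticeSection N s) (y z : U) :
    s y = s z := by
  have key : ∀ y : U, s y = s ⟨genericPoint X, genericPoint_mem y.2⟩ := fun y => by
    obtain ⟨W, hW, m, hm⟩ := hs y
    rw [(hm y hW).2, (hm _ (genericPoint_mem hW)).2]
  rw [key y, key z]

end LatticeSheaf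

/-! ### The model extension on the base. -/

section LogExtension

variable {X : Scheme.{0}} [IsIntegral X] [X.Over SpecC]

/-- The stalks of the extension of `𝒪` by a sheaf of forms, whose class is the class of the
logarithmic derivatives of the transition functions of the divisor: pairs `(ω, r)`, to be thought
of as `ω + r • dlog T` for a rational trivialisation `T` of the line bundle. -/
def extStalks (C : CartierDivisor X) (N : FormStalks X) :
    LatticeStalks X (RatForms X × X.functionField) where
  stalk x :=
    -- If `T = f i * t`, then `ω + r dlog T = (ω + r dlog (f i)) + r dlog t`. The conditions say
    -- that, in terms of the local coordinate `t`, the part along the base lies in `N` and the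
    -- coefficient of `dlog t` is regular.
    { carrier := {v | IsRegularAt x v.2 ∧ ∀ i, x ∈ C.U i →
        v.1 + v.2 • dlogForm (C.f i : X.functionField) ∈ N x}
      zero_mem' := ⟨isRegularAt_zero x, fun i _ => by
        rw [Prod.fst_zero, Prod.snd_zero, zero_smul, zero_add]
        exact zero_mem _⟩
      add_mem' := fun {a b} ha hb => ⟨add_mem ha.1 hb.1, fun i hi => by
        have := add_mem (ha.2 i hi) (hb.2 i hi)
        rw [Prod.fst_add, Prod.snd_add, add_smul]
        convert this using 1
        abel⟩
      neg_mem' := fun {a} ha => ⟨neg_mem ha.1, fun i hi => by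
        have := neg_mem (ha.2 i hi)
        rw [Prod.fst_neg, Prod.snd_neg, neg_smul]
        convert this using 1
        abel⟩ }
  smul_mem x a v hv := ⟨IsRegularAt.mul ⟨a, rfl⟩ hv.1, fun i hi => by
    have := Submodule.smul_mem _ a (hv.2 i hi)
    rw [← algebraMap_smul X.functionField a, smul_add, smul_smul] at this
    exact this⟩

variable (C : CartierDivisor X) (N : FormStalks X)

/-- The inclusion of the forms in the extension. -/
def extInl : formSheaf N ⟶ latticeSheaf (extStalks C N) :=
  SheafOfModules.Hom.mk (PresheafOfModules.homMk
    { app := fun U => AddCommGrpCat.ofHom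
        { toFun := fun s => (show latticeSections (extStalks C N) U.unop from
            ⟨fun y => ((show formSections N U.unop from s).1 y, 0), fun y => by
              obtain ⟨V, hV, m, hm⟩ := (show formSections N U.unop from s).2 y
              refine ⟨V, hV, (m, 0), fun z hz => ⟨⟨isRegularAt_zero _, fun i _ => ?_⟩,
                Prod.ext (hm z hz).2 rfl⟩⟩
              rw [zero_smul, add_zero]
              exact (hm z hz).1⟩)
          map_zero' := rfl
          map_add' := fun s t => by
            apply Subtype.ext; funext y
            exact Prod.ext rfl (add_zero _).symm }
      naturality := by intro U V i; rfl }
    (by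
      intro U r m
      apply Subtype.ext; funext y
      exact Prod.ext rfl (smul_zero _).symm))

lemma exists_extSnd {U : X.Opens} (s : latticeSections (extStalks C N) U) :
    ∃ a : Γ(X, U), ∀ y (hy : y ∈ U), toField a y hy = (s.1 ⟨y, hy⟩).2 := by
  by_cases hU : Nonempty U
  · obtain ⟨y₀⟩ := hU
    obtain ⟨a, ha⟩ := exists_section U (s.1 y₀).2 fun x hx => by
      have := (latticeFieldValued_mem (extStalks C N) s x hx).1
      rw [s.2.eq_generic y₀ ⟨x, hx⟩]
      exact this
    exact ⟨a, fun y hy => by rw [ha, s.2.eq_generic y₀ ⟨y, hy⟩]⟩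
  · exact ⟨0, fun y hy => (hU ⟨⟨y, hy⟩⟩).elim⟩

/-- The coefficient of `dlog T`, as a regular function. -/
def extSnd {U : X.Opens} (s : latticeSections (extStalks C N) U) : Γ(X, U) :=
  (exists_extSnd C N s).choose

lemma toField_extSnd {U : X.Opens} (s : latticeSections (extStalks C N) U) (y : X) (hy : y ∈ U) :
    toField (extSnd C N s) y hy = (s.1 ⟨y, hy⟩).2 :=
  (exists_extSnd C N s).choose_spec y hy

/-- The projection of the extension to the structure sheaf. -/
def extProj : latticeSheaf (extStalks C N) ⟶ structureSheaf X :=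
  SheafOfModules.Hom.mk (PresheafOfModules.homMk
    { app := fun U => AddCommGrpCat.ofHom
        { toFun := fun s => (show Γ(X, U.unop) from
            extSnd C N (show latticeSections (extStalks C N) U.unop from s))
          map_zero' := toField_injective (U := U.unop) fun y hy => by
            refine (toField_extSnd C N _ y hy).trans ?_
            exact (toField_zero (U := U.unop) y hy).symm
          map_add' := fun s t => toField_injective (U := U.unop) fun y hy => by
            refine (toField_extSnd C N _ y hy).trans ?_
            refine Eq.trans ?_ (toField_add (U := U.unop) _ _ y hy).symm
            exact (congrArg₂ (· + ·) (toField_extSnd C N _ y hy) (toField_extSnd C N _ y hy)).symm }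
      naturality := by
        intro U V i
        ext s
        refine toField_injective (U := V.unop) fun y hy => ?_
        refine (toField_extSnd C N _ y hy).trans ?_
        refine Eq.trans ?_ (toField_res i.unop (U := V.unop) (V := U.unop) _ y hy).symm
        exact (toField_extSnd C N _ y (i.unop.le hy)).symm }
    (by
      intro U r m
      refine toField_injective (U := U.unop) fun y hy => ?_
      refine (toField_extSnd C N _ y hy).trans ?_
      refine Eq.trans ?_ (toField_mul (U := U.unop) _ _ y hy).symm
      exact congrArg (toField (U := U.unop) r y hy * ·) (toField_extSnd C N _ y hy).symm))

lemma extInl_extProj : extInl C N ≫ extProj C N = 0 := by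
  ext U s
  refine toField_injective (U := U) fun y hy => ?_
  exact (toField_extSnd C N _ y hy).trans (toField_zero (U := U) y hy).symm

/-- The local lift of `1`, i.e. the logarithmic derivative of the fibre coordinate. -/
def extLift (hN : ∀ x i j, x ∈ C.U i → x ∈ C.U j →
    -dlogForm (C.f i : X.functionField) + dlogForm (C.f j : X.functionField) ∈ N x)
    {U : X.Opens} (i : C.ι) (hU : U ≤ C.U i) :
    Γ(latticeSheaf (extStalks C N), U) :=
  show latticeSections (extStalks C N) U from
    -- This pair stands for `dlog T - dlog (f i) = dlog t`.
    ⟨fun _ => (-dlogForm (C.f i : X.functionField), 1), fun y => ⟨⊤, trivial, _, fun z _ =>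
      ⟨⟨isRegularAt_one _, fun j hj => by
        rw [one_smul]
        exact hN _ _ _ (hU z.2) hj⟩, rfl⟩⟩⟩

lemma extProj_extLift (hN : ∀ x i j, x ∈ C.U i → x ∈ C.U j →
    -dlogForm (C.f i : X.functionField) + dlogForm (C.f j : X.functionField) ∈ N x) {U : X.Opens} (i : C.ι)
    (hU : U ≤ C.U i) : (extProj C N).app U (extLift C N hN i hU) = (1 : Γ(X, U)) :=
  toField_injective (U := U) fun y hy =>
    (toField_extSnd C N _ y hy).trans (toField_one (U := U) y hy).symm

instance mono_extInl : Mono (extInl C N) := by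
  refine mono_of_app_injective _ fun U s t hst => Subtype.ext (funext fun y => ?_)
  exact congrArg Prod.fst (congrFun (congrArg Subtype.val hst) y)

/-- A regular function `s` lifts locally to `s` times the lift of `1`. On the kernel `r = 0`, and
the condition that defines the extension reduces to `ω ∈ N`. -/
lemma ext_shortExact (hN : ∀ x i j, x ∈ C.U i → x ∈ C.U j →
    -dlogForm (C.f i : X.functionField) + dlogForm (C.f j : X.functionField) ∈ N x) :
    (ShortComplex.mk _ _ (extInl_extProj C N)).ShortExact := by
  have hepi : Epi (extProj C N) := by
    refine epi_of_locally_surjective _ fun U s x hx => ?_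
    obtain ⟨i, hi⟩ := C.exists_mem x
    refine ⟨U ⊓ C.U i, inf_le_left, ⟨hx, hi⟩,
      (show Γ(X, U ⊓ C.U i) from res (structureSheaf X).presheaf inf_le_left s) •
        extLift C N hN i inf_le_right, ?_⟩
    refine (Scheme.Modules.Hom.app_smul _ _ _).trans ?_
    refine (congrArg _ (extProj_extLift C N hN i inf_le_right)).trans ?_
    exact mul_one (show Γ(X, U ⊓ C.U i) from res (structureSheaf X).presheaf inf_le_left s)
  refine ShortComplex.ShortExact.mk' ?_ (mono_extInl C N) hepi
  refine exact_of_locally_exact _ _ _ fun U s hs x hx => ⟨U, le_rfl, hx, ?_⟩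
  have h2 : ∀ y : U, ((show latticeSections (extStalks C N) U from s).1 y).2 = 0 := fun y => by
    rw [← toField_extSnd C N (show latticeSections (extStalks C N) U from s) y.1 y.2]
    exact (congrArg (fun a : Γ(X, U) => toField a y.1 y.2) hs).trans (toField_zero y.1 y.2)
  refine ⟨show formSections N U from ⟨fun y => ((show latticeSections (extStalks C N) U from s).1 y).1,
    fun y => ?_⟩, ?_⟩
  · obtain ⟨W, hW, m, hm⟩ := (show latticeSections (extStalks C N) U from s).2 y
    refine ⟨W, hW, m.1, fun z hz => ⟨?_, congrArg Prod.fst (hm z hz).2⟩⟩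
    obtain ⟨i, hi⟩ := C.exists_mem z.1
    have h3 := (hm z hz).1.2 i hi
    have h4 : m.2 = 0 := (congrArg Prod.snd (hm z hz).2).symm.trans (h2 z)
    rwa [h4, zero_smul, add_zero] at h3
  · apply Subtype.ext; funext y
    exact Prod.ext rfl (h2 y).symm

end LogExtension

/-! ### Cocycles and the class of the model extension. -/

section Cohomology

lemma H1.map_mk {X : TopCat.{0}} {F G : TopCat.Presheaf Ab.{0} X} (φ : F ⟶ G) (𝓤 : PointedCover X)
    (c : cocycles F 𝓤) : H1.map φ (H1.mk F 𝓤 c) = H1.mk G 𝓤 (mapCocycle φ 𝓤 c) :=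
  H1.lift_mk ..

lemma H1.pull_mk {X Y : TopCat.{0}} (f : Y ⟶ X) (K : TopCat.Presheaf Ab.{0} Y) (𝓤 : PointedCover X)
    (c : cocycles ((TopCat.Presheaf.pushforward Ab.{0} f).obj K) 𝓤) :
    H1.pull f K (H1.mk _ 𝓤 c) = H1.mk K (𝓤.comap f) (pullCocycle f K 𝓤 c) :=
  H1.lift_mk ..

lemma H1.pull_map_mk {X Y : TopCat.{0}} (f : Y ⟶ X) {F : TopCat.Presheaf Ab.{0} X}
    {K : TopCat.Presheaf Ab.{0} Y} (φ : F ⟶ (TopCat.Presheaf.pushforward Ab.{0} f).obj K)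
    (𝓤 : PointedCover X) (c : cocycles F 𝓤) : H1.pull f K (H1.map φ (H1.mk F 𝓤 c)) =
      H1.mk K (𝓤.comap f) (pullCocycle f K 𝓤 (mapCocycle φ 𝓤 c)) := by
  rw [H1.map_mk, H1.pull_mk]

end Cohomology

section Chern

variable {S₁ S₂ : Scheme.{0}} [IsIntegral S₁] [IsIntegral S₂] [S₁.Over SpecC] [S₂.Over SpecC]

lemma formMap_dlogForm (f : S₂ ⟶ S₁) [IsDominant f] [f.IsOver SpecC] (g : S₁.functionField) :
    formMap f (dlogForm g) = dlogForm (fieldMap f g) := by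
  rw [dlogForm, formMap_smul, formMap_D, map_inv₀]
  rfl

variable (σ : S₂ ⟶ S₁) [IsDominant σ] [σ.IsOver SpecC] {J : Type} (D : J → Set S₁) (δ : J → ℚ)

lemma logInclusion_pullSection {U : S₁.Opens} (s : Γ(formSheaf (regularForms S₁), U)) :
    (logInclusion σ D δ).app (σ ⁻¹ᵁ U) (pullSection σ (formSheaf (regularForms S₁)) s) =
      (formHom σ (regularForms S₁) (orbCotangent σ D δ) (formMap_regularForms σ D δ)).app U s :=
  homEquiv_symm_app_pullSection σ _ _ s

/-- On the overlap `f j = u * f i` with a unit `u`, so the difference is the pull-back of the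
regular form `dlog u`. This makes the local lifts of `1` available in the model extension. -/
lemma dlogForm_sub_mem (C : CartierDivisor S₁) (x : S₂) (i j : C.ι) (hi : σ x ∈ C.U i)
    (hj : σ x ∈ C.U j) : -dlogForm ((C.pullback σ).f i : S₂.functionField) +
      dlogForm ((C.pullback σ).f j : S₂.functionField) ∈ orbCotangent σ D δ x := by
  obtain ⟨u, hu⟩ := C.cocycle j i
  have hx : σ x ∈ C.U j ⊓ C.U i := ⟨hj, hi⟩
  have h1 : dlogForm ((C.pullback σ).f j : S₂.functionField) =
      formMap σ (dlogForm (toField (u : Γ(S₁, C.U j ⊓ C.U i)) (σ x) hx)) +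
      dlogForm ((C.pullback σ).f i : S₂.functionField) := by
    change dlogForm (fieldMap σ (C.f j)) = _ + dlogForm (fieldMap σ (C.f i))
    rw [← formMap_dlogForm, ← formMap_dlogForm, ← map_add,
      ← dlogForm_mul (toField_ne_zero u _ hx) (Units.ne_zero _), hu]
  rw [h1, neg_add_cancel_comm_assoc]
  refine formMap_regularForms σ D δ x _ ?_
  rw [dlogForm, inv_toField, toField, algebraMap_smul]
  exact Submodule.smul_mem _ _ (Submodule.subset_span ⟨_, rfl⟩)

/-- A section of the presheaf of units, as a unit. -/
def sectionUnit {U : S₁.Opens} (c : (unitsPresheaf S₁).obj (op U)) : Γ(S₁, U)ˣ :=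
  Additive.toMul (show Additive Γ(S₁, U)ˣ from c)

lemma pullH1_mk {X Y : Scheme.{0}} (f : Y ⟶ X) (M : X.Modules) (𝓤 : PointedCover X)
    (c : cocycles M.presheaf 𝓤) : pullH1 f M (H1.mk M.presheaf 𝓤 c) =
      H1.mk ((Scheme.Modules.pullback f).obj M).presheaf (𝓤.comap f.base)
        (pullCocycle f.base ((Scheme.Modules.pullback f).obj M).presheaf 𝓤
          (mapCocycle ((Scheme.Modules.pullbackPushforwardAdjunction f).unit.app M).mapPresheaf
            𝓤 c)) :=
  by
  set η := ((Scheme.Modules.pullbackPushforwardAdjunction f).unit.app M).mapPresheaf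
  rw [pullH1, AddMonoidHom.comp_apply]
  exact H1.pull_map_mk f.base (K := ((Scheme.Modules.pullback f).obj M).presheaf) η 𝓤 c

/-- With the lifts `-dlog (f i)` of `1`, the lift at `y` minus the lift at `x` is `dlog (f x) - dlog
(f y) = dlog u`, where `f x = u * f y` defines the cocycle of `c1`. The sign is therefore the one
required, and the equality already holds for cocycles on the pulled-back cover. -/
lemma isExtensionClass_chernMap (C : CartierDivisor S₁) :
    IsExtensionClass (extInl (C.pullback σ) (orbCotangent σ D δ))
      (extProj (C.pullback σ) (orbCotangent σ D δ)) (chernMap σ D δ C.c1) := by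
  have hN : ∀ (x : S₂) (i j : (C.pullback σ).ι), x ∈ (C.pullback σ).U i →
      x ∈ (C.pullback σ).U j → -dlogForm ((C.pullback σ).f i : S₂.functionField) +
        dlogForm ((C.pullback σ).f j : S₂.functionField) ∈ orbCotangent σ D δ x :=
    dlogForm_sub_mem σ D δ C
  let 𝓤 : PointedCover S₁ := ⟨fun x => C.U (C.idx x), C.mem_idx⟩
  let 𝓥 : PointedCover S₂ := 𝓤.comap σ.base
  -- The chosen transition units are made opaque; only their defining equation is kept.
  obtain ⟨c, hc, hc'⟩ : ∃ c : cocycles (unitsPresheaf S₁) 𝓤, C.c1 = H1.mk (unitsPresheaf S₁) 𝓤 c ∧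
      ∀ x y p (hp : p ∈ C.U (C.idx x) ⊓ C.U (C.idx y)),
        toField (sectionUnit (c.1 x y)).1 p hp * (C.f (C.idx y) : S₁.functionField) =
          C.f (C.idx x) :=
    ⟨_, rfl, fun x y => (C.cocycle (C.idx x) (C.idx y)).choose_spec⟩
  let c' : cocycles (formSheaf (orbCotangent σ D δ)).presheaf 𝓥 :=
    mapCocycle (logInclusion σ D δ).mapPresheaf 𝓥 (pullCocycle σ.base
      ((Scheme.Modules.pullback σ).obj (formSheaf (regularForms S₁))).presheaf 𝓤
      (mapCocycle ((Scheme.Modules.pullbackPushforwardAdjunction σ).unit.app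
        (formSheaf (regularForms S₁))).mapPresheaf 𝓤 (mapCocycle (dlog S₁) 𝓤 c)))
  let e : ∀ x, Γ(latticeSheaf (extStalks (C.pullback σ) (orbCotangent σ D δ)), 𝓥.U x) := fun x =>
    extLift (U := σ ⁻¹ᵁ C.U (C.idx (σ x))) (C.pullback σ) (orbCotangent σ D δ) hN (C.idx (σ x)) le_rfl
  have h0 : ∀ x y, c'.1 x y = (formHom σ (regularForms S₁) (orbCotangent σ D δ)
      (formMap_regularForms σ D δ)).app (C.U (C.idx (σ x)) ⊓ C.U (C.idx (σ y)))
        (dlogSection (sectionUnit (c.1 (σ x) (σ y)))) := fun x y =>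
    logInclusion_pullSection σ D δ (U := C.U (C.idx (σ x)) ⊓ C.U (C.idx (σ y)))
      (dlogSection (sectionUnit (c.1 (σ x) (σ y))))
  refine ⟨𝓥, e, c', fun x => ?_, fun x y => ?_, ?_⟩
  · exact extProj_extLift (U := σ ⁻¹ᵁ C.U (C.idx (σ x))) (C.pullback σ) (orbCotangent σ D δ) hN
      (C.idx (σ x)) le_rfl
  · rw [h0]
    apply Subtype.ext; funext p
    refine Prod.ext ?_ (sub_self _).symm
    change formMap σ (dlogForm _) = -dlogForm (fieldMap σ (C.f (C.idx (σ y)))) -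
      -dlogForm (fieldMap σ (C.f (C.idx (σ x))))
    rw [← hc' (σ x) (σ y) (σ p.1) p.2, ← formMap_dlogForm, ← formMap_dlogForm, dlogForm_mul, map_add]
    · abel
    · exact toField_ne_zero _ _ _
    · exact Units.ne_zero _
  · rw [hc]
    have e1 := H1.map_mk (dlog S₁) 𝓤 c
    have e2 := pullH1_mk σ (formSheaf (regularForms S₁)) 𝓤 (mapCocycle (dlog S₁) 𝓤 c)
    have e4 := H1.map_mk (logInclusion σ D δ).mapPresheaf 𝓥 (pullCocycle σ.base
      ((Scheme.Modules.pullback σ).obj (formSheaf (regularForms S₁))).presheaf 𝓤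
      (mapCocycle ((Scheme.Modules.pullbackPushforwardAdjunction σ).unit.app
        (formSheaf (regularForms S₁))).mapPresheaf 𝓤 (mapCocycle (dlog S₁) 𝓤 c)))
    refine Eq.trans ?_ e4
    change H1.map (logInclusion σ D δ).mapPresheaf
      (pullH1 σ (formSheaf (regularForms S₁)) (H1.map (dlog S₁) _)) = _
    rw [e1]
    exact congrArg (H1.map (logInclusion σ D δ).mapPresheaf) e2

end Chern

/-! ### Formal transport of an extension to a total space and back. -/

section Assembly

variable {S Y : Scheme.{0}}

lemma IsExtensionClass.of_iso {F E E' : S.Modules} {a : F ⟶ E} {b : E ⟶ structureSheaf S}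
    {ξ : H1 F.presheaf} (h : IsExtensionClass a b ξ) (ψ : E ⟶ E') {a' : F ⟶ E'}
    {b' : E' ⟶ structureSheaf S} (ha : a ≫ ψ = a') (hb : ψ ≫ b' = b) :
    IsExtensionClass a' b' ξ := by
  subst ha hb
  obtain ⟨𝓤, e, c, h1, h2, h3⟩ := h
  refine ⟨𝓤, fun x => ψ.app _ (e x), c, h1, fun x y => ?_, h3⟩
  refine (congrArg (ψ.app _) (h2 x y)).trans ?_
  rw [map_sub, hom_app_res, hom_app_res]

lemma shortExact_of_iso {A : Type*} [Category A] [Abelian A] {X₁ X₂ X₃ Y₁ Y₂ Y₃ : A} {f : X₁ ⟶ X₂}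
    {g : X₂ ⟶ X₃} (w : f ≫ g = 0) (h : (ShortComplex.mk f g w).ShortExact) (e₁ : X₁ ≅ Y₁)
    (e₂ : X₂ ≅ Y₂) (e₃ : X₃ ≅ Y₃) {f' : Y₁ ⟶ Y₂} {g' : Y₂ ⟶ Y₃} (h₁ : e₁.hom ≫ f' = f ≫ e₂.hom)
    (h₂ : e₂.hom ≫ g' = g ≫ e₃.hom) : ∃ w' : f' ≫ g' = 0, (ShortComplex.mk f' g' w').ShortExact := by
  have w' : f' ≫ g' = 0 := by
    rw [← cancel_epi e₁.hom, ← Category.assoc, h₁, Category.assoc, h₂, ← Category.assoc, w,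
      Limits.zero_comp, Limits.comp_zero]
  exact ⟨w', ShortComplex.shortExact_of_iso (ShortComplex.isoMk e₁ e₂ e₃ h₁ h₂) h⟩

/-- An extension on the base whose pull-back is identified with a module `G` on the total space
computes the restriction of `G` to a section. -/
theorem extension_of_pullback_iso (π : Y ⟶ S) (i₀ : S ⟶ Y) (hi : i₀ ≫ π = 𝟙 S) {F E : S.Modules}
    {G : Y.Modules} (a' : F ⟶ E) (b' : E ⟶ structureSheaf S) (w' : a' ≫ b' = 0)
    (hex : (ShortComplex.mk a' b' w').ShortExact) (θ : (Scheme.Modules.pullback π).obj E ≅ G)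
    (α : (Scheme.Modules.pullback π).obj F ⟶ G) [Mono α]
    (hα : (Scheme.Modules.pullback π).map a' ≫ θ.hom = α) :
    ∃ (β : G ⟶ structureSheaf Y),
      let a : F ⟶ (Scheme.Modules.pullback i₀).obj G := restrictHom i₀ π hi α
      let b : (Scheme.Modules.pullback i₀).obj G ⟶ structureSheaf S :=
        (Scheme.Modules.pullback i₀).map β ≫ pullbackUnit i₀
      (∃ w : α ≫ β = 0, (ShortComplex.mk α β w).ShortExact) ∧
      (∃ w : a ≫ b = 0, (ShortComplex.mk a b w).ShortExact) ∧
      (∃ e : (Scheme.Modules.pullback π).obj ((Scheme.Modules.pullback i₀).obj G) ≅ G,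
        (Scheme.Modules.pullback π).map a ≫ e.hom = α ∧
        e.hom ≫ β = (Scheme.Modules.pullback π).map b ≫ pullbackUnit π) ∧
      ∀ ξ, IsExtensionClass a' b' ξ → IsExtensionClass a b ξ := by
  -- The quotient map upstairs is the pull-back of `b'`, transported along `θ`.
  let β : G ⟶ structureSheaf Y :=
    θ.inv ≫ (Scheme.Modules.pullback π).map b' ≫ pullbackUnit π
  refine ⟨β, ?_⟩
  intro a b
  -- Since `i₀^* π^*` is the identity, restricting `θ` to the section identifies `E` with `i₀^* G`.
  -- The remaining claims are compatibilities of `ψ` with the two sequences.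
  let ψ : E ≅ (Scheme.Modules.pullback i₀).obj G :=
    (sectionIso i₀ π hi).app E ≪≫ (Scheme.Modules.pullback i₀).mapIso θ
  have ha : a' ≫ ψ.hom = a := by
    change a' ≫ (sectionIso i₀ π hi).hom.app E ≫ (Scheme.Modules.pullback i₀).map θ.hom = a
    have h1 := (sectionIso i₀ π hi).hom.naturality a'
    rw [← Category.assoc]
    refine (congrArg (· ≫ _) h1).trans ?_
    rw [Category.assoc]
    refine Eq.trans ?_ (restrictHom_eq i₀ π hi α).symm
    refine congrArg (_ ≫ ·) ?_
    rw [← hα]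
    exact ((Scheme.Modules.pullback i₀).map_comp _ _).symm
  have hb : ψ.hom ≫ b = b' := by
    change ((sectionIso i₀ π hi).hom.app E ≫ (Scheme.Modules.pullback i₀).map θ.hom) ≫
      (Scheme.Modules.pullback i₀).map (θ.inv ≫ (Scheme.Modules.pullback π).map b' ≫
        pullbackUnit π) ≫ pullbackUnit i₀ = b'
    rw [Category.assoc, ← Category.assoc ((Scheme.Modules.pullback i₀).map θ.hom), ← Functor.map_comp,
      Iso.hom_inv_id_assoc, Functor.map_comp, Category.assoc]
    have h1 := (sectionIso i₀ π hi).hom.naturality b'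
    rw [← Category.assoc]
    refine (congrArg (· ≫ _) h1).symm.trans ?_
    rw [Category.assoc]
    refine (congrArg (_ ≫ ·) (sectionIso_pullbackUnit i₀ π hi)).trans ?_
    exact Category.comp_id _
  have hβ : θ.hom ≫ β = (Scheme.Modules.pullback π).map b' ≫ pullbackUnit π :=
    Iso.hom_inv_id_assoc _ _
  -- Pull-back is a left adjoint and gives only right exactness; injectivity on the left is
  -- inherited from `α`.
  have hmono : Mono ((Scheme.Modules.pullback π).map a') := by
    have : Mono ((Scheme.Modules.pullback π).map a' ≫ θ.hom) := hα ▸ inferInstance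
    exact mono_of_mono _ θ.hom
  have hepi : Epi b' := hex.epi_g
  have w'' : (Scheme.Modules.pullback π).map a' ≫ (Scheme.Modules.pullback π).map b' = 0 := by
    rw [← Functor.map_comp, w', Functor.map_zero]
  have hex' : (ShortComplex.mk _ _ w'').ShortExact :=
    ShortComplex.ShortExact.mk'
      (hex.exact.map_of_epi_of_preservesCokernel (Scheme.Modules.pullback π) hepi inferInstance)
      hmono inferInstance
  refine ⟨?_, ?_, ⟨(Scheme.Modules.pullback π).mapIso ψ.symm ≪≫ θ, ?_, ?_⟩, fun ξ hξ =>
    hξ.of_iso ψ.hom ha hb⟩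
  · refine shortExact_of_iso w'' hex' (Iso.refl _) θ (asIso (pullbackUnit π)) ?_ ?_
    · rw [hα]
      exact Category.id_comp _
    · exact hβ
  · refine shortExact_of_iso w' hex (Iso.refl _) ψ (Iso.refl _) ?_ ?_
    · rw [ha]
      exact Category.id_comp _
    · rw [hb]
      exact (Category.comp_id _).symm
  · rw [← ha]
    change (Scheme.Modules.pullback π).map (a' ≫ ψ.hom) ≫ (Scheme.Modules.pullback π).map ψ.inv ≫
      θ.hom = α
    rw [← Category.assoc, ← Functor.map_comp, Category.assoc, Iso.hom_inv_id, Category.comp_id, hα]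
  · change ((Scheme.Modules.pullback π).map ψ.inv ≫ θ.hom) ≫ β = _
    rw [Category.assoc, hβ, ← Category.assoc, ← Functor.map_comp]
    refine congrArg (fun χ => (Scheme.Modules.pullback π).map χ ≫ pullbackUnit π) ?_
    rw [Iso.inv_comp_eq, hb]

end Assembly

/-! ### Localisations, recognised by fractions, and radical ideals. -/

section FractionHom

variable {A B C : Type} [CommRing A] [CommRing B] [CommRing C]

/-- An injective homomorphism such that every element of the target is a fraction of elements of
the source. -/
structure IsFractionHom (φ : A →+* B) : Prop where
  injective : Function.Injective φ
  exists_fraction : ∀ g : B, ∃ a b : A, IsUnit (φ b) ∧ g * φ b = φ a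

/-- The denominators can be taken to be all elements that become units. -/
lemma IsFractionHom.isLocalization {φ : A →+* B} (h : IsFractionHom φ) :
    letI := φ.toAlgebra
    IsLocalization ((IsUnit.submonoid B).comap φ) B := by
  let _ := φ.toAlgebra
  refine ⟨fun y => y.2, fun g => ?_, fun {x y} hxy => ⟨1, ?_⟩⟩
  · obtain ⟨a, b, hb, e⟩ := h.exists_fraction g
    exact ⟨(a, ⟨b, hb⟩), e⟩
  · rw [h.injective hxy]

lemma IsFractionHom.isRadical_map {φ : A →+* B} (h : IsFractionHom φ) {I : Ideal A}
    (hI : I.IsRadical) : (I.map φ).IsRadical := by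
  let _ := φ.toAlgebra
  have := h.isLocalization
  have e := IsLocalization.map_radical ((IsUnit.submonoid B).comap φ) (S := B) I
  rw [hI.radical] at e
  exact Ideal.radical_eq_iff.mp e.symm

/-- The quotient by the extended ideal is the polynomial ring over `A ⧸ I`, which is reduced. -/
lemma isRadical_map_C {I : Ideal A} (hI : I.IsRadical) :
    (I.map (Polynomial.C : A →+* Polynomial A)).IsRadical := by
  rw [Ideal.isRadical_iff_quotient_reduced] at hI ⊢
  have : _root_.IsReduced (Polynomial (A ⧸ I)) := ⟨fun p hp => Polynomial.ext fun n => by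
    rw [(Polynomial.isNilpotent_iff.mp hp n).eq_zero, Polynomial.coeff_zero]⟩
  exact isReduced_of_injective (Ideal.polynomialQuotientEquivQuotientPolynomial I).symm
    (Ideal.polynomialQuotientEquivQuotientPolynomial I).symm.injective

lemma isRadical_span_X [IsDomain A] : (Ideal.span {(Polynomial.X : Polynomial A)}).IsRadical :=
  ((Ideal.span_singleton_prime Polynomial.X_ne_zero).mpr Polynomial.prime_X).isRadical

/-- Elements of a finitely generated ideal become multiples of a generator of the localised ideal
after multiplication by one denominator. -/
lemma exists_mul_mem_span {φ : A →+* B} {J : Ideal A} (hJ : J.FG) {M : Submonoid A}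
    (hφ : letI := φ.toAlgebra; IsLocalization M B) {s : A}
    (h : J.map φ = Ideal.span {φ s}) :
    ∃ m ∈ M, m * s ∈ J ∧ ∀ a ∈ J, m * a ∈ Ideal.span {s} := by
  let _ := φ.toAlgebra
  have := hφ
  -- One denominator serves for `s ∈ J` after localisation. For the reverse inclusion the
  -- denominators of finitely many generators of `J` are multiplied together, and the product of
  -- both works.
  have h1 : ∃ m ∈ M, m * s ∈ J := by
    have : algebraMap A B s ∈ J.map (algebraMap A B) := by
      change φ s ∈ J.map φ
      rw [h]; exact Ideal.mem_span_singleton_self _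
    exact (IsLocalization.algebraMap_mem_map_algebraMap_iff M B J s).mp this
  obtain ⟨m₁, hm₁, h1⟩ := h1
  have h2 : ∃ m ∈ M, ∀ a ∈ J, m * a ∈ Ideal.span {s} := by
    have key : ∀ a ∈ J, ∃ m ∈ M, m * a ∈ Ideal.span {s} := by
      intro a ha
      have : algebraMap A B a ∈ (Ideal.span {s}).map (algebraMap A B) := by
        rw [Ideal.map_span, Set.image_singleton]
        change φ a ∈ Ideal.span {φ s}
        rw [← h]
        exact Ideal.mem_map_of_mem _ ha
      exact (IsLocalization.algebraMap_mem_map_algebraMap_iff M B _ a).mp this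
    classical
    obtain ⟨t, rfl⟩ := hJ
    choose! m hm hm' using key
    refine ⟨∏ a ∈ t, m a, prod_mem fun a ha => hm a (Ideal.subset_span ha), fun a ha => ?_⟩
    change _ ∈ Submodule.comap (LinearMap.mulLeft A (∏ a ∈ t, m a)) (Ideal.span {s})
    refine Submodule.span_le.mpr (fun b hb => ?_) ha
    change (∏ a ∈ t, m a) * b ∈ Ideal.span {s}
    rw [← Finset.prod_erase_mul _ _ hb, mul_assoc]
    exact Ideal.mul_mem_left _ _ (hm' b (Ideal.subset_span hb))
  obtain ⟨m₂, hm₂, h2⟩ := h2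
  refine ⟨m₁ * m₂, mul_mem hm₁ hm₂, ?_, fun a ha => ?_⟩
  · rw [mul_comm m₁, mul_assoc]
    exact Ideal.mul_mem_left _ _ h1
  · rw [mul_assoc]
    exact Ideal.mul_mem_left _ _ (h2 a ha)

end FractionHom

/-! ### The ideal of a closed set in a local ring. -/

section IdealOf

variable {X Y : Scheme.{0}}

lemma mem_idealOf {Z : Set X} {x : X} {a : X.presheaf.stalk x} : a ∈ idealOf Z x ↔
    ∀ (y : X) (_ : y ∈ Z) (h : y ⤳ x),
      X.presheaf.stalkSpecializes h a ∈ IsLocalRing.maximalIdeal (X.presheaf.stalk y) := by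
  simp only [idealOf, Ideal.mem_iInf, Ideal.mem_comap]

lemma isRadical_idealOf (Z : Set X) (x : X) : (idealOf Z x).IsRadical :=
  Ideal.isRadical_iInf _ fun _ => Ideal.isRadical_iInf _ fun _ => Ideal.isRadical_iInf _ fun _ =>
    (Ideal.IsRadical.comap _ (IsLocalRing.maximalIdeal.isMaximal _).isPrime.isRadical)

/-- The prime ideal of the local ring at `x` that corresponds to a generization. -/
def genPrime {x y : X} (h : y ⤳ x) : PrimeSpectrum (X.presheaf.stalk x) :=
  PrimeSpectrum.comap (X.presheaf.stalkSpecializes h).hom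
    (IsLocalRing.closedPoint (X.presheaf.stalk y))

lemma fromSpecStalk_genPrime {x y : X} (h : y ⤳ x) : X.fromSpecStalk x (genPrime h) = y := by
  have := congrArg (fun f => f (IsLocalRing.closedPoint (X.presheaf.stalk y)))
    (congrArg (fun g : Spec _ ⟶ X => (fun p => g p))
      (Scheme.SpecMap_stalkSpecializes_fromSpecStalk h))
  simp only [Scheme.fromSpecStalk_closedPoint] at this
  exact this

lemma exists_genPrime_eq {x : X} (P : PrimeSpectrum (X.presheaf.stalk x)) :
    ∃ (y : X) (h : y ⤳ x), genPrime h = P := by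
  have hy : X.fromSpecStalk x P ∈ Set.range (X.fromSpecStalk x) := ⟨P, rfl⟩
  rw [Scheme.range_fromSpecStalk] at hy
  refine ⟨_, hy, ?_⟩
  exact (X.fromSpecStalk x).injective (fromSpecStalk_genPrime hy)

/-- The generizations of `x` are the primes of its local ring. Hence the functions that vanish on
those in `Z` form the intersection of the primes containing `I`, which is the radical. -/
lemma idealOf_eq_radical {Z : Set X} {x : X} (I : Ideal (X.presheaf.stalk x))
    (h : ∀ (y : X) (hy : y ⤳ x), y ∈ Z ↔ I ≤ (genPrime hy).asIdeal) :
    idealOf Z x = I.radical := by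
  rw [Ideal.radical_eq_sInf]
  refine le_antisymm ?_ ?_
  · refine le_sInf fun J hJ => ?_
    obtain ⟨hIJ, hJ⟩ := hJ
    obtain ⟨y, hy, e⟩ := exists_genPrime_eq ⟨J, hJ⟩
    have e' : (genPrime hy).asIdeal = J := congrArg PrimeSpectrum.asIdeal e
    intro a ha
    have := mem_idealOf.mp ha y ((h y hy).mpr (e'.symm ▸ hIJ)) hy
    rw [← e']
    exact this
  · intro a ha
    refine mem_idealOf.mpr fun y hyZ hy => ?_
    exact (Submodule.mem_sInf.mp ha) (genPrime hy).asIdeal ⟨(h y hy).mp hyZ, (genPrime hy).2⟩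

/-- The trace of `Z` on the spectrum of the local ring is closed, hence the zero locus of an ideal
whose radical is `idealOf Z x`. So the ideal recovers `Z` near `x`. -/
lemma idealOf_le_iff {Z : Set X} (hZ : IsClosed Z) {x y : X} (hy : y ⤳ x) :
    y ∈ Z ↔ idealOf Z x ≤ (genPrime hy).asIdeal := by
  refine ⟨fun h a ha => mem_idealOf.mp ha y h hy, fun h => ?_⟩
  have hc : IsClosed ((X.fromSpecStalk x) ⁻¹' Z) := hZ.preimage (X.fromSpecStalk x).continuous
  obtain ⟨I, hI⟩ := (PrimeSpectrum.isClosed_iff_zeroLocus_ideal _).mp hc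
  have h1 : idealOf Z x = I.radical := by
    refine idealOf_eq_radical I fun y' hy' => ?_
    have : genPrime hy' ∈ X.fromSpecStalk x ⁻¹' Z ↔ I ≤ (genPrime hy').asIdeal := by
      rw [hI]; rfl
    refine Iff.trans ?_ this
    change _ ↔ X.fromSpecStalk x (genPrime hy') ∈ Z
    rw [fromSpecStalk_genPrime]
  have h2 : genPrime hy ∈ X.fromSpecStalk x ⁻¹' Z := by
    rw [hI]
    exact (Ideal.le_radical.trans (h1 ▸ h) : I ≤ _)
  change X.fromSpecStalk x (genPrime hy) ∈ Z at h2
  rwa [fromSpecStalk_genPrime] at h2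

lemma idealOf_eq_top {Z : Set X} (hZ : IsClosed Z) {x : X} (hx : x ∉ Z) : idealOf Z x = ⊤ := by
  rw [← Ideal.radical_top]
  refine idealOf_eq_radical ⊤ fun y hy => ⟨fun h => (hx (hy.mem_closed hZ h)).elim, fun h => ?_⟩
  exact ((genPrime hy).2.ne_top (top_le_iff.mp h)).elim

/-- The prime of `f y'` is the contraction of the prime of `y'`, because maps of local rings reflect
units. The radical is needed for ramified maps and disappears for lines
(`IsFractionHom.isLocalEquation_preimage`). -/
lemma idealOf_preimage (f : Y ⟶ X) {Z : Set X} (hZ : IsClosed Z) (y : Y) :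
    idealOf (f ⁻¹' Z) y = ((idealOf Z (f y)).map (f.stalkMap y).hom).radical := by
  refine idealOf_eq_radical _ fun y' hy => ?_
  have hfy : f y' ⤳ f y := hy.map f.continuous
  rw [Set.mem_preimage, idealOf_le_iff hZ hfy, Ideal.map_le_iff_le_comap]
  have : (genPrime hfy).asIdeal = (genPrime hy).asIdeal.comap (f.stalkMap y).hom := by
    ext a
    change _ ∈ IsLocalRing.maximalIdeal _ ↔ _ ∈ IsLocalRing.maximalIdeal _
    have e := Scheme.Hom.stalkSpecializes_stalkMap_apply f y' y hy a
    rw [IsLocalRing.mem_maximalIdeal, IsLocalRing.mem_maximalIdeal, mem_nonunits_iff,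
      mem_nonunits_iff]
    refine not_congr ?_
    refine Iff.trans ?_ (iff_of_eq (congrArg IsUnit e))
    exact (isUnit_map_iff (f.stalkMap y').hom _).symm
  rw [this]

/-- A section that cuts out `Z` near `x` generates the ideal of `Z` up to radical. -/
lemma idealOf_eq_of_basicOpen {Z : Set X} {U : X.Opens} (s : Γ(X, U)) {x : X} (hx : x ∈ U)
    (h : ∀ y ∈ U, y ∈ Z ↔ y ∉ X.basicOpen s) :
    idealOf Z x = (Ideal.span {X.presheaf.germ U x hx s}).radical := by
  refine idealOf_eq_radical _ fun y hy => ?_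
  have hyU : y ∈ U := hy.mem_open U.2 hx
  rw [h y hyU, X.mem_basicOpen s y hyU, Ideal.span_le, Set.singleton_subset_iff]
  change _ ↔ X.presheaf.stalkSpecializes hy (X.presheaf.germ U x hx s) ∈ IsLocalRing.maximalIdeal _
  rw [TopCat.Presheaf.germ_stalkSpecializes_apply]
  rfl

lemma idealOf_eq_map {Z : Set X} (hZ : IsClosed Z) {x y : X} (hy : y ⤳ x) :
    idealOf Z y = ((idealOf Z x).map (X.presheaf.stalkSpecializes hy).hom).radical := by
  refine idealOf_eq_radical _ fun y' hy' => ?_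
  rw [idealOf_le_iff hZ (hy'.trans hy), Ideal.map_le_iff_le_comap]
  have : (genPrime (hy'.trans hy)).asIdeal =
      (genPrime hy').asIdeal.comap (X.presheaf.stalkSpecializes hy).hom := by
    ext a
    change X.presheaf.stalkSpecializes _ a ∈ IsLocalRing.maximalIdeal _ ↔
      X.presheaf.stalkSpecializes _ (X.presheaf.stalkSpecializes _ a) ∈ IsLocalRing.maximalIdeal _
    rw [TopCat.Presheaf.stalkSpecializes_comp_apply]
  rw [this]

lemma exists_germ_fraction {U : X.Opens} (hU : IsAffineOpen U) {x : X} (hx : x ∈ U)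
    (g : X.presheaf.stalk x) : ∃ a b : Γ(X, U), IsUnit (X.presheaf.germ U x hx b) ∧
      g * X.presheaf.germ U x hx b = X.presheaf.germ U x hx a := by
  let _ := X.presheaf.algebra_section_stalk ⟨x, hx⟩
  have := hU.isLocalization_stalk ⟨x, hx⟩
  obtain ⟨⟨a, b⟩, h⟩ := IsLocalization.surj (hU.primeIdealOf ⟨x, hx⟩).asIdeal.primeCompl g
  exact ⟨a, b, IsLocalization.map_units _ b, h⟩

end IdealOf

/-! ### Local equations on integral schemes. -/

section Integral

variable {X : Scheme.{0}} [IsIntegral X]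

lemma germ_injective {U : X.Opens} {x : X} (hx : x ∈ U) :
    Function.Injective (X.presheaf.germ U x hx) := by
  intro a b h
  refine toField_injective fun y hy => ?_
  rw [toField_eq a y x hy hx, toField_eq b y x hy hx, toField, h, toField]

lemma isFractionHom_germ {U : X.Opens} (hU : IsAffineOpen U) {x : X} (hx : x ∈ U) :
    IsFractionHom (X.presheaf.germ U x hx).hom :=
  ⟨germ_injective hx, exists_germ_fraction hU hx⟩

lemma isFractionHom_stalkSpecializes {x y : X} (hy : y ⤳ x) :
    IsFractionHom (X.presheaf.stalkSpecializes hy).hom := by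
  obtain ⟨_, ⟨U, hU, rfl⟩, hx, -⟩ :=
    X.isBasis_affineOpens.exists_subset_of_mem_open (Set.mem_univ x) isOpen_univ
  have hyU : y ∈ U := hy.mem_open U.2 hx
  have e : ∀ a, X.presheaf.stalkSpecializes hy (X.presheaf.germ U x hx a) =
      X.presheaf.germ U y hyU a := fun a => TopCat.Presheaf.germ_stalkSpecializes_apply ..
  constructor
  · rw [injective_iff_map_eq_zero]
    intro g hg
    obtain ⟨a, b, hb, h⟩ := exists_germ_fraction hU hx g
    have h1 := congrArg (X.presheaf.stalkSpecializes hy) h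
    rw [map_mul, e] at h1
    rw [show X.presheaf.stalkSpecializes hy g = 0 from hg, zero_mul, eq_comm, e,
      ← map_zero (X.presheaf.germ U y hyU).hom] at h1
    have h2 : a = 0 := germ_injective hyU h1
    rw [h2, map_zero] at h
    exact hb.mul_left_eq_zero.mp h
  · intro g
    obtain ⟨a, b, hb, h⟩ := exists_germ_fraction hU hyU g
    refine ⟨X.presheaf.germ U x hx a, X.presheaf.germ U x hx b, ?_, ?_⟩
    · exact (iff_of_eq (congrArg IsUnit (e b))).mpr hb
    · refine (congrArg (g * ·) (e b)).trans (h.trans (e a).symm)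

/-- Here `y` is the more general point: its local ring is a localisation, in which the extended
ideal remains radical. -/
lemma IsLocalEquation.specialize {Z : Set X} (hZ : IsClosed Z) {x y : X} (hy : y ⤳ x)
    {z : X.presheaf.stalk x} (h : IsLocalEquation Z x z) :
    IsLocalEquation Z y (X.presheaf.stalkSpecializes hy z) := by
  rw [IsLocalEquation, idealOf_eq_map hZ hy,
    ((isFractionHom_stalkSpecializes hy).isRadical_map (isRadical_idealOf Z x)).radical, ← h,
    Ideal.map_span, Set.image_singleton]

/-- Normal crossings are prescribed at closed points only. By compactness every point specialises to
a closed one, and an equation found there passes to the generization; off the divisor `1` is an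
equation. -/
lemma IsSNC.exists_isLocalEquation [CompactSpace X] {J : Type} {D : J → Set X} (hD : IsSNC D)
    (j : J) (x : X) : ∃ z, IsLocalEquation (D j) x z := by
  obtain ⟨x', hx', hc⟩ := (isClosed_closure (s := {x})).exists_closed_singleton ⟨x, subset_closure rfl⟩
  have hs : x ⤳ x' := specializes_iff_mem_closure.mpr hx'
  by_cases hj : x' ∈ D j
  · obtain ⟨n, z, a, -, -, h⟩ := hD.2 x' hc
    exact ⟨_, (h ⟨j, hj⟩).specialize (hD.1 j) hs⟩
  · refine ⟨1, ?_⟩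
    rw [IsLocalEquation, Ideal.span_singleton_one, idealOf_eq_top (hD.1 j)]
    exact fun h => hj (hs.mem_closed (hD.1 j) h)

/-- A single ideal of the coordinate ring induces the ideals at all points. This allows a local
equation to be spread out from one point. -/
lemma idealOf_eq_map_germ {Z : Set X} (hZ : IsClosed Z) {U : X.Opens} (hU : IsAffineOpen U) :
    ∃ J : Ideal Γ(X, U), ∀ (x : X) (hx : x ∈ U),
      idealOf Z x = J.map (X.presheaf.germ U x hx).hom := by
  have hc : IsClosed (hU.fromSpec ⁻¹' Z) := hZ.preimage hU.fromSpec.continuous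
  obtain ⟨I, hI⟩ := (PrimeSpectrum.isClosed_iff_zeroLocus_ideal _).mp hc
  refine ⟨I.radical, fun x hx => ?_⟩
  rw [← ((isFractionHom_germ hU hx).isRadical_map I.radical_isRadical).radical]
  refine idealOf_eq_radical _ fun y hy => ?_
  have hyU : y ∈ U := hy.mem_open U.2 hx
  have h1 : y ∈ Z ↔ hU.primeIdealOf ⟨y, hyU⟩ ∈ hU.fromSpec ⁻¹' Z := by
    change _ ↔ hU.fromSpec (hU.primeIdealOf ⟨y, hyU⟩) ∈ Z
    rw [hU.fromSpec_primeIdealOf ⟨y, hyU⟩]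
  have h2 : (hU.primeIdealOf ⟨y, hyU⟩).asIdeal =
      (genPrime hy).asIdeal.comap (X.presheaf.germ U x hx).hom := by
    rw [hU.primeIdealOf_eq_map_closedPoint]
    ext a
    change X.presheaf.germ U y hyU a ∈ IsLocalRing.maximalIdeal _ ↔
      X.presheaf.stalkSpecializes _ (X.presheaf.germ U x hx a) ∈ IsLocalRing.maximalIdeal _
    rw [TopCat.Presheaf.germ_stalkSpecializes_apply]
  rw [h1, hI, Ideal.map_le_iff_le_comap, ← h2, (hU.primeIdealOf _).2.isRadical.radical_le_iff]
  rfl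

/-- A local equation at a point is a local equation in a neighbourhood. -/
lemma IsLocalEquation.exists_section [IsLocallyNoetherian X] {Z : Set X} (hZ : IsClosed Z) {x : X}
    {z : X.presheaf.stalk x} (h : IsLocalEquation Z x z) :
    ∃ (U : X.Opens) (hx : x ∈ U) (s : Γ(X, U)), X.presheaf.germ U x hx s = z ∧
      ∀ (y : X) (hy : y ∈ U), IsLocalEquation Z y (X.presheaf.germ U y hy s) := by
  obtain ⟨V, hxV, s, rfl⟩ := X.presheaf.exists_germ_eq z
  obtain ⟨_, ⟨U, hU, rfl⟩, hxU, hUV⟩ := X.isBasis_affineOpens.exists_subset_of_mem_open hxV V.2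
  let s' : Γ(X, U) := X.presheaf.map (homOfLE hUV).op s
  have hs' : X.presheaf.germ U x hxU s' = X.presheaf.germ V x hxV s :=
    X.presheaf.germ_res_apply ..
  obtain ⟨J, hJ⟩ := idealOf_eq_map_germ hZ hU
  have : IsNoetherianRing Γ(X, U) := IsLocallyNoetherian.component_noetherian ⟨U, hU⟩
  let _ := X.presheaf.algebra_section_stalk ⟨x, hxU⟩
  have hloc := hU.isLocalization_stalk ⟨x, hxU⟩
  -- By noetherianity one denominator `m` compares `J` with the ideal of `s'`. Where `m` is
  -- invertible the two ideals agree at every point.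
  obtain ⟨m, hm, h1, h2⟩ := exists_mul_mem_span (φ := (X.presheaf.germ U x hxU).hom)
    (IsNoetherian.noetherian J) hloc (s := s') (by
      rw [← hJ x hxU, ← h]
      exact congrArg (fun a => Ideal.span {a}) hs'.symm)
  have hxm : x ∈ X.basicOpen m := (X.mem_basicOpen m x hxU).mpr (IsLocalization.map_units
    (M := (hU.primeIdealOf ⟨x, hxU⟩).asIdeal.primeCompl) (X.presheaf.stalk x) ⟨m, hm⟩)
  refine ⟨X.basicOpen m, hxm, X.presheaf.map (homOfLE (X.basicOpen_le m)).op s',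
    (X.presheaf.germ_res_apply ..).trans hs', fun y hy => ?_⟩
  have hyU := X.basicOpen_le m hy
  have hu : IsUnit (X.presheaf.germ U y hyU m) := (X.mem_basicOpen m y hyU).mp hy
  rw [IsLocalEquation, X.presheaf.germ_res_apply, hJ y hyU]
  refine le_antisymm ?_ ?_
  · rw [Ideal.span_singleton_le_iff_mem]
    have := Ideal.mem_map_of_mem (X.presheaf.germ U y hyU).hom h1
    rw [map_mul] at this
    exact (Ideal.unit_mul_mem_iff_mem _ hu).mp this
  · rw [Ideal.map_le_iff_le_comap]
    intro a ha
    obtain ⟨b, hb⟩ := Ideal.mem_span_singleton.mp (h2 a ha)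
    rw [Ideal.mem_comap, ← Ideal.unit_mul_mem_iff_mem _ hu]
    refine Ideal.mem_span_singleton.mpr ⟨X.presheaf.germ U y hyU b, ?_⟩
    have := congrArg (X.presheaf.germ U y hyU) hb
    rw [map_mul, map_mul] at this
    exact this

end Integral

/-! ### Sections along morphisms from and to spectra. -/

section SpecPull

variable {X P : Scheme.{0}} {R R' : CommRingCat.{0}}

/-- The pull-back of sections along a morphism from an affine scheme. -/
def specPull (j : Spec R ⟶ P) (W : P.Opens) (h : ⊤ ≤ j ⁻¹ᵁ W) : Γ(P, W) ⟶ R :=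
  j.appLE W ⊤ h ≫ (Scheme.ΓSpecIso R).hom

lemma specPull_res (j : Spec R ⟶ P) {W W' : P.Opens} (h : ⊤ ≤ j ⁻¹ᵁ W) (i : W ≤ W') :
    P.presheaf.map (homOfLE i).op ≫ specPull j W h = specPull j W' (fun _ hx => i (h hx)) := by
  rw [specPull, ← Category.assoc, Scheme.Hom.map_appLE]
  rfl

lemma specPull_comp (j : Spec R ⟶ P) (f : P ⟶ X) (U : X.Opens) (h : ⊤ ≤ (j ≫ f) ⁻¹ᵁ U) :
    specPull (j ≫ f) U h = f.app U ≫ specPull j (f ⁻¹ᵁ U) h := by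
  rw [specPull, Scheme.Hom.comp_appLE, Category.assoc]
  rfl

lemma specPull_specMap_comp (φ : R ⟶ R') (j : Spec R ⟶ P) (U : P.Opens) (h : ⊤ ≤ j ⁻¹ᵁ U)
    (h' : ⊤ ≤ (Spec.map φ ≫ j) ⁻¹ᵁ U) : specPull (Spec.map φ ≫ j) U h' = specPull j U h ≫ φ := by
  unfold specPull
  rw [Category.assoc, ← Scheme.ΓSpecIso_naturality, ← Category.assoc,
    Scheme.Hom.appTop, Scheme.Hom.app_eq_appLE]
  exact congrArg (· ≫ _) (Scheme.Hom.appLE_comp_appLE ..).symm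

lemma specPull_fromSpec {U : P.Opens} (hU : IsAffineOpen U) :
    specPull hU.fromSpec U hU.fromSpec_preimage_self.ge = 𝟙 _ := by
  rw [specPull, Scheme.Hom.appLE, hU.fromSpec_app_self, Category.assoc, Category.assoc,
    ← Functor.map_comp_assoc]
  have : (eqToHom hU.fromSpec_preimage_self).op ≫
    (homOfLE hU.fromSpec_preimage_self.ge).op = 𝟙 _ := rfl
  rw [this]
  simp

lemma specPull_bijective (j : Spec R ⟶ P) [IsOpenImmersion j] {W : P.Opens}
    (hW : W = j.opensRange) (h : ⊤ ≤ j ⁻¹ᵁ W) : Function.Bijective (specPull j W h) := by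
  have h1 : IsIso (j.app W) := j.isIso_app W hW.le
  have h2 : IsIso (j.appLE W ⊤ h) := by
    have : j ⁻¹ᵁ W = ⊤ := top_le_iff.mp h
    rw [Scheme.Hom.appLE]
    have : IsIso (homOfLE h) := ⟨homOfLE le_top, rfl, rfl⟩
    infer_instance
  have h3 : IsIso (specPull j W h) := by
    rw [specPull]; infer_instance
  exact ConcreteCategory.bijective_of_isIso _

lemma le_preimage_top (F : P ⟶ X) (W : P.Opens) : W ≤ F ⁻¹ᵁ ⊤ := fun _ _ => trivial

/-- The pull-back of an element of a ring along a morphism to its spectrum. -/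
def specSection (F : P ⟶ Spec R) (W : P.Opens) (s : R) : Γ(P, W) :=
  F.appLE ⊤ W (le_preimage_top F W) ((Scheme.ΓSpecIso R).inv s)

lemma specPull_specSection (j : Spec R' ⟶ P) (F : P ⟶ Spec R) (φ : R ⟶ R')
    (hj : j ≫ F = Spec.map φ) (W : P.Opens) (h : ⊤ ≤ j ⁻¹ᵁ W) (s : R) :
    specPull j W h (specSection F W s) = φ s := by
  have h1 : F.appLE ⊤ W (le_preimage_top F W) ≫ j.appLE W ⊤ h = (Spec.map φ).appTop := by
    rw [Scheme.Hom.appLE_comp_appLE, Scheme.Hom.appTop, Scheme.Hom.app_eq_appLE]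
    simp only [hj]
    rfl
  have h2 : (Scheme.ΓSpecIso R).inv ≫ F.appLE ⊤ W (le_preimage_top F W) ≫ specPull j W h = φ := by
    rw [specPull, ← Category.assoc (F.appLE _ _ _), h1, Scheme.ΓSpecIso_naturality,
      Iso.inv_hom_id_assoc]
  exact ConcreteCategory.congr_hom h2 s

lemma mem_basicOpen_specSection (F : P ⟶ Spec R) (W : P.Opens) (s : R) {x : P} (hx : x ∈ W) :
    x ∈ P.basicOpen (specSection F W s) ↔ s ∉ PrimeSpectrum.asIdeal (R := R) (F x) := by
  rw [specSection, Scheme.basicOpen_appLE, basicOpen_eq_of_affine]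
  exact and_iff_right hx

end SpecPull

/-! ### Affine lines, their base change and their local rings. -/

section AffineLine

variable {X P : Scheme.{0}}

/-- Over the affine open set `U`, the morphism `f` is an affine line with coordinate `t`. -/
structure IsAffineLine (f : P ⟶ X) (U : X.Opens) (t : Γ(P, f ⁻¹ᵁ U)) : Prop where
  affine : IsAffineOpen U
  affine_preimage : IsAffineOpen (f ⁻¹ᵁ U)
  bijective : Function.Bijective (Polynomial.eval₂RingHom (f.app U).hom t)

/-- Affine lines are stable under base change. -/
lemma IsAffineLine.baseChange {S₂ Y : Scheme.{0}} {f : P ⟶ X} {U : X.Opens} {t : Γ(P, f ⁻¹ᵁ U)}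
    (ht : IsAffineLine f U t) {q : Y ⟶ P} {π : Y ⟶ S₂} {σ : S₂ ⟶ X} (H : IsPullback q π f σ)
    {V : S₂.Opens} (hV : IsAffineOpen V) (hVU : V ≤ σ ⁻¹ᵁ U) (hle : π ⁻¹ᵁ V ≤ q ⁻¹ᵁ (f ⁻¹ᵁ U)) :
    IsAffineLine π V (q.appLE (f ⁻¹ᵁ U) (π ⁻¹ᵁ V) hle t) := by
  have hW : π ⁻¹ᵁ V = q ⁻¹ᵁ (f ⁻¹ᵁ U) ⊓ π ⁻¹ᵁ V := (inf_eq_right.mpr hle).symm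
  have haff : IsAffineOpen (π ⁻¹ᵁ V) := by
    have : IsAffine _ := ht.affine
    have : IsAffine _ := hV
    have : IsAffine _ := ht.affine_preimage
    exact .of_isIso (Scheme.Hom.isPullback_resLE H hVU le_rfl hW).isoPullback.hom
  -- All three open sets are affine, so the sections over the fibre product are the tensor product,
  -- that is, the pushout of rings.
  have hpo := (isIso_pushoutSection_iff H hVU le_rfl hW).mp
    (isIso_pushoutSection_of_isAffineOpen H hVU le_rfl hW ht.affine hV ht.affine_preimage)
  refine ⟨hV, haff, ?_⟩
  set Φ := Polynomial.eval₂RingHom (π.app V).hom (q.appLE (f ⁻¹ᵁ U) (π ⁻¹ᵁ V) hle t)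
  let e := RingEquiv.ofBijective (Polynomial.eval₂RingHom (f.app U).hom t) ht.bijective
  have he : ∀ a, e.symm ((f.app U).hom a) = Polynomial.C a := fun a => by
    rw [RingEquiv.symm_apply_eq]; simp [e]
  have he' : e.symm t = Polynomial.X := by
    rw [RingEquiv.symm_apply_eq]; simp [e]
  let g₁ : Γ(P, f ⁻¹ᵁ U) ⟶ CommRingCat.of (Polynomial Γ(S₂, V)) :=
    CommRingCat.ofHom ((Polynomial.mapRingHom (σ.appLE U V hVU).hom).comp e.symm.toRingHom)
  let g₂ : Γ(S₂, V) ⟶ CommRingCat.of (Polynomial Γ(S₂, V)) := CommRingCat.ofHom Polynomial.C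
  have hg : f.appLE U (f ⁻¹ᵁ U) le_rfl ≫ g₁ = σ.appLE U V hVU ≫ g₂ := by
    rw [Scheme.Hom.appLE_eq_app]
    refine CommRingCat.hom_ext (RingHom.ext fun a => ?_)
    change Polynomial.map _ (e.symm ((f.app U).hom a)) =
      (Polynomial.C ((σ.appLE U V hVU).hom a) : Polynomial Γ(S₂, V))
    rw [he, Polynomial.map_C]
  -- The inverse of `Φ`, from the universal property: the sections of the old line map through its
  -- polynomial ring, and those of `V` map to constants.
  let Ψ := hpo.desc g₁ g₂ hg
  have h1 : q.appLE (f ⁻¹ᵁ U) (π ⁻¹ᵁ V) hle ≫ Ψ = g₁ := hpo.inl_desc _ _ _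
  have h2 : π.appLE V (π ⁻¹ᵁ V) le_rfl ≫ Ψ = g₂ := hpo.inr_desc _ _ _
  have hl : ∀ p, Ψ (Φ p) = p := by
    have : Ψ.hom.comp Φ = RingHom.id _ := by
      refine Polynomial.ringHom_ext (fun a => ?_) ?_
      · have := ConcreteCategory.congr_hom h2 a
        rw [Scheme.Hom.appLE_eq_app] at this
        change _ = Polynomial.C a at this
        simpa [Φ] using this
      · have := ConcreteCategory.congr_hom h1 t
        have h3 : g₁ t = Polynomial.X := by
          change Polynomial.map _ (e.symm t) = _
          rw [he', Polynomial.map_X]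
        rw [h3] at this
        simpa [Φ] using this
    exact fun p => RingHom.congr_fun this p
  have hr : Ψ ≫ CommRingCat.ofHom Φ = 𝟙 _ := by
    refine hpo.hom_ext ?_ ?_
    · rw [← Category.assoc, h1, Category.comp_id]
      refine CommRingCat.hom_ext (RingHom.ext fun b => ?_)
      obtain ⟨p, rfl⟩ := e.surjective b
      change Φ (Polynomial.map _ (e.symm (e p))) = _
      rw [RingEquiv.symm_apply_apply]
      have : (Φ.comp (Polynomial.mapRingHom (σ.appLE U V hVU).hom)) =
          (q.appLE (f ⁻¹ᵁ U) (π ⁻¹ᵁ V) hle).hom.comp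
            (Polynomial.eval₂RingHom (f.app U).hom t) := by
        refine Polynomial.ringHom_ext (fun a => ?_) ?_
        · have := ConcreteCategory.congr_hom (hpo.w) a
          rw [Scheme.Hom.appLE_eq_app, Scheme.Hom.appLE_eq_app] at this
          simpa [Φ] using this.symm
        · simp [Φ]
      exact RingHom.congr_fun this p
    · rw [← Category.assoc, h2, Category.comp_id, Scheme.Hom.appLE_eq_app]
      refine CommRingCat.hom_ext (RingHom.ext fun a => ?_)
      change Φ (Polynomial.C a) = _
      simp [Φ]
  exact ⟨fun a b hab => by rw [← hl a, ← hl b, hab],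
    fun b => ⟨Ψ b, ConcreteCategory.congr_hom hr b⟩⟩

/-- The homomorphism from the polynomial ring over a local ring of the base of an affine line. -/
def lineHom (f : P ⟶ X) (y : P) (t : P.presheaf.stalk y) :
    Polynomial (X.presheaf.stalk (f y)) →+* P.presheaf.stalk y :=
  Polynomial.eval₂RingHom (f.stalkMap y).hom t

lemma lineHom_C (f : P ⟶ X) (y : P) (t : P.presheaf.stalk y) (a : X.presheaf.stalk (f y)) :
    lineHom f y t (Polynomial.C a) = f.stalkMap y a := Polynomial.eval₂_C _ _

lemma lineHom_X (f : P ⟶ X) (y : P) (t : P.presheaf.stalk y) :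
    lineHom f y t Polynomial.X = t := Polynomial.eval₂_X _ _

lemma lineHom_map_germ (f : P ⟶ X) {U : X.Opens} (t : Γ(P, f ⁻¹ᵁ U)) {y : P} (hy : f y ∈ U)
    (p : Polynomial Γ(X, U)) :
    lineHom f y (P.presheaf.germ (f ⁻¹ᵁ U) y hy t) (p.map (X.presheaf.germ U (f y) hy).hom) =
      P.presheaf.germ (f ⁻¹ᵁ U) y hy (Polynomial.eval₂RingHom (f.app U).hom t p) := by
  have : (lineHom f y (P.presheaf.germ (f ⁻¹ᵁ U) y hy t)).comp
      (Polynomial.mapRingHom (X.presheaf.germ U (f y) hy).hom) =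
      (P.presheaf.germ (f ⁻¹ᵁ U) y hy).hom.comp (Polynomial.eval₂RingHom (f.app U).hom t) := by
    refine Polynomial.ringHom_ext (fun a => ?_) ?_
    · simp only [RingHom.comp_apply, Polynomial.coe_mapRingHom, Polynomial.map_C, lineHom_C,
        Polynomial.coe_eval₂RingHom, Polynomial.eval₂_C]
      exact Scheme.Hom.germ_stalkMap_apply f U y hy a
    · simp only [RingHom.comp_apply, Polynomial.coe_mapRingHom, Polynomial.map_X, lineHom_X,
        Polynomial.coe_eval₂RingHom, Polynomial.eval₂_X]
  exact RingHom.congr_fun this p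

/-- For injectivity, clear the denominators of a polynomial over the local ring and use that `t` is
free over the sections on `U`. Germs upstairs are fractions of sections over the affine preimage,
and these are polynomials in `t`. -/
lemma IsAffineLine.isFractionHom [IsIntegral P] {f : P ⟶ X} {U : X.Opens} {t : Γ(P, f ⁻¹ᵁ U)}
    (ht : IsAffineLine f U t) {y : P} (hy : f y ∈ U) :
    IsFractionHom (lineHom f y (P.presheaf.germ (f ⁻¹ᵁ U) y hy t)) := by
  constructor
  · rw [injective_iff_map_eq_zero]
    intro p hp
    let _ := X.presheaf.algebra_section_stalk ⟨f y, hy⟩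
    have hloc := ht.affine.isLocalization_stalk ⟨f y, hy⟩
    obtain ⟨b, hbm, hb⟩ := IsLocalization.integerNormalization_spec
      (ht.affine.primeIdealOf ⟨f y, hy⟩).asIdeal.primeCompl p
    set p' := IsLocalization.integerNormalization
      (ht.affine.primeIdealOf ⟨f y, hy⟩).asIdeal.primeCompl p
    have hb' : p'.map (X.presheaf.germ U (f y) hy).hom =
        Polynomial.C (X.presheaf.germ U (f y) hy b) * p := by
      refine hb.trans ?_
      rw [Algebra.smul_def]
      rfl
    have h1 := lineHom_map_germ f t hy p'
    rw [hb', map_mul, hp, mul_zero, eq_comm, ← map_zero (P.presheaf.germ (f ⁻¹ᵁ U) y hy).hom] at h1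
    have h2 := germ_injective (X := P) (U := f ⁻¹ᵁ U) (x := y) hy h1
    have h3 : p' = 0 := (injective_iff_map_eq_zero _).mp ht.bijective.1 p' h2
    rw [h3, Polynomial.map_zero, eq_comm] at hb'
    have hu : IsUnit (X.presheaf.germ U (f y) hy b) := IsLocalization.map_units
      (M := (ht.affine.primeIdealOf ⟨f y, hy⟩).asIdeal.primeCompl) (X.presheaf.stalk (f y)) ⟨b, hbm⟩
    exact (hu.map Polynomial.C).mul_right_eq_zero.mp hb'
  · intro g
    obtain ⟨a, b, hb, h⟩ := exists_germ_fraction ht.affine_preimage hy g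
    obtain ⟨a, rfl⟩ := ht.bijective.2 a
    obtain ⟨b, rfl⟩ := ht.bijective.2 b
    refine ⟨a.map (X.presheaf.germ U (f y) hy).hom, b.map (X.presheaf.germ U (f y) hy).hom, ?_, ?_⟩
    · rwa [lineHom_map_germ]
    · rw [lineHom_map_germ, lineHom_map_germ]
      exact h

/-- Adjoining a variable and localising both preserve radical ideals, so the preimage of a divisor
under a line stays reduced. -/
lemma IsFractionHom.isLocalEquation_preimage {f : P ⟶ X} {y : P} {t : P.presheaf.stalk y}
    (ht : IsFractionHom (lineHom f y t)) {Z : Set X} (hZ : IsClosed Z)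
    {z : X.presheaf.stalk (f y)} (hz : IsLocalEquation Z (f y) z) :
    IsLocalEquation (f ⁻¹' Z) y (f.stalkMap y z) := by
  have h1 := ht.isRadical_map (isRadical_map_C (isRadical_idealOf Z (f y)))
  have h2 : ((idealOf Z (f y)).map Polynomial.C).map (lineHom f y t) =
      (idealOf Z (f y)).map (f.stalkMap y).hom := by
    rw [Ideal.map_map]
    congr 1
    exact RingHom.ext fun a => lineHom_C ..
  rw [h2] at h1
  rw [IsLocalEquation, idealOf_preimage f hZ, h1.radical, ← hz, Ideal.map_span,
    Set.image_singleton]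

lemma IsFractionHom.isRadical_span {f : P ⟶ X} [IsIntegral X] {y : P} {t : P.presheaf.stalk y}
    (ht : IsFractionHom (lineHom f y t)) : (Ideal.span {t}).IsRadical := by
  have h1 := ht.isRadical_map isRadical_span_X
  rwa [Ideal.map_span, Set.image_singleton, lineHom_X] at h1

end AffineLine

/-! ### Affine charts of the total space of a line bundle. -/

namespace CartierDivisor

variable {X : Scheme.{0}} [IsIntegral X] (L : CartierDivisor X)

/-- An affine open set as an object of the affine Zariski site. -/
abbrev _root_.LogCone.affineSite {X : Scheme.{0}} {U : X.Opens} (hU : IsAffineOpen U) :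
    X.AffineZariskiSite := ⟨U, hU⟩

/-- The inclusion of the part of the line bundle over an affine open set. -/
def chart {U : X.Opens} (hU : IsAffineOpen U) :
    Spec (CommRingCat.of (L.symAlg U)) ⟶ L.totalSpace :=
  Limits.colimit.ι L.totalGluing.functor (affineSite hU)

instance {U : X.Opens} (hU : IsAffineOpen U) : IsOpenImmersion (L.chart hU) :=
  L.totalGluing.cover.map_prop (affineSite hU)

lemma opensRange_chart {U : X.Opens} (hU : IsAffineOpen U) :
    L.proj ⁻¹ᵁ U = (L.chart hU).opensRange := by
  have h := L.totalGluing.toBase_preimage_eq_opensRange_ι (affineSite hU)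
  have h' : ((Scheme.AffineZariskiSite.directedCover X).f (affineSite hU)).opensRange = U :=
    Scheme.Opens.opensRange_ι U
  rw [h'] at h
  exact h

lemma top_le_chart {U : X.Opens} (hU : IsAffineOpen U) :
    ⊤ ≤ L.chart hU ⁻¹ᵁ (L.proj ⁻¹ᵁ U) := by
  rw [L.opensRange_chart hU, Scheme.Hom.preimage_opensRange]

/-- The sections of the structure sheaf of the line bundle over an affine open set. -/
def chartHom {U : X.Opens} (hU : IsAffineOpen U) : Γ(L.totalSpace, L.proj ⁻¹ᵁ U) →+* L.symAlg U :=
  (specPull (L.chart hU) (L.proj ⁻¹ᵁ U) (L.top_le_chart hU)).hom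

lemma chartHom_bijective {U : X.Opens} (hU : IsAffineOpen U) : Function.Bijective (L.chartHom hU) :=
  specPull_bijective _ (L.opensRange_chart hU) _

lemma chartHom_app {U : X.Opens} (hU : IsAffineOpen U) (a : Γ(X, U)) :
    L.chartHom hU (L.proj.app U a) = L.symAlgC U a := by
  have h1 : L.chart hU ≫ L.proj = Spec.map (CommRingCat.ofHom (L.symAlgC U)) ≫ hU.fromSpec :=
    L.ι_proj ⟨U, hU⟩
  have h2 : specPull (L.chart hU ≫ L.proj) U (L.top_le_chart hU) =
      CommRingCat.ofHom (L.symAlgC U) := by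
    have := specPull_specMap_comp (CommRingCat.ofHom (L.symAlgC U)) hU.fromSpec U
      hU.fromSpec_preimage_self.ge (by rw [← h1]; exact L.top_le_chart hU)
    rw [specPull_fromSpec, Category.id_comp] at this
    rw [← this]
    congr 1
  have h3 := specPull_comp (L.chart hU) L.proj U (L.top_le_chart hU)
  rw [h2] at h3
  replace h2 := h3.symm
  exact ConcreteCategory.congr_hom h2 a

lemma specMap_chart {U V : X.Opens} (hU : IsAffineOpen U) (hV : IsAffineOpen V)
    (f : Γ(X, V)) (h : U = X.basicOpen f) (hUV : U ≤ V) :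
    Spec.map (CommRingCat.ofHom (L.symAlgRes hUV)) ≫ L.chart hV = L.chart hU := by
  let i : affineSite hU ⟶ affineSite hV :=
    homOfLE (X := X.AffineZariskiSite) (Exists.intro f h.symm)
  exact Limits.colimit.w L.totalGluing.functor i

end CartierDivisor

/-! ### The fibre coordinate, and the zero section as the fibre over the vertex. -/

namespace CartierDivisor

section Coordinate

variable {X : Scheme.{0}} [IsIntegral X] (L : CartierDivisor X)

/-- The fibre coordinate as a section of the structure sheaf of the line bundle. -/
def coordSection {U : X.Opens} (hU : IsAffineOpen U) {i : L.ι} (h : U ≤ L.U i) :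
    Γ(L.totalSpace, L.proj ⁻¹ᵁ U) :=
  (RingEquiv.ofBijective _ (L.chartHom_bijective hU)).symm (L.coord h)

lemma chartHom_coordSection {U : X.Opens} (hU : IsAffineOpen U) {i : L.ι} (h : U ≤ L.U i) :
    L.chartHom hU (L.coordSection hU h) = L.coord h :=
  (RingEquiv.ofBijective _ (L.chartHom_bijective hU)).apply_symm_apply _

lemma chartHom_eval₂ {U : X.Opens} (hU : IsAffineOpen U) {i : L.ι} (h : U ≤ L.U i)
    (p : Polynomial Γ(X, U)) :
    L.chartHom hU (Polynomial.eval₂RingHom (L.proj.app U).hom (L.coordSection hU h) p) =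
      L.fromPoly h p := by
  have : (L.chartHom hU).comp (Polynomial.eval₂RingHom (L.proj.app U).hom (L.coordSection hU h)) =
      L.fromPoly h := by
    refine Polynomial.ringHom_ext (fun a => ?_) ?_
    · simp only [RingHom.comp_apply, fromPoly, Polynomial.coe_eval₂RingHom, Polynomial.eval₂_C]
      exact L.chartHom_app hU a
    · simp only [RingHom.comp_apply, fromPoly, Polynomial.coe_eval₂RingHom, Polynomial.eval₂_X]
      exact L.chartHom_coordSection hU h
  exact RingHom.congr_fun this p

lemma isAffineLine {U : X.Opens} (hU : IsAffineOpen U) {i : L.ι} (h : U ≤ L.U i) (y : U) :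
    IsAffineLine L.proj U (L.coordSection hU h) := by
  refine ⟨hU, ?_, ?_⟩
  · rw [L.opensRange_chart hU]
    exact isAffineOpen_opensRange _
  · have h1 : Function.Bijective (L.chartHom hU ∘
        Polynomial.eval₂RingHom (L.proj.app U).hom (L.coordSection hU h)) := by
      have : L.chartHom hU ∘ Polynomial.eval₂RingHom (L.proj.app U).hom (L.coordSection hU h) =
          L.fromPoly h := funext fun p => L.chartHom_eval₂ hU h p
      rw [this]
      exact L.fromPoly_bijective h y
    exact (Function.Bijective.of_comp_iff' (L.chartHom_bijective hU) _).mp h1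

lemma chartHom_res {U V : X.Opens} (hU : IsAffineOpen U) (hV : IsAffineOpen V) (f : Γ(X, V))
    (h : U = X.basicOpen f) (hUV : U ≤ V) (hUV' : L.proj ⁻¹ᵁ U ≤ L.proj ⁻¹ᵁ V)
    (a : Γ(L.totalSpace, L.proj ⁻¹ᵁ V)) :
    L.chartHom hU (L.totalSpace.presheaf.map (homOfLE hUV').op a) =
      L.symAlgRes hUV (L.chartHom hV a) := by
  have h1 := L.specMap_chart hU hV f h hUV
  have h2 := specPull_specMap_comp (CommRingCat.ofHom (L.symAlgRes hUV)) (L.chart hV)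
    (L.proj ⁻¹ᵁ V) (L.top_le_chart hV)
  rw [h1] at h2
  have h3 := h2 ((L.top_le_chart hU).trans fun _ hx => hUV' hx)
  rw [← specPull_res (L.chart hU) (L.top_le_chart hU) hUV'] at h3
  exact ConcreteCategory.congr_hom h3 a

instance : IsDominant L.proj := inferInstance

variable [IsIntegral L.totalSpace]

/-- In the section ring the coordinate over `L.U i` is the variable divided by `f i`. So its product
with `f i` is the variable itself in every chart. -/
lemma exists_fiberCoord : ∃ T : L.totalSpace.functionField, ∀ (U : X.Opens) (hU : IsAffineOpen U)
    (i : L.ι) (h : U ≤ L.U i) (τ : L.totalSpace) (hτ : τ ∈ L.proj ⁻¹ᵁ U),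
    fieldMap L.proj (L.f i) * toField (L.coordSection hU h) τ hτ = T := by
  have key : ∀ (U : X.Opens) (hU : IsAffineOpen U) (i : L.ι) (h : U ≤ L.U i) (τ : L.totalSpace)
      (hτ : τ ∈ L.proj ⁻¹ᵁ U) (U' : X.Opens) (hU' : IsAffineOpen U') (i' : L.ι) (h' : U' ≤ L.U i')
      (τ' : L.totalSpace) (hτ' : τ' ∈ L.proj ⁻¹ᵁ U'),
      fieldMap L.proj (L.f i) * toField (L.coordSection hU h) τ hτ =
        fieldMap L.proj (L.f i') * toField (L.coordSection hU' h') τ' hτ' := by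
    intro U hU i h τ hτ U' hU' i' h' τ' hτ'
    have hg := genericPoint_mem (X := L.totalSpace) hτ
    have hg' := genericPoint_mem (X := L.totalSpace) hτ'
    rw [toField_eq _ τ _ hτ hg, toField_eq _ τ' _ hτ' hg']
    -- The gluing relates an affine set to its basic open subsets, so the two charts are compared on
    -- a set that is basic in both.
    obtain ⟨a, b, hab, hx⟩ := exists_basicOpen_le_affine_inter hU hU'
      (L.proj (genericPoint L.totalSpace)) ⟨hg, hg'⟩
    have hW : IsAffineOpen (X.basicOpen a) := hU.basicOpen a
    have hWU := X.basicOpen_le a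
    have hWU' : X.basicOpen a ≤ U' := hab ▸ X.basicOpen_le b
    -- The quotient of the equations as a regular function; the coordinates then satisfy `t' = u *
    -- t`.
    obtain ⟨u, hu⟩ := exists_section (X.basicOpen a) (L.f i * (L.f i')⁻¹ : X.functionFieldˣ).1
      fun x hxa => by
        obtain ⟨u, hu⟩ := L.cocycle i i'
        have := hu x ⟨h (hWU hxa), h' (hWU' hxa)⟩
        rw [Units.val_mul, ← this, mul_assoc, Units.mul_inv, mul_one]
        exact isRegularAt_toField u.1 x x _ ⟨h (hWU hxa), h' (hWU' hxa)⟩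
    have hTU : L.proj ⁻¹ᵁ X.basicOpen a ≤ L.proj ⁻¹ᵁ U := fun _ hx => hWU hx
    have hTU' : L.proj ⁻¹ᵁ X.basicOpen a ≤ L.proj ⁻¹ᵁ U' := fun _ hx => hWU' hx
    have e1 : L.totalSpace.presheaf.map (homOfLE hTU').op (L.coordSection hU' h') =
        L.proj.app (X.basicOpen a) u *
          L.totalSpace.presheaf.map (homOfLE hTU).op (L.coordSection hU h) := by
      refine (L.chartHom_bijective hW).1 ?_
      rw [map_mul, L.chartHom_app, L.chartHom_res hW hU a rfl hWU hTU,
        L.chartHom_res hW hU' b hab hWU' hTU', L.chartHom_coordSection, L.chartHom_coordSection]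
      refine L.symAlg_ext ⟨_, hx⟩ ?_
      change Polynomial.C ((L.f i')⁻¹ : X.functionFieldˣ).1 * Polynomial.X =
        Polynomial.C (toField u _ hx) * (Polynomial.C ((L.f i)⁻¹ : X.functionFieldˣ).1 * Polynomial.X)
      rw [hu, ← mul_assoc, ← Polynomial.C_mul, ← Units.val_mul]
      congr 3
      rw [mul_right_comm, mul_inv_cancel, one_mul]
    have e2 : toField (L.coordSection hU' h') (genericPoint L.totalSpace) hg' =
        fieldMap L.proj (toField u _ hx) *
          toField (L.coordSection hU h) (genericPoint L.totalSpace) hg := by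
      refine (toField_res (homOfLE hTU') _ _ hx).symm.trans ?_
      rw [e1]
      refine (toField_mul (U := L.proj ⁻¹ᵁ X.basicOpen a) _ _ _ hx).trans ?_
      exact congrArg₂ (· * ·) (fieldMap_toField L.proj u _ hx).symm
        (toField_res (homOfLE hTU) _ _ hx)
    rw [e2, hu, ← mul_assoc, ← map_mul, ← Units.val_mul]
    congr 3
    rw [mul_comm, inv_mul_cancel_right]
  obtain ⟨i, hi⟩ := L.exists_mem (L.proj (genericPoint L.totalSpace))
  obtain ⟨_, ⟨V, hV, rfl⟩, hxV, hVU⟩ :=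
    X.isBasis_affineOpens.exists_subset_of_mem_open hi (L.U i).2
  exact ⟨_, fun U hU i' h τ hτ => key U hU i' h τ hτ V hV i hVU (genericPoint L.totalSpace) hxV⟩

/-- The tautological rational function on the line bundle. -/
def fiberCoord : L.totalSpace.functionField := L.exists_fiberCoord.choose

lemma fieldMap_mul_coordSection {U : X.Opens} (hU : IsAffineOpen U) {i : L.ι} (h : U ≤ L.U i)
    (τ : L.totalSpace) (hτ : τ ∈ L.proj ⁻¹ᵁ U) :
    fieldMap L.proj (L.f i) * toField (L.coordSection hU h) τ hτ = L.fiberCoord :=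
  L.exists_fiberCoord.choose_spec U hU i h τ hτ

end Coordinate

section Exceptional

variable {S S₁ : Scheme.{0}} [IsIntegral S] [IsIntegral S₁]

/-- The pull-back to the line bundle of a function on the cone. -/
def coneSection (L : CartierDivisor S) (μ : S₁ ⟶ S) [IsDominant μ] (U : S₁.Opens)
    (s : L.sectionRing ⊤) : Γ((L.pullback μ).totalSpace, (L.pullback μ).proj ⁻¹ᵁ U) :=
  specSection (R := CommRingCat.of (L.sectionRing ⊤)) (L.resToCone μ) _ s

variable (L : CartierDivisor S) (μ : S₁ ⟶ S) [IsDominant μ]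

lemma chartHom_coneSection {U : S₁.Opens} (hU : IsAffineOpen U) (s : L.sectionRing ⊤) :
    (L.pullback μ).chartHom hU (L.coneSection μ U s) = (L.pullback μ).symAlgRes (le_top : U ≤ ⊤)
      ((L.pullback μ).toSymAlg ⊤ (L.pullSections μ s)) := by
  refine specPull_specSection (R := CommRingCat.of (L.sectionRing ⊤)) ((L.pullback μ).chart hU)
    (L.resToCone μ) (CommRingCat.ofHom (L.pullSections μ) ≫ CommRingCat.ofHom
      (((L.pullback μ).symAlgRes (le_top : U ≤ ⊤)).comp ((L.pullback μ).toSymAlg ⊤))) ?_ _ _ s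
  rw [Spec.map_comp]
  have h1 : (L.pullback μ).chart hU ≫ (L.pullback μ).toCone = Spec.map (CommRingCat.ofHom
      (((L.pullback μ).symAlgRes (le_top : U ≤ ⊤)).comp ((L.pullback μ).toSymAlg ⊤))) :=
    Limits.colimit.ι_desc _ _
  refine (Category.assoc _ _ _).symm.trans ?_
  exact congrArg (· ≫ Spec.map (CommRingCat.ofHom (L.pullSections μ))) h1

lemma mem_basicOpen_coneSection (U : S₁.Opens) (s : L.sectionRing ⊤)
    {τ : (L.pullback μ).totalSpace} (hτ : τ ∈ (L.pullback μ).proj ⁻¹ᵁ U) :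
    τ ∈ (L.pullback μ).totalSpace.basicOpen (L.coneSection μ U s) ↔
      s ∉ PrimeSpectrum.asIdeal (R := L.sectionRing ⊤) (L.resToCone μ τ) :=
  mem_basicOpen_specSection (R := CommRingCat.of (L.sectionRing ⊤)) (L.resToCone μ) _ s hτ

lemma mem_exceptional_iff (τ : (L.pullback μ).totalSpace) : τ ∈ L.exceptional μ ↔
    ∀ s : L.sectionRing ⊤, (s ∈ PrimeSpectrum.asIdeal (R := L.sectionRing ⊤) (L.resToCone μ τ) ↔
      s.1.coeff 0 = 0) := by
  have h0 : ∀ s : L.sectionRing ⊤, s ∈ PrimeSpectrum.asIdeal (R := L.sectionRing ⊤) L.vertex ↔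
      s.1.coeff 0 = 0 := fun s => by
    refine (RingHom.mem_ker (f := Polynomial.constantCoeff.comp (L.sectionRing ⊤).subtype)).trans ?_
    rfl
  constructor
  · intro h s
    rw [← h0, show L.resToCone μ τ = L.vertex from h]
  · intro h
    refine PrimeSpectrum.ext (Ideal.ext fun s => (h s).trans (h0 s).symm)

end Exceptional

section Vertex

variable {S S₁ : Scheme.{0}} [IsIntegral S] [IsIntegral S₁] [S.Over SpecC]
  (L : CartierDivisor S) (μ : S₁ ⟶ S) [IsDominant μ]

/-- Regular functions on a proper variety are constant, hence vanish nowhere or everywhere. -/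
lemma isUnit_of_toField_eq [UniversallyClosed (S ↘ SpecC)] {U : S₁.Opens} (a : Γ(S₁, U))
    {q : L.sectionRing ⊤} (h0 : q.1.coeff 0 ≠ 0)
    (ha : ∀ y hy, toField a y hy = fieldMap μ (q.1.coeff 0)) : IsUnit a := by
  let c := L.constSection ⊤ q
  have hc : ∀ y hy, toField c y hy = q.1.coeff 0 := L.toField_constSection q
  have hc0 : c ≠ 0 := fun h => h0 (by
    rw [← hc (genericPoint S) trivial, h]; exact toField_zero _ _)
  have hu : IsUnit c := by
    obtain ⟨d, hd⟩ := (isField_of_universallyClosed ℂ (S ↘ SpecC)).mul_inv_cancel hc0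
    exact IsUnit.of_mul_eq_one d hd
  have hu' := (hu.map (μ.app ⊤).hom).map (S₁.presheaf.map (homOfLE (le_preimage_top μ U)).op).hom
  convert hu' using 1
  refine toField_injective fun y hy => ?_
  rw [ha]
  refine Eq.trans ?_ (toField_res (homOfLE (le_preimage_top μ U)) (μ.app ⊤ c) y hy).symm
  rw [← hc (μ y) trivial]
  exact fieldMap_toField μ c y trivial

/-- Ampleness shows that a point over the vertex lies on the zero section: some homogeneous function
on the cone of positive degree is locally a unit times a power of the coordinate. Conversely, on the
zero section a function on the cone equals its part of degree zero, which is zero or a unit because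
`S` is proper. -/
lemma mem_exceptional_iff_notMem_basicOpen [UniversallyClosed (S ↘ SpecC)] (hL : L.IsAmple)
    {U : S₁.Opens} (hU : IsAffineOpen U) {i : (L.pullback μ).ι} (h : U ≤ (L.pullback μ).U i)
    {τ : (L.pullback μ).totalSpace} (hτ : τ ∈ (L.pullback μ).proj ⁻¹ᵁ U) :
    τ ∈ L.exceptional μ ↔
      τ ∉ (L.pullback μ).totalSpace.basicOpen ((L.pullback μ).coordSection hU h) := by
  have hpτ : (L.pullback μ).proj τ ∈ U := hτ
  have hgerm : ∀ a : Γ(S₁, U), IsUnit ((L.pullback μ).totalSpace.presheaf.germ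
      ((L.pullback μ).proj ⁻¹ᵁ U) τ hτ ((L.pullback μ).proj.app U a)) ↔
      IsUnit (S₁.presheaf.germ U ((L.pullback μ).proj τ) hpτ a) := fun a => by
    have e := Scheme.Hom.germ_stalkMap_apply (L.pullback μ).proj U τ hτ a
    rw [← e]
    exact isUnit_map_iff ((L.pullback μ).proj.stalkMap τ).hom _
  constructor
  · intro hE
    -- A section `g` of a positive multiple of `L` that does not vanish at the image point. As a
    -- function of degree `k` it vanishes at the vertex, and `hst` writes it as `a` times the `k`-th
    -- power of the coordinate, with `a` invertible at the point.
    obtain ⟨k, g, W, hk, hg, -, hxW, hW⟩ := hL (μ ((L.pullback μ).proj τ))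
    have hi : μ ((L.pullback μ).proj τ) ∈ L.U i := h hpτ
    obtain ⟨u, hu⟩ := (hW _ i hi).mp hxW
    let s : L.sectionRing ⊤ := ⟨Polynomial.monomial k g, fun m => by
      rw [Polynomial.coeff_monomial]
      split_ifs with hm
      · subst hm; exact hg
      · intro x _ j _
        rw [zero_mul]
        exact isRegularAt_zero x⟩
    have hs : τ ∉ (L.pullback μ).totalSpace.basicOpen (L.coneSection μ U s) := by
      rw [L.mem_basicOpen_coneSection μ U s hτ, not_not]
      refine ((L.mem_exceptional_iff μ τ).mp hE s).mpr ?_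
      exact Polynomial.coeff_monomial_of_ne _ hk.ne
    obtain ⟨a, ha⟩ := exists_section U (fieldMap μ (g * (L.f i : S.functionField) ^ k))
      fun x hx => (hg (μ x) trivial i (h hx)).fieldMap μ
    have hst : L.coneSection μ U s =
        (L.pullback μ).proj.app U a * (L.pullback μ).coordSection hU h ^ k := by
      refine ((L.pullback μ).chartHom_bijective hU).1 ?_
      rw [L.chartHom_coneSection μ hU, map_mul, map_pow, (L.pullback μ).chartHom_app,
        (L.pullback μ).chartHom_coordSection]
      refine (L.pullback μ).symAlg_ext ⟨_, hpτ⟩ ?_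
      change (Polynomial.monomial k g).map (fieldMap μ) = Polynomial.C (toField a _ hpτ) *
        (Polynomial.C (((L.pullback μ).f i)⁻¹ : S₁.functionFieldˣ).1 * Polynomial.X) ^ k
      have e1 : ((L.pullback μ).f i : S₁.functionField) = fieldMap μ (L.f i) := rfl
      rw [ha, map_mul, map_pow, ← e1, Polynomial.map_monomial, mul_pow, ← Polynomial.C_pow,
        ← mul_assoc, ← Polynomial.C_mul, mul_assoc, ← mul_pow, Units.mul_inv, one_pow, mul_one,
        Polynomial.C_mul_X_pow_eq_monomial]
    have hua : IsUnit (S₁.presheaf.germ U ((L.pullback μ).proj τ) hpτ a) := by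
      have e : S₁.presheaf.germ U ((L.pullback μ).proj τ) hpτ a =
          μ.stalkMap ((L.pullback μ).proj τ) u.1 := by
        refine IsFractionRing.injective (S₁.presheaf.stalk ((L.pullback μ).proj τ)) S₁.functionField ?_
        refine (ha _ hpτ).trans ?_
        rw [← hu, fieldMap_algebraMap]
        rfl
      rw [e]
      exact u.isUnit.map (μ.stalkMap ((L.pullback μ).proj τ)).hom
    intro ht
    apply hs
    rw [Scheme.mem_basicOpen _ _ _ hτ] at ht ⊢
    rw [hst, map_mul, map_pow]
    exact ((hgerm a).mpr hua).mul (ht.pow k)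
  · intro ht
    rw [Scheme.mem_basicOpen _ _ _ hτ] at ht
    rw [L.mem_exceptional_iff]
    intro s
    rw [← not_iff_not, ← L.mem_basicOpen_coneSection μ U s hτ, Scheme.mem_basicOpen _ _ _ hτ]
    -- Expand the function in powers of the coordinate. Where the coordinate vanishes only the
    -- constant coefficient matters, and that is the pull-back of the degree zero part of `s`.
    obtain ⟨p, hp⟩ := ((L.pullback μ).isAffineLine hU h ⟨_, hpτ⟩).bijective.2 (L.coneSection μ U s)
    have hp0 : ∀ y hy, toField (p.coeff 0) y hy = fieldMap μ (s.1.coeff 0) := by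
      intro y hy
      have e1 := congrArg ((L.pullback μ).valAt ⟨y, hy⟩) (((L.pullback μ).chartHom_eval₂ hU h p).symm.trans
        ((congrArg ((L.pullback μ).chartHom hU) hp).trans (L.chartHom_coneSection μ hU s)))
      rw [valAt_fromPoly] at e1
      have e2 := congrArg (fun r => r.coeff 0) e1
      simp only [Polynomial.comp_C_mul_X_coeff, pow_zero, mul_one, Polynomial.coeff_map] at e2
      refine e2.trans ?_
      exact Polynomial.coeff_map _ _
    have hdecomp : L.coneSection μ U s = (L.pullback μ).coordSection hU h *
        Polynomial.eval₂RingHom ((L.pullback μ).proj.app U).hom ((L.pullback μ).coordSection hU h) p.divX +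
        (L.pullback μ).proj.app U (p.coeff 0) := by
      rw [← hp]
      conv_lhs => rw [← Polynomial.X_mul_divX_add p]
      rw [map_add, map_mul]
      exact congrArg₂ (· + ·) (congrArg (· * _) (Polynomial.eval₂_X _ _))
        (Polynomial.eval₂_C _ _)
    have hmem : (L.pullback μ).totalSpace.presheaf.germ ((L.pullback μ).proj ⁻¹ᵁ U) τ hτ
        ((L.pullback μ).coordSection hU h *
        Polynomial.eval₂RingHom ((L.pullback μ).proj.app U).hom ((L.pullback μ).coordSection hU h) p.divX) ∈
        IsLocalRing.maximalIdeal ((L.pullback μ).totalSpace.presheaf.stalk τ) := by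
      rw [map_mul]
      exact Ideal.mul_mem_right _ _ ht
    by_cases h0 : s.1.coeff 0 = 0
    · have hz : p.coeff 0 = 0 := toField_injective fun y hy => by
        rw [hp0, h0, map_zero, toField_zero]
      rw [hdecomp, hz, map_zero, add_zero]
      exact iff_of_false hmem (not_not.mpr h0)
    · have hu : IsUnit (p.coeff 0) := L.isUnit_of_toField_eq μ (p.coeff 0) h0 hp0
      refine iff_of_true ?_ h0
      rw [hdecomp, map_add]
      by_contra hn
      have h1 := (Ideal.add_mem_iff_right _ hmem).mp hn
      exact h1 ((hgerm _).mpr (hu.map (S₁.presheaf.germ U ((L.pullback μ).proj τ) hpτ).hom))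

end Vertex

end CartierDivisor

/-! ### Spreading out orbifold forms to neighbourhoods. -/

section Spread

lemma pullGerm_germ {X Y : Scheme.{0}} [IsIntegral Y] (σ : Y ⟶ X) {U : X.Opens} (s : Γ(X, U))
    (y : Y) (hy : σ y ∈ U) :
    pullGerm σ y (X.presheaf.germ U (σ y) hy s) = toField (σ.app U s) y hy :=
  congrArg (algebraMap (Y.presheaf.stalk y) Y.functionField)
    (Scheme.Hom.germ_stalkMap_apply σ U y hy s)

lemma pullGerm_germ_eq {X Y : Scheme.{0}} [IsIntegral Y] (σ : Y ⟶ X) {U : X.Opens} (s : Γ(X, U))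
    (y z : Y) (hy : σ y ∈ U) (hz : σ z ∈ U) :
    pullGerm σ y (X.presheaf.germ U (σ y) hy s) = pullGerm σ z (X.presheaf.germ U (σ z) hz s) :=
  (pullGerm_germ σ s y hy).trans ((toField_eq _ _ _ _ _).trans (pullGerm_germ σ s z hz).symm)

variable {X Y : Scheme.{0}} [IsIntegral X] [IsIntegral Y] [Y.Over SpecC]

/-- A rational form in a stalk of the orbifold cotangent sheaf lies in all nearby stalks. -/
lemma exists_orbCotangent_mem [IsLocallyNoetherian X] [IsLocallyNoetherian Y] (σ : Y ⟶ X)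
    {J : Type} (D : J → Set X) (hD : ∀ j, IsClosed (D j)) (δ : J → ℚ) (y : Y) (b : RatForms Y)
    (hb : b ∈ orbCotangent σ D δ y) :
    ∃ W : Y.Opens, y ∈ W ∧ ∀ y' ∈ W, b ∈ orbCotangent σ D δ y' := by
  refine Submodule.span_induction ?_ ?_ ?_ ?_ hb
  · rintro _ (⟨g, rfl⟩ | ⟨j, z, w, u, e, m, hz, hw, hu, he, hm, rfl⟩)
    · obtain ⟨U, hU, s, rfl⟩ := X.presheaf.exists_germ_eq g
      refine ⟨σ ⁻¹ᵁ U, hU, fun y' hy' => Submodule.subset_span (Or.inl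
        ⟨X.presheaf.germ U (σ y') hy' s, ?_⟩)⟩
      exact congrArg (KaehlerDifferential.D ℂ Y.functionField) (pullGerm_germ_eq σ s y' y hy' hU)
    -- The equations of the divisor and of its preimage, and the unit, all extend to a
    -- neighbourhood. The relation between them, with the same exponents, is checked in the function
    -- field.
    · obtain ⟨U, hU, s, rfl, hs⟩ := hz.exists_section (hD j)
      obtain ⟨V, hV, w', rfl, hw'⟩ := hw.exists_section ((hD j).preimage σ.continuous)
      obtain ⟨V', hV', u', rfl⟩ := Y.presheaf.exists_germ_eq u
      have hyu : y ∈ Y.basicOpen u' := (Y.mem_basicOpen u' y hV').mpr hu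
      refine ⟨σ ⁻¹ᵁ U ⊓ V ⊓ Y.basicOpen u', ⟨⟨hU, hV⟩, hyu⟩, fun y' hy' => ?_⟩
      obtain ⟨⟨hU', hVy⟩, hyu'⟩ := hy'
      have hVu' := Y.basicOpen_le u' hyu'
      refine Submodule.subset_span (Or.inr ⟨j, X.presheaf.germ U (σ y') hU' s,
        Y.presheaf.germ V y' hVy w', Y.presheaf.germ V' y' hVu' u', e, m, hs _ hU', hw' _ hVy,
        (Y.mem_basicOpen u' y' hVu').mp hyu', ?_, hm, ?_⟩)
      · refine IsFractionRing.injective (Y.presheaf.stalk y') Y.functionField ?_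
        have h1 := congrArg (algebraMap (Y.presheaf.stalk y) Y.functionField) he
        rw [map_mul, map_pow] at h1 ⊢
        refine ((pullGerm_germ_eq σ s y' y hU' hU).trans h1).trans ?_
        exact congrArg₂ (· * ·) (toField_eq u' y y' hV' hVu')
          (congrArg (· ^ e) (toField_eq w' y y' hV hVy))
      · exact congrArg₂ (fun a b => (a ^ m)⁻¹ • KaehlerDifferential.D ℂ Y.functionField b)
          (toField_eq w' y y' hV hVy) (pullGerm_germ_eq σ s y y' hU hU')
  · exact ⟨⊤, trivial, fun _ _ => zero_mem _⟩
  · rintro a b - - ⟨W, hW, h⟩ ⟨W', hW', h'⟩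
    exact ⟨W ⊓ W', ⟨hW, hW'⟩, fun y' hy' => add_mem (h y' hy'.1) (h' y' hy'.2)⟩
  · rintro r a - ⟨W, hW, h⟩
    obtain ⟨U, hU, s, rfl⟩ := Y.presheaf.exists_germ_eq r
    refine ⟨W ⊓ U, ⟨hW, hU⟩, fun y' hy' => ?_⟩
    rw [← algebraMap_smul Y.functionField]
    change toField s y hU • a ∈ _
    rw [toField_eq s y y' hU hy'.2, toField, algebraMap_smul]
    exact Submodule.smul_mem _ _ (h y' hy'.1)

end Spread

/-! ### Change of local equations in logarithmic forms. -/

section Derivation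

variable {O L A : Type} [CommRing O] [CommRing L] [CommRing A] [Algebra O L] [Algebra ℂ L]

/-- The elements whose differentials lie in a given submodule. -/
def diffSubring (ψ : A →+* O) (Q : Submodule O Ω[L⁄ℂ]) : Subring A where
  carrier := {a | KaehlerDifferential.D ℂ L (algebraMap O L (ψ a)) ∈ Q}
  zero_mem' := by simp
  one_mem' := by simp
  add_mem' {a b} ha hb := by
    simp only [Set.mem_ofPred_eq, map_add] at *
    exact add_mem ha hb
  neg_mem' {a} ha := by
    simp only [Set.mem_ofPred_eq, map_neg] at *
    exact neg_mem ha
  mul_mem' {a b} ha hb := by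
    simp only [Set.mem_ofPred_eq, map_mul, Derivation.leibniz, algebraMap_smul] at *
    exact add_mem (Submodule.smul_mem _ _ hb) (Submodule.smul_mem _ _ ha)

lemma mem_diffSubring {ψ : A →+* O} {Q : Submodule O Ω[L⁄ℂ]} {a : A} : a ∈ diffSubring ψ Q ↔
    KaehlerDifferential.D ℂ L (algebraMap O L (ψ a)) ∈ Q := Iff.rfl

/-- The quotient rule with a unit as denominator. -/
lemma mem_diffSubring_of_mul {ψ : A →+* O} {Q : Submodule O Ω[L⁄ℂ]} {g a b : A} (hb : IsUnit b)
    (h : g * b = a) (ha : a ∈ diffSubring ψ Q) (hb' : b ∈ diffSubring ψ Q) :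
    g ∈ diffSubring ψ Q := by
  obtain ⟨c, hc⟩ := (hb.map ψ).exists_left_inv
  have h1 := congrArg (fun x => KaehlerDifferential.D ℂ L (algebraMap O L (ψ x))) h
  simp only [map_mul, Derivation.leibniz, algebraMap_smul] at h1
  have h2 : KaehlerDifferential.D ℂ L (algebraMap O L (ψ g)) = c •
      (KaehlerDifferential.D ℂ L (algebraMap O L (ψ a)) -
        ψ g • KaehlerDifferential.D ℂ L (algebraMap O L (ψ b))) := by
    rw [← h1, add_sub_cancel_left, smul_smul, hc, one_smul]
  rw [mem_diffSubring, h2]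
  exact Submodule.smul_mem _ _ (sub_mem ha (Submodule.smul_mem _ _ hb'))

/-- By the Leibniz rule `w⁻ᵐ d(z v) = w⁻ᵐ z dv + v w⁻ᵐ dz`. The first coefficient is regular because
`z` is a multiple of `wᵉ` and `m ≤ e`, which is the condition that the coefficient of the divisor is
at most `1`. -/
lemma inv_pow_smul_D_mem {O L : Type} [CommRing O] [Field L] [Algebra O L] [Algebra ℂ L]
    [FaithfulSMul O L] (Q : Submodule O Ω[L⁄ℂ]) {z v w w₀ v' u : O} {e m : ℕ} (hv : IsUnit v)
    (hv' : IsUnit v') (hw : w₀ * v' = w) (hz : z * v = u * w ^ e) (hm : m ≤ e)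
    (hDv : KaehlerDifferential.D ℂ L (algebraMap O L v) ∈ Q)
    (hDz : KaehlerDifferential.D ℂ L (algebraMap O L (z * v)) ∈ Q)
    (h : (algebraMap O L w₀ ^ m)⁻¹ • KaehlerDifferential.D ℂ L (algebraMap O L z) ∈ Q) :
    (algebraMap O L w ^ m)⁻¹ • KaehlerDifferential.D ℂ L (algebraMap O L (z * v)) ∈ Q := by
  obtain rfl | hm0 := eq_or_ne m 0
  · simpa using hDz
  -- In this degenerate case the inverse is zero by convention, and so is the form.
  by_cases hw0 : w = 0
  · rw [hw0, map_zero, zero_pow hm0, inv_zero, zero_smul]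
    exact zero_mem _
  obtain ⟨c, hc⟩ := hv.exists_left_inv
  obtain ⟨c', hc'⟩ := hv'.exists_left_inv
  have hF : algebraMap O L w ≠ 0 := (FaithfulSMul.algebraMap_eq_zero_iff O L).not.mpr hw0
  have e0 : z = c * u * w ^ e := by rw [mul_assoc, ← hz, mul_left_comm, hc, mul_one]
  have e1 : (algebraMap O L w ^ m)⁻¹ * algebraMap O L z =
      algebraMap O L (c * u * w ^ (e - m)) := by
    rw [e0, inv_mul_eq_iff_eq_mul₀ (pow_ne_zero _ hF), ← map_pow, ← map_mul]
    congr 1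
    rw [mul_left_comm, ← pow_add, Nat.add_sub_cancel' hm]
  have e2 : (algebraMap O L w ^ m)⁻¹ = algebraMap O L (c' ^ m) * (algebraMap O L w₀ ^ m)⁻¹ := by
    have h1 : w₀ = c' * w := by rw [← hw, mul_left_comm, hc', mul_one]
    have h2 : algebraMap O L c' ≠ 0 := fun h => by
      have := congrArg (algebraMap O L) hc'
      rw [map_mul, h, zero_mul, map_one] at this
      exact zero_ne_one this
    rw [h1, map_mul, mul_pow, map_pow, mul_inv, mul_inv_cancel_left₀ (pow_ne_zero _ h2)]
  have e3 : (algebraMap O L w ^ m)⁻¹ • KaehlerDifferential.D ℂ L (algebraMap O L (z * v)) =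
      (c * u * w ^ (e - m)) • KaehlerDifferential.D ℂ L (algebraMap O L v) +
      (c' ^ m * v) • (algebraMap O L w₀ ^ m)⁻¹ •
        KaehlerDifferential.D ℂ L (algebraMap O L z) := by
    rw [map_mul, Derivation.leibniz, smul_add, smul_smul, e1, algebraMap_smul]
    congr 1
    rw [smul_smul, e2, ← algebraMap_smul L (c' ^ m * v), smul_smul, map_mul]
    congr 1
    ring
  rw [e3]
  exact add_mem (Submodule.smul_mem _ _ hDv) (Submodule.smul_mem _ _ h)

/-- The same computation for coefficient `1`, with `a` the full power of the equation upstairs: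
since `t v = u a`, the form is `u` times `dt / t` plus a regular multiple of `dv`. -/
lemma inv_smul_D_mem_of_dlog {O L : Type} [CommRing O] [Field L] [Algebra O L] [Algebra ℂ L]
    [FaithfulSMul O L] (Q : Submodule O Ω[L⁄ℂ]) {t v u a : O} (hv : IsUnit v) (ht : t ≠ 0)
    (hz : t * v = u * a)
    (hDv : KaehlerDifferential.D ℂ L (algebraMap O L v) ∈ Q)
    (h : (algebraMap O L t)⁻¹ • KaehlerDifferential.D ℂ L (algebraMap O L t) ∈ Q) :
    (algebraMap O L a)⁻¹ • KaehlerDifferential.D ℂ L (algebraMap O L (t * v)) ∈ Q := by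
  obtain ⟨c, hc⟩ := hv.exists_left_inv
  have hc0 : algebraMap O L c * algebraMap O L v = 1 := by rw [← map_mul, hc, map_one]
  have hv0 : algebraMap O L v ≠ 0 := right_ne_zero_of_mul_eq_one hc0
  have ht0 : algebraMap O L t ≠ 0 := (FaithfulSMul.algebraMap_eq_zero_iff O L).not.mpr ht
  have h1 : algebraMap O L t * algebraMap O L v = algebraMap O L u * algebraMap O L a := by
    rw [← map_mul, ← map_mul, hz]
  have ha0 : algebraMap O L a ≠ 0 := right_ne_zero_of_mul (h1 ▸ mul_ne_zero ht0 hv0)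
  have e3 : (algebraMap O L a)⁻¹ • KaehlerDifferential.D ℂ L (algebraMap O L (t * v)) =
      (u * c) • KaehlerDifferential.D ℂ L (algebraMap O L v) +
      u • (algebraMap O L t)⁻¹ • KaehlerDifferential.D ℂ L (algebraMap O L t) := by
    rw [map_mul, Derivation.leibniz, smul_add, smul_smul, smul_smul, ← algebraMap_smul L (u * c),
      ← algebraMap_smul L u, smul_smul, map_mul]
    congr 2
    · rw [inv_mul_eq_iff_eq_mul₀ ha0, ← mul_one (algebraMap O L t), ← hc0]
      linear_combination algebraMap O L c * h1
    · rw [inv_mul_eq_iff_eq_mul₀ ha0, ← mul_assoc, eq_mul_inv_iff_mul_eq₀ ht0]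
      linear_combination h1
  rw [e3]
  exact add_mem (Submodule.smul_mem _ _ hDv) (Submodule.smul_mem _ _ h)

/-- A flat local homomorphism is faithfully flat, so ideals are recovered by contraction. This
descends the ramification relation from the total space to the covering. -/
lemma span_singleton_eq_of_flat {A B : Type} [CommRing A] [CommRing B] [IsLocalRing A]
    [IsLocalRing B] (φ : A →+* B) [IsLocalHom φ] (hφ : φ.Flat) {a b : A}
    (h : Ideal.span {φ a} = Ideal.span {φ b}) : Ideal.span {a} = Ideal.span {b} := by
  algebraize [φ]
  have : IsLocalHom (algebraMap A B) := ‹IsLocalHom φ›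
  have : Module.FaithfullyFlat A B := Module.FaithfullyFlat.of_flat_of_isLocalHom
  have e : ∀ a : A, (Ideal.span {a}).map (algebraMap A B) = Ideal.span {φ a} := fun a => by
    rw [Ideal.map_span, Set.image_singleton]; rfl
  rw [← Ideal.comap_map_eq_self_of_faithfullyFlat (B := B) (Ideal.span {a}),
    ← Ideal.comap_map_eq_self_of_faithfullyFlat (B := B) (Ideal.span {b}), e, e, h]

end Derivation

/-! ### Logarithmic forms on a square of affine lines. -/

section Square

variable {S₁ S₂ T Y : Scheme.{0}}

/-- Transport of germs along an equality of morphisms. -/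
lemma exists_germ_of_hom_eq {f g : Y ⟶ S₁} (h : f = g) (y : Y) (a : S₁.presheaf.stalk (f y)) :
    ∃ b : S₁.presheaf.stalk (g y), g.stalkMap y b = f.stalkMap y a ∧
      ∀ Z : Set S₁, IsLocalEquation Z (f y) a → IsLocalEquation Z (g y) b := by
  subst h
  exact ⟨a, rfl, fun _ => id⟩

/-- The points `r (q y)` and `σ (π y)` are equal, but their local rings are different types. This
moves a germ from one to the other and keeps its pull-back and its property of being a local
equation. -/
lemma exists_germ_of_square {q : Y ⟶ T} {π : Y ⟶ S₂} {r : T ⟶ S₁} {σ : S₂ ⟶ S₁}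
    (h : q ≫ r = π ≫ σ) (y : Y) (a : S₁.presheaf.stalk (r (q y))) :
    ∃ b : S₁.presheaf.stalk (σ (π y)),
      π.stalkMap y (σ.stalkMap (π y) b) = q.stalkMap y (r.stalkMap (q y) a) ∧
      ∀ Z : Set S₁, IsLocalEquation Z (r (q y)) a → IsLocalEquation Z (σ (π y)) b := by
  obtain ⟨b, hb, hb'⟩ := exists_germ_of_hom_eq h y a
  refine ⟨b, ?_, hb'⟩
  have e1 := ConcreteCategory.congr_hom (Scheme.Hom.stalkMap_comp q r y) a
  have e2 := ConcreteCategory.congr_hom (Scheme.Hom.stalkMap_comp π σ y) b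
  exact e2.symm.trans (hb.trans e1)

/-- The morphisms `r` and `π` of a commutative square are affine lines near `y`, with the same
coordinate `t`, which is a local equation of the set `E`. -/
structure IsLineSquare (q : Y ⟶ T) (π : Y ⟶ S₂) (r : T ⟶ S₁) (E : Set T) (y : Y)
    (t : T.presheaf.stalk (q y)) : Prop where
  fraction_base : IsFractionHom (lineHom r (q y) t)
  fraction : IsFractionHom (lineHom π y (q.stalkMap y t))
  equation_base : IsLocalEquation E (q y) t
  equation : IsLocalEquation (q ⁻¹' E) y (q.stalkMap y t)

lemma fieldMap_algebraMap_stalk [IsIntegral S₂] [IsIntegral Y] {π : Y ⟶ S₂} [IsDominant π] {y : Y}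
    (a : S₂.presheaf.stalk (π y)) :
    fieldMap π (algebraMap _ S₂.functionField a) = algebraMap _ Y.functionField (π.stalkMap y a) :=
  fieldMap_algebraMap π y a

lemma dlogForm_mem_orbCotangent [IsIntegral Y] [Y.Over SpecC] {q : Y ⟶ T} {π : Y ⟶ S₂} {r : T ⟶ S₁}
    {E : Set T} {y : Y} {t : T.presheaf.stalk (q y)} {ι : Type} {D : ι → Set S₁} {δ : ι → ℚ}
    (ht : IsLineSquare q π r E y t) :
    dlogForm (algebraMap _ Y.functionField (q.stalkMap y t)) ∈
      orbCotangent q (fun j : Option ι => j.elim E fun i => r ⁻¹' D i)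
      (fun j : Option ι => j.elim 1 δ) y := by
  refine Submodule.subset_span (Or.inr ⟨none, t, q.stalkMap y t, 1, 1, 1, ht.equation_base,
    ht.equation, isUnit_one, by rw [one_mul, pow_one], by simp, ?_⟩)
  rw [pow_one]
  rfl

variable [IsIntegral S₂] [IsIntegral Y] [S₂.Over SpecC] [Y.Over SpecC]
  {q : Y ⟶ T} {π : Y ⟶ S₂} {r : T ⟶ S₁} {σ : S₂ ⟶ S₁}
  [IsDominant π] [π.IsOver SpecC] {E : Set T} {y : Y} {t : T.presheaf.stalk (q y)}
  {ι : Type} {D : ι → Set S₁} {δ : ι → ℚ}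

/-- Pull-back along the line maps the orbifold cotangent sheaf to the logarithmic one. -/
lemma formMap_orbCotangent (w : q ≫ r = π ≫ σ) (ht : IsLineSquare q π r E y t)
    (hD : ∀ i, IsClosed (D i)) (m : RatForms S₂) (hm : m ∈ orbCotangent σ D δ (π y)) :
    formMap π m ∈ orbCotangent q (fun j : Option ι => j.elim E fun i => r ⁻¹' D i)
      (fun j : Option ι => j.elim 1 δ) y := by
  refine Submodule.span_induction ?_ ?_ ?_ ?_ hm
  · rintro _ (⟨g, rfl⟩ | ⟨j, z, w', u, e, m, hz, hw, hu, he, hm, rfl⟩)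
    · obtain ⟨g', hg', -⟩ := exists_germ_of_square w.symm y g
      refine Submodule.subset_span (Or.inl ⟨r.stalkMap (q y) g', ?_⟩)
      refine Eq.trans ?_ (formMap_D π _).symm
      exact congrArg (KaehlerDifferential.D ℂ Y.functionField)
        ((congrArg (algebraMap _ Y.functionField) hg').trans (fieldMap_algebraMap_stalk _).symm)
    · obtain ⟨z', hz', hz''⟩ := exists_germ_of_square w.symm y z
      -- Pull-back along lines takes local equations to local equations, so a generator goes to the
      -- generator with the same exponents.
      refine Submodule.subset_span (Or.inr ⟨some j, r.stalkMap (q y) z', π.stalkMap y w',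
        π.stalkMap y u, e, m, ht.fraction_base.isLocalEquation_preimage (hD j) (hz'' _ hz), ?_,
        hu.map (π.stalkMap y).hom, ?_, hm, ?_⟩)
      · have h1 := ht.fraction.isLocalEquation_preimage ((hD j).preimage σ.continuous) hw
        have h2 : π ⁻¹' (σ ⁻¹' D j) = q ⁻¹' (r ⁻¹' D j) := by
          ext x
          have := congrArg (fun f : Y ⟶ S₁ => f x) w
          change σ (π x) ∈ D j ↔ r (q x) ∈ D j
          rw [← Scheme.Hom.comp_apply, ← w, Scheme.Hom.comp_apply]
        rw [h2] at h1
        exact h1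
      · refine hz'.trans ?_
        refine (congrArg (π.stalkMap y) he).trans ?_
        rw [map_mul, map_pow]
      · rw [formMap_smul, formMap_D, map_inv₀, map_pow, fieldMap_algebraMap_stalk]
        exact congrArg (fun a => _ • KaehlerDifferential.D ℂ Y.functionField a)
          ((fieldMap_algebraMap_stalk _).trans (congrArg (algebraMap _ Y.functionField) hz'.symm))
  · rw [map_zero]; exact zero_mem _
  · intro a b _ _ ha hb
    rw [map_add]; exact add_mem ha hb
  · intro c a _ ha
    rw [← algebraMap_smul S₂.functionField c a, formMap_smul, fieldMap_algebraMap_stalk,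
      algebraMap_smul]
    exact Submodule.smul_mem _ _ ha

/-- The module generated by the pull-backs of orbifold forms and the logarithmic form `dt / t`. -/
def lineForms (π : Y ⟶ S₂) [IsDominant π] [π.IsOver SpecC] (B : FormStalks S₂) (y : Y)
    (τ : Y.presheaf.stalk y) : Submodule (Y.presheaf.stalk y) (RatForms Y) :=
  Submodule.span _ (formMap π '' B (π y) ∪ {dlogForm (algebraMap _ Y.functionField τ)})

/-- The functions whose differentials lie in the module form a ring closed under division by units.
It contains the functions from the base, and also `t`, because `dt = t • (dt / t)`; hence it
contains all fractions of polynomials in `t`. -/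
lemma D_mem_lineForms (w : q ≫ r = π ≫ σ) (ht : IsLineSquare q π r E y t)
    (g : T.presheaf.stalk (q y)) :
    KaehlerDifferential.D ℂ Y.functionField (pullGerm q y g) ∈
      lineForms π (orbCotangent σ D δ) y (q.stalkMap y t) := by
  set Q := lineForms π (orbCotangent σ D δ) y (q.stalkMap y t)
  have hbase : ∀ c, r.stalkMap (q y) c ∈ diffSubring (q.stalkMap y).hom Q := fun c => by
    obtain ⟨c', hc', -⟩ := exists_germ_of_square w y c
    refine Submodule.subset_span (Or.inl ⟨_, Submodule.subset_span (Or.inl ⟨c', rfl⟩), ?_⟩)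
    refine (formMap_D π _).trans (congrArg (KaehlerDifferential.D ℂ Y.functionField) ?_)
    exact (fieldMap_algebraMap_stalk _).trans (congrArg (algebraMap _ Y.functionField) hc')
  have hτ : t ∈ diffSubring (q.stalkMap y).hom Q := by
    rw [mem_diffSubring]
    by_cases h0 : algebraMap _ Y.functionField (q.stalkMap y t) = 0
    · have : (algebraMap _ Y.functionField) ((q.stalkMap y).hom t) = 0 := h0
      rw [this, map_zero]
      exact zero_mem _
    have h1 : q.stalkMap y t • dlogForm (algebraMap _ Y.functionField (q.stalkMap y t)) ∈ Q :=
      Submodule.smul_mem _ _ (Submodule.subset_span (Or.inr rfl))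
    rw [← algebraMap_smul Y.functionField, dlogForm, smul_inv_smul₀ h0] at h1
    exact h1
  have hpoly : ∀ P, lineHom r (q y) t P ∈ diffSubring (q.stalkMap y).hom Q := fun P => by
    refine Polynomial.induction_on P (fun a => ?_) (fun a b ha hb => ?_) (fun n a h => ?_)
    · rw [lineHom_C]
      exact hbase a
    · rw [map_add]
      exact add_mem ha hb
    · rw [pow_succ, ← mul_assoc, map_mul, lineHom_X]
      exact mul_mem h hτ
  obtain ⟨a, b, hb, hg⟩ := ht.fraction_base.exists_fraction g
  exact mem_diffSubring_of_mul hb hg (hpoly a) (hpoly b)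

/-- The logarithmic cotangent sheaf is generated by the pull-back of the orbifold cotangent sheaf
and the logarithmic form of the coordinate of the line. -/
lemma orbCotangent_le_lineForms [IsIntegral T] [Flat π] (w : q ≫ r = π ≫ σ)
    (ht : IsLineSquare q π r E y t)
    (hD : ∀ i, IsClosed (D i)) (hD' : ∀ i x, ∃ z, IsLocalEquation (D i) x z)
    (hσ : ∀ i x, ∃ z, IsLocalEquation (σ ⁻¹' D i) x z) (hδ : ∀ i, δ i ≤ 1) :
    orbCotangent q (fun j : Option ι => j.elim E fun i => r ⁻¹' D i)
      (fun j : Option ι => j.elim 1 δ) y ≤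
      lineForms π (orbCotangent σ D δ) y (q.stalkMap y t) := by
  refine Submodule.span_le.mpr ?_
  rintro _ (⟨g, rfl⟩ | ⟨j, z, w', u, e, m, hz, hw, hu, he, hm, rfl⟩)
  · exact D_mem_lineForms w ht g
  rcases j with _ | i
  -- Along `E` the coefficient is `1`, so the pole has the full order `e` and the form is a multiple
  -- of `dt / t` up to a regular correction.
  · have hm' : m = e := by
      have : (m : ℚ) = e * 1 := hm
      exact_mod_cast this.trans (mul_one _)
    subst hm'
    obtain ⟨v, rfl⟩ := Ideal.span_singleton_eq_span_singleton.mp (ht.equation_base.trans hz.symm)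
    have h0 : q.stalkMap y t ≠ 0 := fun h0 => Polynomial.X_ne_zero
      (ht.fraction.injective ((lineHom_X _ _ _).trans (h0.trans (map_zero _).symm)))
    have hp : pullGerm q y (t * v) =
        algebraMap _ Y.functionField (q.stalkMap y t * q.stalkMap y v) :=
      congrArg (algebraMap _ Y.functionField) (map_mul (q.stalkMap y).hom t v)
    rw [hp, ← map_pow]
    refine inv_smul_D_mem_of_dlog _ (v.isUnit.map (q.stalkMap y).hom) h0
      ((map_mul (q.stalkMap y).hom t v).symm.trans he) (D_mem_lineForms w ht v) ?_
    exact Submodule.subset_span (Or.inr rfl)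
  · obtain ⟨z₀, hz₀⟩ := hD' i (r (q y))
    obtain ⟨z', hz', hz''⟩ := exists_germ_of_square w y z₀
    obtain ⟨w₀, hw₀⟩ := hσ i (π y)
    have h2 : π ⁻¹' (σ ⁻¹' D i) = q ⁻¹' (r ⁻¹' D i) := by
      ext x
      change σ (π x) ∈ D i ↔ r (q x) ∈ D i
      rw [← Scheme.Hom.comp_apply, ← w, Scheme.Hom.comp_apply]
    have hzr := ht.fraction_base.isLocalEquation_preimage (hD i) hz₀
    have hwπ := ht.fraction.isLocalEquation_preimage ((hD i).preimage σ.continuous) hw₀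
    rw [h2] at hwπ
    obtain ⟨v, rfl⟩ := Ideal.span_singleton_eq_span_singleton.mp (hzr.trans hz.symm)
    obtain ⟨v', hv'⟩ := Ideal.span_singleton_eq_span_singleton.mp (hwπ.trans hw.symm)
    have hp : (q.stalkMap y).hom (r.stalkMap (q y) z₀ * v) =
        π.stalkMap y (σ.stalkMap (π y) z') * q.stalkMap y v :=
      (map_mul (q.stalkMap y).hom _ _).trans (congrArg (· * _) hz'.symm)
    have hmδ : (m : ℚ) = e * δ i := hm
    have hme : m ≤ e := by
      have : (m : ℚ) ≤ e := hmδ.trans_le (mul_le_of_le_one_right (Nat.cast_nonneg _) (hδ i))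
      exact_mod_cast this
    -- The given `z`, `w'` and `e` live on the total spaces. To use a generator on the covering, the
    -- relation between equation and ramification index must hold there, and it descends along the
    -- flat map `π`.
    have hflat : Ideal.span {σ.stalkMap (π y) z'} = Ideal.span {w₀ ^ e} := by
      refine span_singleton_eq_of_flat (π.stalkMap y).hom (Flat.stalkMap π y) ?_
      have e1 : Associated (π.stalkMap y (σ.stalkMap (π y) z')) (π.stalkMap y w₀ ^ e) := by
        have a1 : Associated (π.stalkMap y (σ.stalkMap (π y) z')) (u * w' ^ e) := by
          rw [← he, hp]
          exact (associated_mul_unit_right _ _ (v.isUnit.map (q.stalkMap y).hom))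
        have a2 : Associated (u * w' ^ e) (w' ^ e) := associated_unit_mul_left _ _ hu
        exact (a1.trans a2).trans (Associated.symm ⟨v', hv'⟩).pow_pow
      exact Ideal.span_singleton_eq_span_singleton.mpr
        (e1.trans (Associated.of_eq (map_pow (π.stalkMap y).hom w₀ e).symm))
    obtain ⟨u₀, hu₀⟩ := Ideal.span_singleton_eq_span_singleton.mp hflat.symm
    have hp' : pullGerm q y (r.stalkMap (q y) z₀ * v) = algebraMap _ Y.functionField
        (π.stalkMap y (σ.stalkMap (π y) z') * q.stalkMap y v) :=
      congrArg (algebraMap _ Y.functionField) hp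
    have hDz := D_mem_lineForms (D := D) (δ := δ) w ht (r.stalkMap (q y) z₀ * v)
    rw [hp'] at hDz ⊢
    refine inv_pow_smul_D_mem _ (v.isUnit.map (q.stalkMap y).hom) v'.isUnit hv'
      (hp.symm.trans he) hme (D_mem_lineForms w ht v) hDz ?_
    refine Submodule.subset_span (Or.inl ⟨(algebraMap _ S₂.functionField w₀ ^ m)⁻¹ •
      KaehlerDifferential.D ℂ S₂.functionField (pullGerm σ (π y) z'),
      Submodule.subset_span (Or.inr ⟨i, z', w₀, u₀, e, m, hz'' _ hz₀, hw₀, u₀.isUnit, ?_, hmδ,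
        rfl⟩), ?_⟩)
    · rw [mul_comm]; exact hu₀.symm
    · rw [formMap_smul, formMap_D, map_inv₀, map_pow, fieldMap_algebraMap_stalk]
      exact congrArg (fun a => _ • KaehlerDifferential.D ℂ Y.functionField a)
        (fieldMap_algebraMap_stalk _)

end Square

/-! ### Comparison of the pulled-back extension with the logarithmic forms. -/

section LogLine

lemma IsFractionHom.isFractionRing {S Y : Scheme.{0}} [IsIntegral Y] {π : Y ⟶ S} {y : Y}
    {t : Y.presheaf.stalk y} (h : IsFractionHom (lineHom π y t)) :
    letI := ((algebraMap (Y.presheaf.stalk y) Y.functionField).comp (lineHom π y t)).toAlgebra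
    IsFractionRing (Polynomial (S.presheaf.stalk (π y))) Y.functionField := by
  let _ := ((algebraMap (Y.presheaf.stalk y) Y.functionField).comp (lineHom π y t)).toAlgebra
  have hinj : Function.Injective (algebraMap (Polynomial (S.presheaf.stalk (π y))) Y.functionField) :=
    (IsFractionRing.injective (Y.presheaf.stalk y) Y.functionField).comp h.injective
  have := (faithfulSMul_iff_algebraMap_injective _ _).mpr hinj
  have key : ∀ g : Y.presheaf.stalk y, ∃ p q : Polynomial (S.presheaf.stalk (π y)),
      algebraMap _ Y.functionField g = algebraMap _ Y.functionField p / algebraMap _ Y.functionField q := by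
    intro g
    obtain ⟨p, q, hq, e⟩ := h.exists_fraction g
    refine ⟨p, q, eq_div_of_mul_eq (hq.map (algebraMap _ Y.functionField)).ne_zero ?_⟩
    exact (map_mul (algebraMap (Y.presheaf.stalk y) Y.functionField) _ _).symm.trans (congrArg _ e)
  refine IsFractionRing.of_field _ _ fun z => ?_
  obtain ⟨a, b, -, rfl⟩ := IsFractionRing.div_surjective (A := Y.presheaf.stalk y) z
  obtain ⟨p, q, hpq⟩ := key a
  obtain ⟨p', q', hpq'⟩ := key b
  exact ⟨p * q', q * p', by rw [hpq, hpq', map_mul, map_mul, div_div_div_eq]⟩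

variable {S Y : Scheme.{0}} [IsIntegral S] [IsIntegral Y] [S.Over SpecC] [Y.Over SpecC]
  (π : Y ⟶ S) [IsDominant π] [π.IsOver SpecC] (C : CartierDivisor S) (τ : Y.functionField)
  (B : FormStalks S) (G : FormStalks Y)

/-- The morphism `π` is locally an affine line with the coordinates `τ / f i`, for a rational
function `τ` and the local equations `f i` of a divisor, and `G` is generated by the pull-backs of
the forms in `B` and the logarithmic forms of the coordinates. -/
structure IsLogLine : Prop where
  formMap_mem : ∀ y, ∀ m ∈ B (π y), formMap π m ∈ G y
  exists_coord : ∀ y i, π y ∈ C.U i → ∃ t : Y.presheaf.stalk y, IsFractionHom (lineHom π y t) ∧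
    fieldMap π (C.f i) * algebraMap _ Y.functionField t = τ ∧
    dlogForm (algebraMap _ Y.functionField t) ∈ G y ∧ G y ≤ lineForms π B y t

/-- The rational form `ω + r • dlog τ`. -/
def extForm : RatForms S × S.functionField →+ RatForms Y where
  toFun v := formMap π v.1 + fieldMap π v.2 • dlogForm τ
  map_zero' := by rw [Prod.fst_zero, Prod.snd_zero, map_zero, map_zero, zero_smul, add_zero]
  map_add' v w := by
    rw [Prod.fst_add, Prod.snd_add, map_add, map_add, add_smul]
    abel

lemma extForm_apply (v : RatForms S × S.functionField) :
    extForm π τ v = formMap π v.1 + fieldMap π v.2 • dlogForm τ := rfl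

lemma extForm_smul (k : S.functionField) (v : RatForms S × S.functionField) :
    extForm π τ (k • v) = fieldMap π k • extForm π τ v := by
  rw [extForm_apply, extForm_apply, Prod.smul_fst, Prod.smul_snd, formMap_smul, smul_add, smul_smul,
    smul_eq_mul, map_mul]

section Independence

variable {π} {y : Y} {t : Y.presheaf.stalk y} (h : IsFractionHom (lineHom π y t))
  {J : Type} (b : Module.Basis J S.functionField (RatForms S))

include h

lemma linearIndependent_formMap : LinearIndependent Y.functionField fun j => formMap π (b j) := by
  let _ := ((algebraMap (Y.presheaf.stalk y) Y.functionField).comp (lineHom π y t)).toAlgebra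
  have := h.isFractionRing
  refine linearIndependent_kaehlerMap (A := S.presheaf.stalk (π y)) (fieldMap π)
    (fieldMap_complex π) (fun a => ?_) b
  refine (fieldMap_algebraMap_stalk a).trans ?_
  exact congrArg (algebraMap _ Y.functionField) (lineHom_C _ _ _ a).symm

/-- Contraction with `d/dt`: it kills forms from the base and takes `dt / t` to `1 / t`. -/
lemma exists_functional : ∃ d : RatForms Y →ₗ[Y.functionField] Y.functionField,
    (∀ ω, d (formMap π ω) = 0) ∧ d (dlogForm (algebraMap _ Y.functionField t)) ≠ 0 := by
  let _ := ((algebraMap (Y.presheaf.stalk y) Y.functionField).comp (lineHom π y t)).toAlgebra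
  have := h.isFractionRing
  let _ : Algebra (S.presheaf.stalk (π y)) Y.functionField := (pullGerm π y).toAlgebra
  have : IsScalarTower (S.presheaf.stalk (π y)) (Polynomial (S.presheaf.stalk (π y)))
    Y.functionField := .of_algebraMap_eq fun a =>
      congrArg (algebraMap _ Y.functionField) (lineHom_C _ _ _ a).symm
  have : IsScalarTower ℂ (S.presheaf.stalk (π y)) Y.functionField :=
    .of_algebraMap_eq fun c => (pullGerm_complex π y c).symm
  obtain ⟨d, hd, hd'⟩ := exists_functional_of_polynomial (A := S.presheaf.stalk (π y))
    (L := Y.functionField)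
  have hX : algebraMap (Polynomial (S.presheaf.stalk (π y))) Y.functionField Polynomial.X =
      algebraMap (Y.presheaf.stalk y) Y.functionField t :=
    congrArg (algebraMap (Y.presheaf.stalk y) Y.functionField) (lineHom_X _ _ _)
  have ht : algebraMap (Y.presheaf.stalk y) Y.functionField t ≠ 0 := by
    rw [← hX]
    exact IsFractionRing.to_map_ne_zero_of_mem_nonZeroDivisors
      (mem_nonZeroDivisors_of_ne_zero Polynomial.X_ne_zero)
  refine ⟨d, fun ω => ?_, ?_⟩
  · refine functional_kaehlerMap_eq_zero (A := S.presheaf.stalk (π y)) (fieldMap π)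
      (fieldMap_complex π) d (fun a => ?_) ω
    refine (congrArg (fun g => d (KaehlerDifferential.D ℂ Y.functionField g))
      (fieldMap_algebraMap π y a)).trans (hd' a)
  · rw [dlogForm, map_smul, ← hX, hd, hX]
    exact mul_ne_zero (inv_ne_zero ht) one_ne_zero

lemma dlogForm_coord {f : S.functionField} (hf : f ≠ 0)
    (hτ : fieldMap π f * algebraMap _ Y.functionField t = τ) :
    dlogForm τ = formMap π (dlogForm f) + dlogForm (algebraMap _ Y.functionField t) := by
  have ht : algebraMap (Y.presheaf.stalk y) Y.functionField t ≠ 0 := by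
    rw [Ne, FaithfulSMul.algebraMap_eq_zero_iff]
    exact fun h0 => Polynomial.X_ne_zero
      (h.injective ((lineHom_X _ _ _).trans (h0.trans (map_zero _).symm)))
  rw [← hτ, dlogForm_mul ((map_ne_zero _).mpr hf) ht, formMap_dlogForm]

lemma linearIndependent_extForm {f : S.functionField} (hf : f ≠ 0)
    (hτ : fieldMap π f * algebraMap _ Y.functionField t = τ) :
    LinearIndependent Y.functionField fun j =>
      extForm π τ (b.prod (Module.Basis.singleton Unit S.functionField) j) := by
  obtain ⟨d, hd, hd'⟩ := exists_functional h
  refine linearIndependent_prod_unit (extForm π τ) b ?_ d (fun v => ?_) ?_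
  · have e : (fun j => extForm π τ (b j, 0)) = fun j => formMap π (b j) := funext fun j => by
      rw [extForm_apply, map_zero, zero_smul, add_zero]
    rw [e]
    exact linearIndependent_formMap h b
  · rw [extForm_apply, map_zero, zero_smul, add_zero, hd]
  · rw [extForm_apply, map_zero, zero_add, map_one, one_smul, dlogForm_coord τ h hf hτ, map_add, hd,
      zero_add]
    exact hd'

end Independence

variable {π C τ B G}

/-- Since `dlog τ = π^* dlog (f i) + dlog t`, the form equals `π^* (ω + r dlog (f i)) + r dlog t`.
By the definition of `extStalks`, the first term comes from `B` and the second has a regular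
coefficient. -/
lemma IsLogLine.extForm_mem (h : IsLogLine π C τ B G) (y : Y)
    (v : RatForms S × S.functionField) (hv : v ∈ (extStalks C B).stalk (π y)) :
    extForm π τ v ∈ G y := by
  obtain ⟨i, hi⟩ := C.exists_mem (π y)
  obtain ⟨t, ht, hτ, hG, -⟩ := h.exists_coord y i hi
  obtain ⟨⟨r, hr⟩, hv⟩ := hv
  have e : extForm π τ v = formMap π (v.1 + v.2 • dlogForm (C.f i : S.functionField)) +
      π.stalkMap y r • dlogForm (algebraMap _ Y.functionField t) := by
    rw [extForm_apply, dlogForm_coord τ ht (Units.ne_zero _) hτ, map_add, formMap_smul, smul_add,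
      add_assoc, ← algebraMap_smul Y.functionField (π.stalkMap y r), ← fieldMap_algebraMap_stalk, ← hr]
  rw [e]
  exact add_mem (h.formMap_mem y _ (hv i hi)) (Submodule.smul_mem _ _ hG)

/-- The comparison of the extension on the base with the logarithmic forms. -/
def IsLogLine.hom (h : IsLogLine π C τ B G) :
    latticeSheaf (extStalks C B) ⟶ (Scheme.Modules.pushforward π).obj (formSheaf G) :=
  SheafOfModules.Hom.mk (PresheafOfModules.homMk
    { app := fun U => AddCommGrpCat.ofHom
        { toFun := fun s => (show formSections G (π ⁻¹ᵁ U.unop) from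
            ⟨fun y => extForm π τ ((show latticeSections (extStalks C B) U.unop from s).1 ⟨π y.1, y.2⟩),
            fun y => by
              obtain ⟨V, hV, m, hm⟩ :=
                (show latticeSections (extStalks C B) U.unop from s).2 ⟨π y.1, y.2⟩
              exact ⟨π ⁻¹ᵁ V, hV, extForm π τ m, fun z hz =>
                ⟨h.extForm_mem z.1 m (hm ⟨π z.1, z.2⟩ hz).1, congrArg _ (hm ⟨π z.1, z.2⟩ hz).2⟩⟩⟩)
          map_zero' := by
            apply Subtype.ext; funext y
            exact map_zero (extForm π τ)
          map_add' := fun s t => by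
            apply Subtype.ext; funext y
            exact map_add (extForm π τ) _ _ }
      naturality := by intro U V i; rfl }
    (by
      intro U r m
      apply Subtype.ext; funext y
      change extForm π τ (toField (U := U.unop) r (π y.1) y.2 • _) =
        toField (U := π ⁻¹ᵁ U.unop) (π.app U.unop r) y.1 y.2 • extForm π τ _
      rw [extForm_smul]
      exact congrArg (· • _) (fieldMap_toField π (U := U.unop) r y.1 y.2)))

/-- The comparison of the pull-back of the extension with the logarithmic forms. -/
def IsLogLine.pullbackHom (h : IsLogLine π C τ B G) :
    (Scheme.Modules.pullback π).obj (latticeSheaf (extStalks C B)) ⟶ formSheaf G :=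
  ((Scheme.Modules.pullbackPushforwardAdjunction π).homEquiv _ _).symm h.hom

lemma IsLogLine.pullbackHom_pullSection (h : IsLogLine π C τ B G) {U : S.Opens}
    (s : Γ(latticeSheaf (extStalks C B), U)) (y : Y) (hy : π y ∈ U) :
    (formFieldValued G).val (U := π ⁻¹ᵁ U) y hy (h.pullbackHom.app (π ⁻¹ᵁ U) (pullSection π _ s)) =
      extForm π τ ((latticeFieldValued _).val (π y) hy s) :=
  congrArg ((formFieldValued G).val (U := π ⁻¹ᵁ U) y hy) (homEquiv_symm_app_pullSection π _ h.hom s)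

lemma IsLogLine.map_extInl_pullbackHom (h : IsLogLine π C τ B G) :
    (Scheme.Modules.pullback π).map (extInl C B) ≫ h.pullbackHom =
      ((Scheme.Modules.pullbackPushforwardAdjunction π).homEquiv _ _).symm
        (formHom π B G h.formMap_mem) := by
  rw [IsLogLine.pullbackHom, ← Adjunction.homEquiv_naturality_left_symm]
  congr 1
  ext U s
  apply Subtype.ext; funext y
  change formMap π _ + fieldMap π 0 • dlogForm τ = formMap π _
  rw [map_zero, zero_smul, add_zero]
  rfl

lemma IsLogLine.mono_pullbackHom [Flat π] (h : IsLogLine π C τ B G) : Mono h.pullbackHom := by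
  obtain ⟨i, hi⟩ := C.exists_mem (π (genericPoint Y))
  obtain ⟨t, ht, hτ, -, -⟩ := h.exists_coord _ i hi
  exact mono_of_pullback (latticeFieldValued _) (formFieldValued G) h.pullbackHom (extForm π τ)
    (extForm_smul π τ) (fun s y hy => h.pullbackHom_pullSection s y hy) _
    (linearIndependent_extForm τ ht (Module.Basis.ofVectorSpace _ _) (Units.ne_zero _) hτ)

lemma IsLogLine.mono_formHom [Flat π] (h : IsLogLine π C τ B G) :
    Mono (((Scheme.Modules.pullbackPushforwardAdjunction π).homEquiv _ _).symm
        (formHom π B G h.formMap_mem)) := by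
  obtain ⟨i, hi⟩ := C.exists_mem (π (genericPoint Y))
  obtain ⟨t, ht, hτ, -, -⟩ := h.exists_coord _ i hi
  refine mono_of_pullback (formFieldValued B) (formFieldValued G) _ (formMap π)
    (formMap_smul π) (fun {U} s y hy => ?_) _
    (linearIndependent_formMap ht (Module.Basis.ofVectorSpace _ _))
  exact congrArg ((formFieldValued G).val (U := π ⁻¹ᵁ U) y hy)
    (homEquiv_symm_app_pullSection π _ (formHom π B G h.formMap_mem) s)

/-- Both kinds of generators of `G` are values of sections of the extension: forms from the base,
which by `hB` extend to sections near the point, and `dlog t`, which is the image of the local lift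
of `1`. -/
lemma IsLogLine.epi_pullbackHom (h : IsLogLine π C τ B G)
    (hN : ∀ x i j, x ∈ C.U i → x ∈ C.U j →
      -dlogForm (C.f i : S.functionField) + dlogForm (C.f j : S.functionField) ∈ B x)
    (hB : ∀ x, ∀ m ∈ B x, ∃ W : S.Opens, x ∈ W ∧ ∀ x' ∈ W, m ∈ B x') : Epi h.pullbackHom := by
  refine epi_of_pullback (latticeFieldValued _) h.pullbackHom (formFieldValued G) (extForm π τ)
    (fun s y hy => h.pullbackHom_pullSection s y hy) fun s y hy => ?_
  obtain ⟨i, hi⟩ := C.exists_mem (π y)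
  obtain ⟨t, ht, hτ, -, hG⟩ := h.exists_coord y i hi
  refine Submodule.span_mono ?_ (hG (formFieldValued_mem G s y hy))
  rintro _ (⟨m, hm, rfl⟩ | rfl)
  · obtain ⟨W, hW, hm⟩ := hB _ m hm
    refine ⟨W, hW, (extInl C B).app W (show formSections B W from ⟨fun _ => m, fun x =>
      ⟨W, x.2, m, fun z hz => ⟨hm _ hz, rfl⟩⟩⟩), ?_⟩
    change formMap π m = formMap π m + fieldMap π 0 • dlogForm τ
    rw [map_zero, zero_smul, add_zero]
  · refine ⟨C.U i, hi, extLift C B hN i le_rfl, ?_⟩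
    change _ = formMap π (-dlogForm _) + fieldMap π 1 • dlogForm τ
    rw [map_one, one_smul, dlogForm_coord τ ht (Units.ne_zero (C.f i)) hτ, map_neg,
      neg_add_cancel_left]

end LogLine

/-! ### The covering of the total space as a logarithmic line. -/

lemma fieldMap_comp {X Y Z : Scheme.{0}} [IsIntegral X] [IsIntegral Y] [IsIntegral Z] (f : Z ⟶ Y)
    (g : Y ⟶ X) [IsDominant f] [IsDominant g] [IsDominant (f ≫ g)] (a : X.functionField) :
    fieldMap (f ≫ g) a = fieldMap f (fieldMap g a) := by
  obtain ⟨b, c, -, rfl⟩ := IsFractionRing.div_surjective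
    (A := X.presheaf.stalk (g (f (genericPoint Z)))) a
  have key : ∀ (z : Z) (b : X.presheaf.stalk (g (f z))),
      fieldMap (f ≫ g) (algebraMap _ X.functionField b) =
        fieldMap f (fieldMap g (algebraMap _ X.functionField b)) := fun z b => by
    refine (fieldMap_algebraMap (f ≫ g) z b).trans ?_
    refine Eq.trans ?_ (congrArg (fieldMap f) (fieldMap_algebraMap g (f z) b)).symm
    refine Eq.trans ?_ (fieldMap_algebraMap f z _).symm
    exact congrArg (algebraMap _ Z.functionField)
      (ConcreteCategory.congr_hom (Scheme.Hom.stalkMap_comp f g z) b)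
  rw [map_div₀, map_div₀, map_div₀, key, key]

lemma fieldMap_congr {X Y : Scheme.{0}} [IsIntegral X] [IsIntegral Y] {f g : Y ⟶ X} [IsDominant f]
    [IsDominant g] (h : f = g) (a : X.functionField) : fieldMap f a = fieldMap g a := by
  subst h
  rfl

lemma stalkMap_germ_appLE {X Y : Scheme.{0}} (f : Y ⟶ X) (U : X.Opens) (V : Y.Opens)
    (e : V ≤ f ⁻¹ᵁ U) (y : Y) (hy : y ∈ V) (s : Γ(X, U)) :
    f.stalkMap y (X.presheaf.germ U (f y) (e hy) s) = Y.presheaf.germ V y hy (f.appLE U V e s) :=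
  (Scheme.Hom.germ_stalkMap_apply f U y (e hy) s).trans
    (Y.presheaf.germ_res_apply (homOfLE e) y hy (f.app U s)).symm

namespace CartierDivisor

section Cover

variable {S₁ S₂ : Scheme.{0}} [IsIntegral S₁] (L : CartierDivisor S₁) (σ : S₂ ⟶ S₁)

/-- The total space is its own base change along the identity, and such fibre products of the
geometrically integral projection are integral. -/
lemma isIntegral_totalSpace [IsLocallyNoetherian S₁] : IsIntegral L.totalSpace := by
  have : IsIntegral (Limits.pullback (𝟙 S₁) L.proj) := inferInstance
  have : Nonempty L.totalSpace := ⟨Limits.pullback.snd (𝟙 S₁) L.proj (genericPoint _)⟩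
  exact isIntegral_of_isOpenImmersion (inv (Limits.pullback.snd (𝟙 S₁) L.proj))

instance [Surjective σ] : Surjective (L.coverMap σ) :=
  inferInstanceAs (Surjective (Limits.pullback.snd σ L.proj))

instance : Flat (L.coverProj σ) :=
  inferInstanceAs (Flat (Limits.pullback.fst σ L.proj))

lemma coverMap_proj : L.coverMap σ ≫ L.proj = L.coverProj σ ≫ σ := Limits.pullback.condition.symm

lemma isPullback_cover : IsPullback (L.coverMap σ) (L.coverProj σ) L.proj σ :=
  (IsPullback.of_hasPullback σ L.proj).flip

variable {L σ} [IsIntegral S₂] [IsIntegral L.totalSpace] [IsIntegral (L.coverTotal σ)]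
  [IsDominant σ] [IsDominant (L.coverMap σ)]

/-- The coordinate of the bundle near the image of `y` is also a coordinate after base change. It
cuts out `E` set-theoretically by `hE`; because it generates a radical ideal on both total spaces,
it is a local equation there. -/
lemma exists_isLineSquare {E : Set L.totalSpace}
    (hE : ∀ (U : S₁.Opens) (hU : IsAffineOpen U) (i : L.ι) (h : U ≤ L.U i) (τ : L.totalSpace),
      L.proj τ ∈ U → (τ ∈ E ↔ τ ∉ L.totalSpace.basicOpen (L.coordSection hU h)))
    (y : L.coverTotal σ) (i : L.ι) (hi : σ (L.coverProj σ y) ∈ L.U i) :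
    ∃ t, IsLineSquare (L.coverMap σ) (L.coverProj σ) L.proj E y t ∧
      fieldMap (L.coverProj σ) ((L.pullback σ).f i) *
        algebraMap _ (L.coverTotal σ).functionField ((L.coverMap σ).stalkMap y t) =
          fieldMap (L.coverMap σ) L.fiberCoord := by
  set q := L.coverMap σ
  set π := L.coverProj σ
  have hsq : ∀ z, L.proj (q z) = σ (π z) := fun z => by
    rw [← Scheme.Hom.comp_apply, ← Scheme.Hom.comp_apply, L.coverMap_proj]
  obtain ⟨_, ⟨U, hU, rfl⟩, hyU, hUi⟩ :=
    S₁.isBasis_affineOpens.exists_subset_of_mem_open hi (L.U i).2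
  obtain ⟨_, ⟨V, hV, rfl⟩, hyV, hVU⟩ :=
    S₂.isBasis_affineOpens.exists_subset_of_mem_open (show π y ∈ σ ⁻¹ᵁ U from hyU) (σ ⁻¹ᵁ U).2
  have hyU' : L.proj (q y) ∈ U := by rw [hsq]; exact hyU
  have hle : π ⁻¹ᵁ V ≤ q ⁻¹ᵁ (L.proj ⁻¹ᵁ U) := fun z hz => by
    change L.proj (q z) ∈ U
    rw [hsq]
    exact hVU hz
  have hline := L.isAffineLine hU hUi ⟨_, hyU⟩
  have hline' := hline.baseChange (L.isPullback_cover σ) hV hVU hle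
  let s := L.coordSection hU hUi
  let t := L.totalSpace.presheaf.germ (L.proj ⁻¹ᵁ U) (q y) hyU' s
  have hfr : IsFractionHom (lineHom L.proj (q y) t) := hline.isFractionHom hyU'
  have e : q.stalkMap y t =
      (L.coverTotal σ).presheaf.germ (π ⁻¹ᵁ V) y hyV (q.appLE (L.proj ⁻¹ᵁ U) (π ⁻¹ᵁ V) hle s) :=
    stalkMap_germ_appLE q (L.proj ⁻¹ᵁ U) (π ⁻¹ᵁ V) hle y hyV s
  have hfr' : IsFractionHom (lineHom π y (q.stalkMap y t)) := by
    rw [e]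
    exact hline'.isFractionHom hyV
  refine ⟨t, ⟨hfr, hfr', ?_, ?_⟩, ?_⟩
  · have h1 := idealOf_eq_of_basicOpen (Z := E) (U := L.proj ⁻¹ᵁ U) s hyU'
      (fun τ hτ => hE U hU i hUi τ hτ)
    rw [hfr.isRadical_span.radical] at h1
    exact h1.symm
  · have h1 := idealOf_eq_of_basicOpen (Z := q ⁻¹' E) (U := π ⁻¹ᵁ V)
      (q.appLE (L.proj ⁻¹ᵁ U) (π ⁻¹ᵁ V) hle s) hyV (fun z hz => by
        rw [Scheme.basicOpen_appLE]
        refine (hE U hU i hUi (q z) (hle hz)).trans (not_congr ?_)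
        exact (and_iff_right hz).symm)
    rw [← e, hfr'.isRadical_span.radical] at h1
    exact h1.symm
  · have h1 := congrArg (fieldMap q) (L.fieldMap_mul_coordSection hU hUi (q y) hyU')
    rw [map_mul] at h1
    refine Eq.trans (congrArg₂ (· * ·) ?_ ?_) h1
    · have : IsDominant (q ≫ L.proj) := inferInstance
      have : IsDominant (π ≫ σ) := inferInstance
      exact (fieldMap_comp π σ _).symm.trans
        ((fieldMap_congr (L.coverMap_proj σ).symm _).trans (fieldMap_comp q L.proj _))
    · exact (fieldMap_algebraMap q y t).symm

/-- The fibre product of a line bundle with a covering is a logarithmic line over the covering. -/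
lemma isLogLine [S₂.Over SpecC] [IsLocallyNoetherian S₂] {E : Set L.totalSpace}
    (hE : ∀ (U : S₁.Opens) (hU : IsAffineOpen U) (i : L.ι) (h : U ≤ L.U i) (τ : L.totalSpace),
      L.proj τ ∈ U → (τ ∈ E ↔ τ ∉ L.totalSpace.basicOpen (L.coordSection hU h)))
    {ι : Type} {D : ι → Set S₁} {δ : ι → ℚ} (hD : ∀ i, IsClosed (D i))
    (hD' : ∀ i x, ∃ z, IsLocalEquation (D i) x z)
    (hσ : ∀ i x, ∃ z, IsLocalEquation (σ ⁻¹' D i) x z) (hδ : ∀ i, δ i ≤ 1) :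
    IsLogLine (L.coverProj σ) (L.pullback σ) (fieldMap (L.coverMap σ) L.fiberCoord)
      (orbCotangent σ D δ) (orbCotangent (L.coverMap σ)
        (fun j : Option ι => j.elim E fun i => L.proj ⁻¹' D i) fun j : Option ι => j.elim 1 δ) := by
  have w := L.coverMap_proj σ
  refine ⟨fun y => ?_, fun y i hi => ?_⟩
  · obtain ⟨i, hi⟩ := L.exists_mem (σ (L.coverProj σ y))
    obtain ⟨t, ht, -⟩ := exists_isLineSquare hE y i hi
    exact formMap_orbCotangent w ht hD
  · obtain ⟨t, ht, hτ⟩ := exists_isLineSquare hE y i hi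
    exact ⟨_, ht.fraction, hτ, dlogForm_mem_orbCotangent ht,
      orbCotangent_le_lineForms w ht hD hD' hσ hδ⟩

end Cover

end CartierDivisor

/-! ### Conclusion. -/

lemma IsLogLine.exists_extension {S Y : Scheme.{0}} [IsIntegral S] [IsIntegral Y] [S.Over SpecC]
    [Y.Over SpecC] {π : Y ⟶ S} [IsDominant π] [π.IsOver SpecC] [Flat π] {C : CartierDivisor S}
    {τ : Y.functionField} {B : FormStalks S} {G : FormStalks Y} (h : IsLogLine π C τ B G)
    (hN : ∀ x i j, x ∈ C.U i → x ∈ C.U j →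
      -dlogForm (C.f i : S.functionField) + dlogForm (C.f j : S.functionField) ∈ B x)
    (hB : ∀ x, ∀ m ∈ B x, ∃ W : S.Opens, x ∈ W ∧ ∀ x' ∈ W, m ∈ B x')
    (i₀ : S ⟶ Y) (hi : i₀ ≫ π = 𝟙 S) :
    ∃ (β : formSheaf G ⟶ structureSheaf Y),
      let α : (Scheme.Modules.pullback π).obj (formSheaf B) ⟶ formSheaf G :=
        ((Scheme.Modules.pullbackPushforwardAdjunction π).homEquiv _ _).symm
          (formHom π B G h.formMap_mem)
      let a : formSheaf B ⟶ (Scheme.Modules.pullback i₀).obj (formSheaf G) :=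
        restrictHom i₀ π hi α
      let b : (Scheme.Modules.pullback i₀).obj (formSheaf G) ⟶ structureSheaf S :=
        (Scheme.Modules.pullback i₀).map β ≫ pullbackUnit i₀
      (∃ w : α ≫ β = 0, (ShortComplex.mk α β w).ShortExact) ∧
      (∃ w : a ≫ b = 0, (ShortComplex.mk a b w).ShortExact) ∧
      (∃ e : (Scheme.Modules.pullback π).obj ((Scheme.Modules.pullback i₀).obj (formSheaf G)) ≅
          formSheaf G,
        (Scheme.Modules.pullback π).map a ≫ e.hom = α ∧
        e.hom ≫ β = (Scheme.Modules.pullback π).map b ≫ pullbackUnit π) ∧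
      ∀ ξ, IsExtensionClass (extInl C B) (extProj C B) ξ → IsExtensionClass a b ξ := by
  have := h.mono_pullbackHom
  have := h.epi_pullbackHom hN hB
  have : IsIso h.pullbackHom := isIso_of_mono_of_epi _
  have := h.mono_formHom
  exact extension_of_pullback_iso π i₀ hi (extInl C B) (extProj C B) (extInl_extProj C B)
    (ext_shortExact C B hN) (asIso h.pullbackHom) _ h.map_extInl_pullbackHom

end LogCone

end

theorem mainTheorem9
    {S S₁ S₂ : Scheme.{0}} [IsIntegral S] [IsIntegral S₁] [IsIntegral S₂]
    [S.Over SpecC] [S₁.Over SpecC] [S₂.Over SpecC]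
    [IsProper (S ↘ SpecC)] (hS : ∀ x : S, IsIntegrallyClosed (S.presheaf.stalk x))
    (L : CartierDivisor S) (hL : L.IsAmple)
    {ι : Type} [Finite ι] (Δ : ι → Set S) (hΔ : ∀ i, IsPrimeDivisor (Δ i))
    (hΔ' : Function.Injective Δ) (δ : ι → ℚ) (hδ : ∀ i, 0 ≤ δ i ∧ δ i ≤ 1)
    (μ : S₁ ⟶ S) [μ.IsOver SpecC] [IsModification μ] [Smooth (S₁ ↘ SpecC)]
    {κ : Type} [Finite κ] (H : κ → Set S₁)
    (hH : IsSNC (Sum.elim (fun i => strictTransform μ (Δ i)) H))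
    (σ : S₂ ⟶ S₁) [σ.IsOver SpecC] [Surjective σ] [Smooth (S₂ ↘ SpecC)]
    (N : ℕ) (hN : 0 < N)
    (hσ : IsKawamataCover σ (Sum.elim (fun i => strictTransform μ (Δ i)) H) N)
    (hNδ : ∀ i, ∃ m : ℕ, (m : ℚ) = N * δ i) :
    let M : CartierDivisor S₁ := L.pullback μ
    let D : ι → Set S₁ := fun i => strictTransform μ (Δ i)
    let i₀ : S₂ ⟶ M.coverTotal σ := M.coverZero σ
    let π : M.coverTotal σ ⟶ S₂ := M.coverProj σ
    let B : FormStalks S₂ := orbCotangent σ D δ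
    let G : FormStalks (M.coverTotal σ) := orbCotangent (M.coverMap σ)
      (fun j : Option ι => j.elim (L.exceptional μ) fun i => M.proj ⁻¹' D i)
      (fun j : Option ι => j.elim 1 δ)
    ∃ (h : ∀ y, ∀ m ∈ B (π y), formMap π m ∈ G y)
      (β : formSheaf G ⟶ structureSheaf (M.coverTotal σ)),
      let α : (Scheme.Modules.pullback π).obj (formSheaf B) ⟶ formSheaf G :=
        ((Scheme.Modules.pullbackPushforwardAdjunction π).homEquiv _ _).symm (formHom π B G h)
      let a : formSheaf B ⟶ (Scheme.Modules.pullback i₀).obj (formSheaf G) :=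
        restrictHom i₀ π (M.coverZero_coverProj σ) α
      let b : (Scheme.Modules.pullback i₀).obj (formSheaf G) ⟶ structureSheaf S₂ :=
        (Scheme.Modules.pullback i₀).map β ≫ pullbackUnit i₀
      (∃ w : α ≫ β = 0, (ShortComplex.mk α β w).ShortExact) ∧
      (∃ w : a ≫ b = 0, (ShortComplex.mk a b w).ShortExact) ∧
      (∃ e : (Scheme.Modules.pullback π).obj ((Scheme.Modules.pullback i₀).obj (formSheaf G)) ≅
          formSheaf G,
        (Scheme.Modules.pullback π).map a ≫ e.hom = α ∧
        e.hom ≫ β = (Scheme.Modules.pullback π).map b ≫ pullbackUnit π) ∧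
      IsExtensionClass a b (chernMap σ D δ M.c1) := by
  intro M D i₀ π B G
  have : IsLocallyNoetherian S₁ := LocallyOfFiniteType.isLocallyNoetherian (S₁ ↘ SpecC)
  have : IsLocallyNoetherian S₂ := LocallyOfFiniteType.isLocallyNoetherian (S₂ ↘ SpecC)
  have : IsIntegral M.totalSpace := M.isIntegral_totalSpace
  have hμ : IsProper μ := IsModification.proper
  have hS₁ : IsProper (S₁ ↘ SpecC) := comp_over μ SpecC ▸ inferInstance
  -- Compactness of both schemes yields local equations at all points from the normal crossing
  -- conditions at closed points.
  have : CompactSpace S₁ := QuasiCompact.compactSpace_of_compactSpace (S₁ ↘ SpecC)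
  have := hσ.finite
  have : CompactSpace S₂ := QuasiCompact.compactSpace_of_compactSpace σ
  have hD : ∀ i, IsClosed (D i) := fun i => hH.1 (Sum.inl i)
  have hline : IsLogLine π (M.pullback σ) (fieldMap (M.coverMap σ) M.fiberCoord) B G := by
    refine CartierDivisor.isLogLine (fun U hU i h τ hτ =>
      L.mem_exceptional_iff_notMem_basicOpen μ hL hU h hτ) hD
      (fun i => hH.exists_isLocalEquation (Sum.inl i))
      (fun i => hσ.snc.exists_isLocalEquation (Sum.inl i)) fun i => (hδ i).2
  obtain ⟨β, h1, h2, h3, h4⟩ := hline.exists_extension (dlogForm_sub_mem σ D δ M)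
    (exists_orbCotangent_mem σ D hD δ) i₀ (M.coverZero_coverProj σ)
  exact ⟨hline.formMap_mem, β, h1, h2, h3, h4 _ (isExtensionClass_chernMap σ D δ M)⟩
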